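/- **Notation.** Let $\rho\in(0,+\infty)$ and $q=[\rho]$ (integer part). For a positive Borel measure $\mu$ on $\mathbb C$ put $$\mu^{\mathrm{rad}}(t)=\mu(\{|z|\le t\}),\qquad N_\mu(t)=\int_0^t\frac{\mu^{\mathrm{rad}}(s)}{s}\,ds\in[0,+\infty].$$ For a function $f$ on $(0,+\infty)$ with values in $[-\infty,+\infty]$ put $\mathrm{type}_\rho[f]=\limsup_{r\to+\infty} f^+(r)/r^\rho\in[0,+\infty]$, where $f^+=\max\{f,0\}$. Put $\mathrm{type}_\rho[\mu]=\mathrm{type}_\rho[\mu^{\mathrm{rad}}]$, and for a subharmonic function $u$ on $\mathbb C$ put $\mathrm{type}_\rho[u]=\mathrm{type}_\rho[M_u]$, where $M_u(r)=\max_{|z|=r}u(z)$. If $u\not\equiv-\infty$, its Riesz measure is $\mu_u=\frac1{2\pi}\Delta u$, in the sense of distributions. The Weierstrass primary kernel of genus $q$ is $$K_q(z)=\ln|1-z|+\sum_{k=1}^q\mathrm{Re}\,\frac{z^k}{k}\in[-\infty,+\infty),$$ and $\mathcal M_q(r)=\max_{|z|=r}K_q(z)$ for $r\ge0$. The function $\mathcal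 M_q$ is nonnegative, increasing and convex as a function of $\ln r$; $\mathcal M_q'$ denotes its right derivative, and $t\mapsto t\,\mathcal M_q'(t)$ is nonnegative and increasing. Put $$S(\rho)=\int_0^{+\infty}r^{-\rho}\mathcal M_q'(r)\,dr .$$ **Theorem.** Let $\rho\in(0,+\infty)$ and $q=[\rho]$. Let $\mu$ be a positive Borel measure on $\mathbb C$ with $0\notin\operatorname{supp}\mu$ and $\mathrm{type}_\rho[\mu]<+\infty$. Then for every $z\in\mathbb C$ the canonical Hadamard–Weierstrass integral $$U_q^\mu(z)=\int_{\mathbb C}K_q\!\left(\frac zw\right)d\mu(w)\in[-\infty,+\infty)$$ is well defined (the positive part of the integrand has a finite integral), and with $r=|z|$ the following holds. 1. $$U_q^\mu(z)\le\int_0^{+\infty}\mathcal M_q\!\left(\frac rt\right)d\mu^{\mathrm{rad}}(t)=\int_0^{+\infty}\mu^{\mathrm{rad}}\!\left(\frac rt\right)\mathcal M_q'(t)\,dt<+\infty .$$ 2. $$U_q^\mu(z)\le\int_0^{+\infty}\frac rt\,\mathcal M_q'\!\left(\frac rt\right)dN_\mu(t)=\int_0^{+\infty}N_\mu\!\left(\frac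 rt\right)d\bigl(t\,\mathcal M_q'(t)\bigr)<+\infty .$$ 3. If $\rho$ is not an integer, then $S(\rho)<+\infty$, and for every subharmonic function $u\not\equiv-\infty$ on $\mathbb C$ with $\mathrm{type}_\rho[u]<+\infty$ and Riesz measure $\mu_u$, $$\mathrm{type}_\rho[u]\le S(\rho)\,\mathrm{type}_\rho[\mu_u],\qquad \mathrm{type}_\rho[u]\le\rho\,S(\rho)\,\mathrm{type}_\rho[N_{\mu_u}].$$ -/

import Mathlib

open MeasureTheory Set Filter Metric
open scoped ENNReal ContDiff

noncomputable section

namespace Valiron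

/-- The integral `∫ f dμ ∈ [-∞, +∞]` of an extended-real function, as the difference of the
integrals of its positive and negative parts. It is used only for functions whose positive part
has a finite integral, so the form `∞ - ∞` never occurs. -/
def eintegral {α : Type*} [MeasurableSpace α] (μ : Measure α) (f : α → EReal) : EReal :=
  ((∫⁻ x, (f x).toENNReal ∂μ : ℝ≥0∞) : EReal) - ((∫⁻ x, (-f x).toENNReal ∂μ : ℝ≥0∞) : EReal)

/-- The maximum of `u` over the circle `|z| = r`. -/
def circleMax (u : ℂ → EReal) (r : ℝ) : EReal := ⨆ z ∈ sphere (0 : ℂ) r, u z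

/-- `type_ρ[f] = limsup_{r → +∞} f⁺(r) / r^ρ ∈ [0, +∞]`; here `toENNReal` is the positive part. -/
def growthType (ρ : ℝ) (f : ℝ → EReal) : ℝ≥0∞ :=
  limsup (fun r : ℝ => (f r).toENNReal / ENNReal.ofReal (r ^ ρ)) atTop

/-- The counting function `μ^rad(t) = μ {|z| ≤ t}`. -/
def radialCount (μ : Measure ℂ) (t : ℝ) : ℝ≥0∞ := μ (closedBall 0 t)

/-- The averaged counting function `N_μ(t) = ∫_0^t μ^rad(s) / s ds ∈ [0, +∞]`. -/
def averagedCount (μ : Measure ℂ) (t : ℝ) : ℝ≥0∞ :=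
  ∫⁻ s in Ioc 0 t, radialCount μ s / ENNReal.ofReal s

/-- The type of a measure at order `ρ`. -/
def measureType (ρ : ℝ) (μ : Measure ℂ) : ℝ≥0∞ := growthType ρ (fun t => (radialCount μ t : EReal))

/-- The type of the averaged counting function of a measure at order `ρ`. -/
def averagedType (ρ : ℝ) (μ : Measure ℂ) : ℝ≥0∞ :=
  growthType ρ (fun t => (averagedCount μ t : EReal))

/-- The type of a function on the plane at order `ρ`. -/
def functionType (ρ : ℝ) (u : ℂ → EReal) : ℝ≥0∞ := growthType ρ (circleMax u)

/-- The Weierstrass primary kernel `K_q(z) = ln|1 - z| + ∑_{k=1}^q Re (z^k / k)`, with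
`K_q(1) = -∞`. -/
def primaryKernel (q : ℕ) (z : ℂ) : EReal :=
  ENNReal.log ‖1 - z‖ₑ + ((∑ k ∈ Finset.Icc 1 q, (z ^ k / (k : ℂ)).re : ℝ) : EReal)

/-- The canonical Hadamard–Weierstrass integral `U_q^μ(z) = ∫ K_q(z / w) dμ(w)`. -/
def canonicalIntegral (q : ℕ) (μ : Measure ℂ) (z : ℂ) : EReal :=
  eintegral μ (fun w => primaryKernel q (z / w))

/-- `M_q(r) = max_{|z| = r} K_q(z)`, a nonnegative real number for `r ≥ 0`. -/
def kernelMax (q : ℕ) (r : ℝ) : ℝ := (circleMax (primaryKernel q) r).toReal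

/-- The right derivative `M_q'` of `M_q`, nonnegative on `(0, +∞)`. -/
def kernelMaxDeriv (q : ℕ) (r : ℝ) : ℝ := derivWithin (kernelMax q) (Ioi r) r

open Classical in
/-- The Lebesgue–Stieltjes measure `df` on `(0, +∞)` of a function increasing on `[0, +∞)`
(and `0` for a function which is not increasing). -/
def stieltjesMeasure (f : ℝ → ℝ) : Measure ℝ :=
  if h : Monotone (fun t : ℝ => f (max t 0)) then
    h.stieltjesFunction.measure.restrict (Ioi 0)
  else 0

/-- `S(ρ) = ∫_0^∞ r^{-ρ} M_q'(r) dr` with `q = [ρ]`, as an element of `[0, +∞]`. -/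
def valironConstant (ρ : ℝ) : ℝ≥0∞ :=
  ∫⁻ r in Ioi (0 : ℝ), ENNReal.ofReal (r ^ (-ρ) * kernelMaxDeriv ⌊ρ⌋₊ r)

/-- The mean value of `u` over the circle of centre `z` and radius `r`. -/
def circleMean (u : ℂ → EReal) (z : ℂ) (r : ℝ) : EReal :=
  eintegral ((ENNReal.ofReal (2 * Real.pi))⁻¹ • volume.restrict (Ioc 0 (2 * Real.pi)))
    (fun θ : ℝ => u (circleMap z r θ))

/-- Subharmonic functions on the whole plane, with values in `[-∞, +∞)`. The function
identically `-∞` is allowed. -/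
structure IsSubharmonic (u : ℂ → EReal) : Prop where
  lt_top : ∀ z, u z < ⊤
  upperSemicontinuous : UpperSemicontinuous u
  le_circleMean : ∀ z, ∀ r : ℝ, 0 < r → u z ≤ circleMean u z r

/-- `μ` is the Riesz measure `(1 / 2π) Δu` of `u`, the Laplacian being that of distributions:
`∫ u Δφ dA = 2π ∫ φ dμ` for all real test functions `φ`. -/
structure IsRieszMeasure (u : ℂ → EReal) (μ : Measure ℂ) : Prop where
  locallyFinite : IsLocallyFiniteMeasure μ
  integral_laplacian : ∀ φ : ℂ → ℝ, ContDiff ℝ ∞ φ → HasCompactSupport φ →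
    ∫ z, (u z).toReal * Laplacian.laplacian φ z = 2 * Real.pi * ∫ z, φ z ∂μ

end Valiron

end

open Valiron

noncomputable section

namespace Valiron

/-! Everything rests on the pointwise bound `K_q(z/w) ≤ M_q(|z|/|w|)` and on the nature of `M_q` as
the logarithm of the maximum modulus of the entire function `E_q`. The maximum principle makes `M_q`
increasing. The three circles theorem makes it convex in `ln r`, so that `t M_q'(t)` is increasing
and at most `M_q(e t)`. Size estimates complete the picture: `M_q(x) = O(x^(q+1))` for all `x ≥ 0`,
and `M_q(x) = O(x^p)` for `x ≥ 1` whenever `p ≥ q`, `p > 0`.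

For the canonical integral, write `M_q(r/|w|)` as the integral of `M_q'` over `(0, r/|w|]` and
exchange integrals. The averaged version exchanges integrals once more, against `d(t M_q'(t))`, and
substitutes `t = r/x`. All the majorants are thus the single number `∫ M_q(r/|w|) dμ(w)`, which is
finite because `ρ < q + 1` makes `|w|^(-q-1)` integrable (`lintegral_norm_rpow_neg_lt_top`).

For a subharmonic `u` of finite type, `0` may lie in the support of its Riesz measure, so the
potential uses `ln|z - w|` for `|w| ≤ 1` and `K_q(z/w)` outside. Both `u` and the potential are
mollified by one fixed radial bump supported in the unit disc. The two mollifications have the same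
Laplacian, so their difference is harmonic. Both are `O(|z|^ρ)` from above, and the sub-mean value
inequality at `0` turns this into a bound for the `L¹` means of the difference on circles. A
Liouville argument then makes the difference `O(|z|^q)` (`exists_abs_sub_le_of_harmonic`). Since `u`
lies below its mollification, `u(z)` is at most `O(|z|^q)` plus a logarithm plus the majorant at
`|z| + 1` (`IsSubharmonic.exists_le_majorant`).

If the counting function is eventually at most `c s^ρ`, homogeneity gives the majorant the main term
`c S(ρ) r^ρ`. If instead `N` is, the main term is `c ρ S(ρ) r^ρ`, because `s^ρ` is the primitive of
`ρ x^ρ / x`. Non-integrality of `ρ` leaves room for an exponent `p` with `q < p < ρ`. Hence `S(ρ)`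
converges, all other terms are `O(r^p)`, and the shift from `r` to `r + 1` does not change the type.
-/

/-! ### The kernel maximum: monotonicity, convexity in `ln r`, right derivative. -/

/-- The Weierstrass primary factor `E_q(z) = (1 - z) exp (∑_{k=1}^q z^k / k)`. -/
def primaryFactor (q : ℕ) (z : ℂ) : ℂ :=
  (1 - z) * Complex.exp (∑ k ∈ Finset.Icc 1 q, z ^ k / (k : ℂ))

/-- The primary kernel as a real-valued function, with the value of `Real.log 0` at `z = 1`. -/
def realKernel (q : ℕ) (z : ℂ) : ℝ :=
  Real.log ‖1 - z‖ + ∑ k ∈ Finset.Icc 1 q, (z ^ k / (k : ℂ)).re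

lemma differentiable_primaryFactor (q : ℕ) : Differentiable ℂ (primaryFactor q) := by
  unfold primaryFactor
  fun_prop

lemma primaryFactor_ne_zero {q : ℕ} {z : ℂ} (hz : z ≠ 1) : primaryFactor q z ≠ 0 :=
  mul_ne_zero (sub_ne_zero.2 hz.symm) (Complex.exp_ne_zero _)

lemma log_norm_primaryFactor {q : ℕ} {z : ℂ} (hz : z ≠ 1) :
    Real.log ‖primaryFactor q z‖ = realKernel q z := by
  rw [primaryFactor, norm_mul, Complex.norm_exp, Real.log_mul, Real.log_exp, realKernel,
    Complex.re_sum]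
  · exact norm_ne_zero_iff.2 (sub_ne_zero.2 hz.symm)
  · exact (Real.exp_pos _).ne'

lemma primaryKernel_eq_coe {q : ℕ} {z : ℂ} (hz : z ≠ 1) :
    primaryKernel q z = (realKernel q z : EReal) := by
  rw [primaryKernel, realKernel, ← ofReal_norm,
    ENNReal.log_ofReal_of_pos (norm_pos_iff.2 (sub_ne_zero.2 hz.symm)), EReal.coe_add]

lemma primaryKernel_one (q : ℕ) : primaryKernel q 1 = ⊥ := by
  simp [primaryKernel]

/-- Compactness is applied to the continuous function `|E_q|` instead of its logarithm, which takes
the value `-∞`. It shows that the `toReal` in `kernelMax` loses nothing. -/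
lemma exists_norm_primaryFactor_max (q : ℕ) {r : ℝ} (hr : 0 ≤ r) :
    ∃ z : ℂ, ‖z‖ = r ∧ z ≠ 1 ∧ kernelMax q r = realKernel q z ∧
      ∀ w : ℂ, ‖w‖ = r → ‖primaryFactor q w‖ ≤ ‖primaryFactor q z‖ := by
  have hne : (sphere (0 : ℂ) r).Nonempty := (NormedSpace.sphere_nonempty).2 hr
  obtain ⟨z, hz, hmax⟩ := (isCompact_sphere (0 : ℂ) r).exists_isMaxOn hne
    ((differentiable_primaryFactor q).continuous.norm.continuousOn)
  have hmax' : ∀ w : ℂ, ‖w‖ = r → ‖primaryFactor q w‖ ≤ ‖primaryFactor q z‖ :=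
    fun w hw => hmax (by simpa using hw)
  -- `E_q` vanishes at `1` but not at `-r`, so `1` cannot be a maximum point.
  have hz1 : z ≠ 1 := by
    rintro rfl
    have h1 := hmax' (-(r : ℂ)) (by simp [abs_of_nonneg hr])
    have h2 : primaryFactor q (1 : ℂ) = 0 := by simp [primaryFactor]
    rw [h2, norm_zero] at h1
    have h3 : primaryFactor q (-(r : ℂ)) = 0 := norm_le_zero_iff.1 h1
    refine primaryFactor_ne_zero (fun h => ?_) h3
    have := congrArg Complex.re h
    simp at this
    linarith
  refine ⟨z, by simpa using hz, hz1, ?_, hmax'⟩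
  have : circleMax (primaryKernel q) r = (realKernel q z : EReal) := by
    refine le_antisymm (iSup₂_le fun w hw => ?_) ?_
    · by_cases hw1 : w = 1
      · rw [hw1, primaryKernel_one]; exact bot_le
      · rw [primaryKernel_eq_coe hw1, EReal.coe_le_coe_iff, ← log_norm_primaryFactor hw1,
          ← log_norm_primaryFactor hz1]
        exact Real.log_le_log (norm_pos_iff.2 (primaryFactor_ne_zero hw1))
          (hmax' w (by simpa using hw))
    · rw [← primaryKernel_eq_coe hz1]
      exact le_iSup₂ (f := fun w (_ : w ∈ sphere (0 : ℂ) r) => primaryKernel q w) z hz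
  rw [kernelMax, this, EReal.toReal_coe]

lemma norm_primaryFactor_le (q : ℕ) (w : ℂ) :
    ‖primaryFactor q w‖ ≤ Real.exp (kernelMax q ‖w‖) := by
  obtain ⟨z, -, hz1, hz, hmax⟩ := exists_norm_primaryFactor_max q (norm_nonneg w)
  rw [hz, ← log_norm_primaryFactor hz1, Real.exp_log (norm_pos_iff.2 (primaryFactor_ne_zero hz1))]
  exact hmax w rfl

lemma realKernel_le_kernelMax {q : ℕ} {w : ℂ} (hw : w ≠ 1) :
    realKernel q w ≤ kernelMax q ‖w‖ := by
  rw [← log_norm_primaryFactor hw, Real.log_le_iff_le_exp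
    (norm_pos_iff.2 (primaryFactor_ne_zero hw))]
  exact norm_primaryFactor_le q w

lemma primaryKernel_le_kernelMax (q : ℕ) (w : ℂ) :
    primaryKernel q w ≤ (kernelMax q ‖w‖ : EReal) := by
  by_cases hw : w = 1
  · rw [hw, primaryKernel_one]; exact bot_le
  · rw [primaryKernel_eq_coe hw, EReal.coe_le_coe_iff]
    exact realKernel_le_kernelMax hw

lemma kernelMax_le_of_norm_primaryFactor_le {q : ℕ} {r c : ℝ} (hr : 0 ≤ r)
    (h : ∀ z : ℂ, ‖z‖ = r → ‖primaryFactor q z‖ ≤ Real.exp c) : kernelMax q r ≤ c := by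
  obtain ⟨z, hzr, hz1, hz, -⟩ := exists_norm_primaryFactor_max q hr
  rw [hz, ← log_norm_primaryFactor hz1, Real.log_le_iff_le_exp
    (norm_pos_iff.2 (primaryFactor_ne_zero hz1))]
  exact h z hzr

lemma kernelMax_zero (q : ℕ) : kernelMax q 0 = 0 := by
  obtain ⟨z, hz0, -, hz, -⟩ := exists_norm_primaryFactor_max q le_rfl
  rw [norm_eq_zero] at hz0
  rw [hz, hz0, realKernel]
  have : ∀ k ∈ Finset.Icc 1 q, ((0 : ℂ) ^ k / (k : ℂ)).re = 0 := fun k hk => by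
    rw [zero_pow (by have := (Finset.mem_Icc.1 hk).1; omega)]; simp
  rw [Finset.sum_eq_zero this]
  simp

lemma kernelMax_mono {q : ℕ} {r s : ℝ} (hr : 0 ≤ r) (hrs : r ≤ s) :
    kernelMax q r ≤ kernelMax q s := by
  rcases hrs.eq_or_lt with rfl | hlt
  · exact le_rfl
  have hs : 0 < s := hr.trans_lt hlt
  refine kernelMax_le_of_norm_primaryFactor_le hr fun z hz => ?_
  -- The maximum principle on the disc of radius `s`.
  refine Complex.norm_le_of_forall_mem_frontier_norm_le (U := ball (0 : ℂ) s) isBounded_ball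
    (differentiable_primaryFactor q).diffContOnCl (fun w hw => ?_) (subset_closure ?_)
  · rw [frontier_ball _ hs.ne', mem_sphere_zero_iff_norm] at hw
    rw [← hw]
    exact norm_primaryFactor_le q w
  · simpa [hz] using hlt

lemma kernelMax_nonneg (q : ℕ) {r : ℝ} (hr : 0 ≤ r) : 0 ≤ kernelMax q r :=
  (kernelMax_zero q).symm.le.trans (kernelMax_mono le_rfl hr)

/-- The three circles theorem for the primary factor. -/
lemma convexOn_kernelMax_exp (q : ℕ) : ConvexOn ℝ univ (fun x => kernelMax q (Real.exp x)) := by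
  refine LinearOrder.convexOn_of_lt convex_univ fun x _ y _ hxy a b ha hb hab => ?_
  have hyx : 0 < y - x := sub_pos.2 hxy
  refine kernelMax_le_of_norm_primaryFactor_le (Real.exp_pos _).le fun z hz => ?_
  have hz0 : z ≠ 0 := norm_pos_iff.1 (hz ▸ Real.exp_pos _)
  have hre : (Complex.log z).re = a * x + b * y := by
    rw [Complex.log_re, hz, Real.log_exp]; simp
  -- The three lines theorem for `E_q(exp ζ)` on the strip `x ≤ Re ζ ≤ y`, at a logarithm of `z`,
  -- whose real part is `a x + b y`.
  have key := Complex.HadamardThreeLines.norm_le_interp_of_mem_verticalClosedStrip'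
    (f := fun ζ => primaryFactor q (Complex.exp ζ)) (z := Complex.log z)
    (a := Real.exp (kernelMax q (Real.exp x))) (b := Real.exp (kernelMax q (Real.exp y))) hxy
    (by
      rw [Complex.HadamardThreeLines.verticalClosedStrip, mem_preimage, hre]
      have h1 : 0 < b * (y - x) := mul_pos hb hyx
      have h2 : 0 < a * (y - x) := mul_pos ha hyx
      obtain rfl : a = 1 - b := by linarith
      constructor <;> nlinarith)
    (((differentiable_primaryFactor q).comp Complex.differentiable_exp).diffContOnCl)
    (by
      refine ⟨Real.exp (kernelMax q (Real.exp y)), ?_⟩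
      rintro _ ⟨ζ, hζ, rfl⟩
      refine (norm_primaryFactor_le q _).trans (Real.exp_le_exp.2 ?_)
      rw [Complex.norm_exp]
      exact kernelMax_mono (Real.exp_pos _).le (Real.exp_le_exp.2 hζ.2))
    (fun ζ hζ => by
      have : ζ.re = x := hζ
      simpa [Complex.norm_exp, this] using norm_primaryFactor_le q (Complex.exp ζ))
    (fun ζ hζ => by
      have : ζ.re = y := hζ
      simpa [Complex.norm_exp, this] using norm_primaryFactor_le q (Complex.exp ζ))
  have e1 : (a * x + b * y - x) / (y - x) = b := by
    rw [div_eq_iff hyx.ne']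
    linear_combination x * hab
  rw [hre, e1, Complex.exp_log hz0, ← Real.exp_mul, ← Real.exp_mul, ← Real.exp_add] at key
  refine key.trans (Real.exp_le_exp.2 (le_of_eq ?_))
  rw [← hab]
  simp only [smul_eq_mul]
  ring

/-- A convex function on the line has right derivatives everywhere, and `log` carries right
neighbourhoods to right neighbourhoods. The chain rule then makes `r M_q'(r)` the slope of `M_q` in
the variable `ln r`. -/
lemma hasDerivWithinAt_kernelMax (q : ℕ) {r : ℝ} (hr : 0 < r) :
    HasDerivWithinAt (kernelMax q) (kernelMaxDeriv q r) (Ioi r) r ∧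
      r * kernelMaxDeriv q r =
        derivWithin (fun x => kernelMax q (Real.exp x)) (Ioi (Real.log r)) (Real.log r) := by
  have h1 := (convexOn_kernelMax_exp q).hasDerivWithinAt_rightDeriv_of_mem_interior
    (x := Real.log r) (by simp)
  set D := derivWithin (fun x => kernelMax q (Real.exp x)) (Ioi (Real.log r)) (Real.log r)
  have h2 : HasDerivWithinAt Real.log r⁻¹ (Ioi r) r :=
    (Real.hasDerivAt_log hr.ne').hasDerivWithinAt
  have h3 : MapsTo Real.log (Ioi r) (Ioi (Real.log r)) := fun x hx => Real.log_lt_log hr hx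
  have h4 := h1.comp r h2 h3
  have h5 : HasDerivWithinAt (kernelMax q) (D * r⁻¹) (Ioi r) r := by
    refine h4.congr (fun x hx => ?_) ?_
    · simp [Real.exp_log (hr.trans hx)]
    · simp [Real.exp_log hr]
  have h6 : kernelMaxDeriv q r = D * r⁻¹ := h5.derivWithin (uniqueDiffWithinAt_Ioi r)
  rw [h6]
  exact ⟨h5, by field_simp⟩

lemma mul_kernelMaxDeriv_mono {q : ℕ} {r s : ℝ} (hr : 0 < r) (hrs : r ≤ s) :
    r * kernelMaxDeriv q r ≤ s * kernelMaxDeriv q s := by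
  rw [(hasDerivWithinAt_kernelMax q hr).2, (hasDerivWithinAt_kernelMax q (hr.trans_le hrs)).2]
  exact (convexOn_kernelMax_exp q).monotoneOn_rightDeriv (by simp) (by simp)
    (Real.log_le_log hr hrs)

lemma kernelMaxDeriv_nonneg (q : ℕ) {r : ℝ} (hr : 0 < r) : 0 ≤ kernelMaxDeriv q r := by
  have h := hasDerivWithinAt_iff_tendsto_slope.1 (hasDerivWithinAt_kernelMax q hr).1
  rw [sdiff_singleton_eq_self (by simp)] at h
  refine ge_of_tendsto h ?_
  filter_upwards [self_mem_nhdsWithin] with x hx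
  rw [slope_def_field]
  exact div_nonneg (sub_nonneg.2 (kernelMax_mono hr.le (le_of_lt hx)))
    (sub_nonneg.2 (le_of_lt hx))

/-- Convexity bounds the slope at `log r` by the chord up to `log r + 1`, and `M_q ≥ 0`; the unit
step is the source of the factor `e`. Growth bounds for `M_q` thereby pass to `M_q'`. -/
lemma mul_kernelMaxDeriv_le (q : ℕ) {r : ℝ} (hr : 0 < r) :
    r * kernelMaxDeriv q r ≤ kernelMax q (Real.exp 1 * r) := by
  rw [(hasDerivWithinAt_kernelMax q hr).2]
  have := (convexOn_kernelMax_exp q).rightDeriv_le_slope_of_mem_interior (x := Real.log r)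
    (y := Real.log r + 1) (by simp) (mem_univ _) (by linarith)
  refine this.trans ?_
  rw [slope_def_field, add_sub_cancel_left, div_one, Real.exp_add, Real.exp_log hr, mul_comm]
  linarith [kernelMax_nonneg q hr.le]

lemma measurable_kernelMaxDeriv_of_pos (q : ℕ) :
    AEMeasurable (kernelMaxDeriv q) (volume.restrict (Ioi 0)) := by
  have h : AEMeasurable (fun r => r⁻¹ * (r * kernelMaxDeriv q r)) (volume.restrict (Ioi 0)) :=
    measurable_inv.aemeasurable.mul
      (aemeasurable_restrict_of_monotoneOn measurableSet_Ioi
        fun r hr s _ hrs => mul_kernelMaxDeriv_mono hr hrs)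
  refine h.congr ?_
  filter_upwards [ae_restrict_mem measurableSet_Ioi] with r hr
  exact inv_mul_cancel_left₀ (ne_of_gt hr) _


/-! ### Growth of the kernel maximum, and finiteness and positivity of `S(ρ)`. -/

/-- Near the origin the kernel is the real part of the Taylor remainder of order `q + 1` of `log(1 -
z)`. -/
lemma abs_realKernel_le {q : ℕ} {z : ℂ} (hz : ‖z‖ ≤ 1 / 2) :
    |realKernel q z| ≤ 2 * ‖z‖ ^ (q + 1) := by
  have h1 := Complex.norm_log_sub_logTaylor_le q (z := -z) (by rw [norm_neg]; linarith)
  rw [norm_neg] at h1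
  have h2 : Complex.logTaylor (q + 1) (-z) = -∑ k ∈ Finset.Icc 1 q, z ^ k / (k : ℂ) := by
    have hI : Finset.Icc 1 q = Finset.Ico 1 (q + 1) := by ext; simp
    rw [Complex.logTaylor, Finset.sum_range_succ', ← Finset.sum_neg_distrib, hI,
      Finset.sum_Ico_eq_sum_range]
    simp only [Nat.cast_zero, div_zero, add_zero, Nat.add_sub_cancel]
    refine Finset.sum_congr rfl fun k _ => ?_
    rw [neg_pow z (k + 1), ← mul_assoc, ← pow_add, Odd.neg_one_pow ⟨k + 1, by ring⟩, add_comm 1 k]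
    ring
  have h3 : realKernel q z = (Complex.log (1 + -z) - Complex.logTaylor (q + 1) (-z)).re := by
    rw [h2, realKernel, sub_neg_eq_add, Complex.add_re, Complex.log_re, Complex.re_sum,
      ← sub_eq_add_neg]
  rw [h3]
  refine (Complex.abs_re_le_norm _).trans (h1.trans ?_)
  have h4 : (1 - ‖z‖)⁻¹ ≤ 2 := by
    rw [inv_le_comm₀ (by linarith) (by norm_num)]; linarith
  have h5 : (0 : ℝ) ≤ (1 - ‖z‖)⁻¹ := inv_nonneg.2 (by linarith)
  rw [div_le_iff₀ (by positivity)]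
  have h6 : ‖z‖ ^ (q + 1) * (1 - ‖z‖)⁻¹ ≤ ‖z‖ ^ (q + 1) * 2 := by gcongr
  have h7 : 0 ≤ 2 * ‖z‖ ^ (q + 1) * q := by positivity
  nlinarith

lemma kernelMax_le_log_add (q : ℕ) {x : ℝ} (hx : 0 ≤ x) :
    kernelMax q x ≤ Real.log (1 + x) + ∑ k ∈ Finset.Icc 1 q, x ^ k := by
  obtain ⟨z, rfl, hz1, hz, -⟩ := exists_norm_primaryFactor_max q hx
  rw [hz, realKernel]
  refine add_le_add (Real.log_le_log (norm_pos_iff.2 (sub_ne_zero.2 hz1.symm)) ?_)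
    (Finset.sum_le_sum fun k hk => (Complex.re_le_norm _).trans ?_)
  · simpa using norm_sub_le (1 : ℂ) z
  · have : (1 : ℝ) ≤ k := by exact_mod_cast (Finset.mem_Icc.1 hk).1
    rw [norm_div, norm_pow, Complex.norm_natCast]
    exact div_le_self (by positivity) this

lemma exists_kernelMax_le_pow (q : ℕ) :
    ∃ C : ℝ, 0 < C ∧ ∀ x : ℝ, 0 ≤ x → kernelMax q x ≤ C * x ^ (q + 1) := by
  -- For `x ≥ 1/2` the logarithm and the `q` powers are each at most `(2x)^(q+1)`, which gives the
  -- constant.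
  refine ⟨(q + 1) * 2 ^ (q + 1), by positivity, fun x hx => ?_⟩
  rcases le_total x (1 / 2) with h | h
  · obtain ⟨z, rfl, -, hz, -⟩ := exists_norm_primaryFactor_max q hx
    rw [hz]
    refine (le_abs_self _).trans ((abs_realKernel_le h).trans ?_)
    gcongr
    have h1 : (2 : ℝ) ≤ 2 ^ (q + 1) := by
      simpa using pow_le_pow_right₀ (one_le_two (α := ℝ)) (Nat.succ_le_succ (Nat.zero_le q))
    have h2 : (0 : ℝ) ≤ q * 2 ^ (q + 1) := by positivity
    linarith
  · have key : ∀ k ≤ q + 1, x ^ k ≤ 2 ^ (q + 1) * x ^ (q + 1) := fun k hk => by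
      rw [← mul_pow]
      calc x ^ k ≤ (2 * x) ^ k := pow_le_pow_left₀ hx (by linarith) k
        _ ≤ (2 * x) ^ (q + 1) := pow_le_pow_right₀ (by linarith) hk
    refine (kernelMax_le_log_add q hx).trans ?_
    have h1 : Real.log (1 + x) ≤ 2 ^ (q + 1) * x ^ (q + 1) := by
      refine (Real.log_le_sub_one_of_pos (by linarith)).trans ?_
      simpa using key 1 (by omega)
    have h2 : ∑ k ∈ Finset.Icc 1 q, x ^ k ≤ q * (2 ^ (q + 1) * x ^ (q + 1)) := by
      refine (Finset.sum_le_card_nsmul _ _ _ fun k hk =>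
        key k ((Finset.mem_Icc.1 hk).2.trans (Nat.le_succ q))).trans ?_
      simp
    linarith

/-- The hypothesis `0 < p` matters for `q = 0`, where only the logarithm is left and no bounded
majorant exists. -/
lemma exists_kernelMax_le_rpow {q : ℕ} {p : ℝ} (hp : 0 < p) (hqp : (q : ℝ) ≤ p) :
    ∃ C : ℝ, 0 < C ∧ ∀ x : ℝ, 1 ≤ x → kernelMax q x ≤ C * x ^ p := by
  refine ⟨2 ^ p / p + q, by positivity, fun x hx => ?_⟩
  have hx0 : 0 ≤ x := zero_le_one.trans hx
  refine (kernelMax_le_log_add q hx0).trans ?_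
  have h1 : Real.log (1 + x) ≤ 2 ^ p / p * x ^ p := by
    calc Real.log (1 + x) ≤ Real.log (2 * x) := Real.log_le_log (by linarith) (by linarith)
      _ ≤ (2 * x) ^ p / p := Real.log_le_rpow_div (by linarith) hp
      _ = _ := by rw [Real.mul_rpow zero_le_two hx0]; ring
  have h2 : ∑ k ∈ Finset.Icc 1 q, x ^ k ≤ q * x ^ p := by
    refine (Finset.sum_le_card_nsmul _ _ (x ^ p) fun k hk => ?_).trans (by simp)
    rw [← Real.rpow_natCast]
    exact Real.rpow_le_rpow_of_exponent_le hx
      ((Nat.cast_le.2 (Finset.mem_Icc.1 hk).2).trans hqp)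
  linarith

lemma continuousOn_kernelMax (q : ℕ) : ContinuousOn (kernelMax q) (Ici 0) := by
  intro r hr
  rcases (mem_Ici.1 hr).eq_or_lt with rfl | hr
  · obtain ⟨C, -, hC⟩ := exists_kernelMax_le_pow q
    rw [ContinuousWithinAt, kernelMax_zero]
    have h1 : Tendsto (fun x : ℝ => C * x ^ (q + 1)) (nhdsWithin 0 (Ici 0)) (nhds 0) := by
      have : Continuous fun x : ℝ => C * x ^ (q + 1) := by fun_prop
      simpa using (this.tendsto 0).mono_left nhdsWithin_le_nhds
    refine tendsto_of_tendsto_of_tendsto_of_le_of_le' tendsto_const_nhds h1 ?_ ?_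
    · filter_upwards [self_mem_nhdsWithin] with x hx using kernelMax_nonneg q hx
    · filter_upwards [self_mem_nhdsWithin] with x hx using hC x hx
  · have h1 : Continuous fun x => kernelMax q (Real.exp x) :=
      continuousOn_univ.1 ((convexOn_kernelMax_exp q).continuousOn isOpen_univ)
    have h2 : ContinuousAt (fun x => kernelMax q (Real.exp (Real.log x))) r :=
      h1.continuousAt.comp (Real.continuousAt_log hr.ne')
    refine (h2.congr ?_).continuousWithinAt
    filter_upwards [lt_mem_nhds hr] with x hx
    rw [Real.exp_log hx]

/-- The fundamental theorem of calculus for right derivatives; integrability is automatic because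
`M_q' ≥ 0`. -/
lemma lintegral_kernelMaxDeriv (q : ℕ) {r : ℝ} (hr : 0 ≤ r) :
    ∫⁻ t in Ioc 0 r, ENNReal.ofReal (kernelMaxDeriv q t) = ENNReal.ofReal (kernelMax q r) := by
  have hc : ContinuousOn (kernelMax q) (Icc 0 r) :=
    (continuousOn_kernelMax q).mono Icc_subset_Ici_self
  have hd : ∀ x ∈ Ioo 0 r, HasDerivWithinAt (kernelMax q) (kernelMaxDeriv q x) (Ioi x) x :=
    fun x hx => (hasDerivWithinAt_kernelMax q hx.1).1
  have hi := intervalIntegral.integrableOn_deriv_right_of_nonneg hc hd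
    fun x hx => kernelMaxDeriv_nonneg q hx.1
  have := intervalIntegral.integral_eq_sub_of_hasDeriv_right_of_le hr hc hd
    ((intervalIntegrable_iff_integrableOn_Ioc_of_le hr).2 hi)
  rw [kernelMax_zero, sub_zero, intervalIntegral.integral_of_le hr] at this
  rw [← this, ofReal_integral_eq_lintegral_ofReal hi]
  filter_upwards [ae_restrict_mem measurableSet_Ioc] with x hx
  exact kernelMaxDeriv_nonneg q hx.1

lemma tendsto_mul_kernelMaxDeriv_zero (q : ℕ) :
    Tendsto (fun t => t * kernelMaxDeriv q t) (nhdsWithin 0 (Ioi 0)) (nhds 0) := by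
  obtain ⟨C, -, hC⟩ := exists_kernelMax_le_pow q
  have h1 : Tendsto (fun x : ℝ => C * (Real.exp 1 * x) ^ (q + 1)) (nhdsWithin 0 (Ioi 0))
      (nhds 0) := by
    have : Continuous fun x : ℝ => C * (Real.exp 1 * x) ^ (q + 1) := by fun_prop
    simpa using (this.tendsto 0).mono_left nhdsWithin_le_nhds
  refine tendsto_of_tendsto_of_tendsto_of_le_of_le' tendsto_const_nhds h1 ?_ ?_
  · filter_upwards [self_mem_nhdsWithin] with x hx using
      mul_nonneg (le_of_lt hx) (kernelMaxDeriv_nonneg q hx)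
  · filter_upwards [self_mem_nhdsWithin] with x hx using
      (mul_kernelMaxDeriv_le q hx).trans (hC _ (mul_nonneg (Real.exp_pos _).le (le_of_lt hx)))

lemma valironConstant_lt_top {ρ : ℝ} (hρ : 0 < ρ) (hn : ∀ n : ℕ, ρ ≠ n) :
    valironConstant ρ < ⊤ := by
  set q := ⌊ρ⌋₊ with hq
  have hqρ : (q : ℝ) < ρ := lt_of_le_of_ne (Nat.floor_le hρ.le) (hn q).symm
  have hρq : ρ < q + 1 := Nat.lt_floor_add_one ρ
  obtain ⟨C, hC, hM⟩ := exists_kernelMax_le_pow q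
  -- An exponent strictly between `q` and `ρ` makes the integrand `O(r^(p-ρ-1))` at infinity. Near
  -- `0` it is `O(r^(q-ρ))`, integrable since `ρ < q + 1`.
  obtain ⟨p, hp1, hp2⟩ := exists_between hqρ
  have hp0 : 0 < p := (Nat.cast_nonneg q).trans_lt hp1
  obtain ⟨C', hC', hM'⟩ := exists_kernelMax_le_rpow hp0 hp1.le
  have hder : ∀ r : ℝ, 0 < r → kernelMaxDeriv q r ≤ kernelMax q (Real.exp 1 * r) / r :=
    fun r hr => by rw [le_div_iff₀ hr, mul_comm]; exact mul_kernelMaxDeriv_le q hr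
  rw [valironConstant, ← Ioc_union_Ioi_eq_Ioi zero_le_one]
  refine (lintegral_union_le _ _ _).trans_lt (ENNReal.add_lt_top.2 ⟨?_, ?_⟩)
  · have hInt : IntegrableOn (fun r : ℝ => C * Real.exp 1 ^ (q + 1) * r ^ (q - ρ)) (Ioc 0 1) := by
      refine Integrable.const_mul ?_ _
      exact (intervalIntegrable_iff_integrableOn_Ioc_of_le zero_le_one).1
        (intervalIntegral.intervalIntegrable_rpow' (by linarith))
    refine lt_of_le_of_lt (setLIntegral_mono_ae' measurableSet_Ioc (ae_of_all _ fun r hr =>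
      ENNReal.ofReal_le_ofReal ?_)) hInt.lintegral_lt_top
    have hr0 : 0 < r := hr.1
    calc r ^ (-ρ) * kernelMaxDeriv q r
        ≤ r ^ (-ρ) * (C * (Real.exp 1 * r) ^ (q + 1) / r) := by
          gcongr
          refine (hder r hr0).trans ?_
          gcongr
          exact hM _ (by positivity)
      _ = C * Real.exp 1 ^ (q + 1) * r ^ (q - ρ) := by
          rw [sub_eq_add_neg, Real.rpow_add hr0, Real.rpow_natCast, mul_pow]
          field_simp
          ring
  · have hInt : IntegrableOn (fun r : ℝ => C' * Real.exp 1 ^ p * r ^ (p - ρ - 1)) (Ioi 1) :=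
      (integrableOn_Ioi_rpow_of_lt (by linarith) zero_lt_one).const_mul _
    refine lt_of_le_of_lt (setLIntegral_mono_ae' measurableSet_Ioi (ae_of_all _ fun r hr =>
      ENNReal.ofReal_le_ofReal ?_)) hInt.lintegral_lt_top
    have hr1 : 1 < r := hr
    have hr0 : 0 < r := zero_lt_one.trans hr1
    calc r ^ (-ρ) * kernelMaxDeriv q r
        ≤ r ^ (-ρ) * (C' * (Real.exp 1 * r) ^ p / r) := by
          gcongr
          refine (hder r hr0).trans ?_
          gcongr
          refine hM' _ ?_
          nlinarith [Real.add_one_le_exp 1]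
      _ = C' * Real.exp 1 ^ p * r ^ (p - ρ - 1) := by
          rw [Real.rpow_sub_one hr0.ne', sub_eq_add_neg, Real.rpow_add hr0,
            Real.mul_rpow (Real.exp_pos _).le hr0.le]
          field_simp

/-- If `S(ρ)` were `0`, then `M_q'` would vanish almost everywhere and `M_q(3)` would be `0`, while
`K_q(3) ≥ ln 2`. This excludes the product `0 * ∞ = 0` when the measure has infinite type. -/
lemma valironConstant_ne_zero (ρ : ℝ) : valironConstant ρ ≠ 0 := by
  intro h
  set q := ⌊ρ⌋₊ with hq
  rw [valironConstant, lintegral_eq_zero_iff'] at h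
  · have h1 : ∫⁻ t in Ioc (0 : ℝ) 3, ENNReal.ofReal (kernelMaxDeriv q t) = 0 := by
      refine le_antisymm ?_ bot_le
      refine (lintegral_mono_set Ioc_subset_Ioi_self).trans (le_of_eq ?_)
      rw [lintegral_eq_zero_iff' (measurable_kernelMaxDeriv_of_pos q).ennreal_ofReal]
      filter_upwards [h, ae_restrict_mem measurableSet_Ioi] with t ht ht0
      have ht0' : (0 : ℝ) < t := ht0
      simp only [Pi.zero_apply, ENNReal.ofReal_eq_zero] at ht ⊢
      exact nonpos_of_mul_nonpos_right ht (Real.rpow_pos_of_pos ht0' _)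
    rw [lintegral_kernelMaxDeriv q (by norm_num), ENNReal.ofReal_eq_zero] at h1
    have h2 := realKernel_le_kernelMax (q := q) (w := 3) (by norm_num)
    have h3 : 0 < realKernel q 3 := by
      have : (0 : ℝ) ≤ ∑ k ∈ Finset.Icc 1 q, ((3 : ℂ) ^ k / (k : ℂ)).re := by
        refine Finset.sum_nonneg fun k _ => ?_
        have : ((3 : ℂ) ^ k / (k : ℂ)) = ((3 ^ k / k : ℝ) : ℂ) := by push_cast; rfl
        rw [this, Complex.ofReal_re]
        positivity
      have h4 : ‖(1 : ℂ) - 3‖ = 2 := by norm_num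
      rw [realKernel, h4]
      linarith [Real.log_pos one_lt_two]
    have h5 : ‖(3 : ℂ)‖ = 3 := by simp
    rw [h5] at h2
    linarith
  · refine AEMeasurable.ennreal_ofReal (AEMeasurable.mul ?_ (measurable_kernelMaxDeriv_of_pos q))
    exact (measurable_id.pow_const _).aemeasurable

/-! ### Types and counting functions. -/

section Growth

lemma eventually_le_of_growthType_lt {ρ : ℝ} {f : ℝ → EReal} {c : ℝ≥0∞}
    (h : growthType ρ f < c) :
    ∀ᶠ r in atTop, (f r).toENNReal ≤ c * ENNReal.ofReal (r ^ ρ) := by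
  filter_upwards [eventually_lt_of_limsup_lt h, eventually_gt_atTop 0] with r hr hr0
  exact (ENNReal.div_le_iff (by simpa using Real.rpow_pos_of_pos hr0 ρ) ENNReal.ofReal_ne_top).1
    hr.le

lemma growthType_le_of_eventually_le {ρ : ℝ} {f : ℝ → EReal} {c : ℝ≥0∞}
    (h : ∀ᶠ r in atTop, (f r).toENNReal ≤ c * ENNReal.ofReal (r ^ ρ)) :
    growthType ρ f ≤ c := by
  refine limsup_le_of_le (by isBoundedDefault) ?_
  filter_upwards [h, eventually_gt_atTop 0] with r hr hr0
  exact (ENNReal.div_le_iff (by simpa using Real.rpow_pos_of_pos hr0 ρ) ENNReal.ofReal_ne_top).2 hr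

lemma radialCount_mono (μ : Measure ℂ) : Monotone (radialCount μ) :=
  fun _ _ h => measure_mono (closedBall_subset_closedBall h)

lemma averagedCount_mono (μ : Measure ℂ) : Monotone (averagedCount μ) :=
  fun _ _ h => lintegral_mono_set (Ioc_subset_Ioc_right h)

lemma radialCount_lt_top {ρ : ℝ} {μ : Measure ℂ} (h : measureType ρ μ < ⊤) (t : ℝ) :
    radialCount μ t < ⊤ := by
  obtain ⟨c, hc, hc'⟩ := exists_between h
  obtain ⟨r, hr, hrt⟩ := ((eventually_le_of_growthType_lt hc).and (eventually_ge_atTop t)).exists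
  rw [EReal.toENNReal_coe] at hr
  exact (radialCount_mono μ hrt).trans_lt
    (hr.trans_lt (ENNReal.mul_lt_top hc' ENNReal.ofReal_lt_top))

lemma isLocallyFiniteMeasure_of_radialCount_lt_top {μ : Measure ℂ}
    (h : ∀ t, radialCount μ t < ⊤) : IsLocallyFiniteMeasure μ :=
  ⟨fun z => ⟨closedBall 0 (‖z‖ + 1), by
    refine Filter.mem_of_superset (isOpen_ball.mem_nhds ?_) ball_subset_closedBall
    simp, h _⟩⟩

lemma exists_radialCount_le {ρ ε : ℝ} (hρ : 0 ≤ ρ) {μ : Measure ℂ} (hε : 0 < ε)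
    (h0 : radialCount μ ε = 0) (h : measureType ρ μ < ⊤) :
    ∃ A : ℝ≥0∞, A < ⊤ ∧ ∀ x : ℝ, radialCount μ x ≤ A * (Ioi ε).indicator
      (fun x => ENNReal.ofReal (x ^ ρ)) x := by
  obtain ⟨c, hc, hc'⟩ := exists_between h
  obtain ⟨R, hR⟩ := eventually_atTop.1 (eventually_le_of_growthType_lt hc)
  have hερ : 0 < ε ^ ρ := Real.rpow_pos_of_pos hε ρ
  -- The first summand serves beyond `R`; the second serves on `(ε, R]`, where `x^ρ ≥ ε^ρ`.
  refine ⟨c + radialCount μ R / ENNReal.ofReal (ε ^ ρ), ENNReal.add_lt_top.2 ⟨hc', ?_⟩,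
    fun x => ?_⟩
  · exact ENNReal.div_lt_top (radialCount_lt_top h R).ne (by simpa using hερ)
  by_cases hx : ε < x
  · rw [indicator_of_mem (mem_Ioi.2 hx), add_mul]
    rcases le_total R x with hRx | hxR
    · have := hR x hRx
      rw [EReal.toENNReal_coe] at this
      exact this.trans le_self_add
    · refine ((radialCount_mono μ hxR).trans ?_).trans le_add_self
      calc radialCount μ R = radialCount μ R / ENNReal.ofReal (ε ^ ρ) * ENNReal.ofReal (ε ^ ρ) :=
            (ENNReal.div_mul_cancel (by simpa using hερ) ENNReal.ofReal_ne_top).symm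
        _ ≤ _ := by gcongr
  · have : radialCount μ x ≤ radialCount μ ε := radialCount_mono μ (not_lt.1 hx)
    rw [h0] at this
    exact this.trans bot_le

end Growth

/-! ### Exchange of integrals and convergence of power moments. -/

section Tonelli

lemma lintegral_setLIntegral_swap {α β : Type*} [MeasurableSpace α] [MeasurableSpace β]
    {μ : Measure α} {ν : Measure β} [SFinite μ] [SFinite ν] {S : Set (α × β)}
    (hS : MeasurableSet S) {g : β → ℝ≥0∞} (hg : AEMeasurable g ν) :
    ∫⁻ w, ∫⁻ t in {t | (w, t) ∈ S}, g t ∂ν ∂μ = ∫⁻ t, g t * μ {w | (w, t) ∈ S} ∂ν := by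
  have hS1 : ∀ w, MeasurableSet {t | (w, t) ∈ S} := fun w => measurable_prodMk_left hS
  have hS2 : ∀ t, MeasurableSet {w | (w, t) ∈ S} := fun t => measurable_prodMk_right hS
  have hm : AEMeasurable (Function.uncurry fun w t => S.indicator (fun p => g p.2) (w, t))
      (μ.prod ν) :=
    (hg.comp_quasiMeasurePreserving Measure.quasiMeasurePreserving_snd).indicator hS
  calc ∫⁻ w, ∫⁻ t in {t | (w, t) ∈ S}, g t ∂ν ∂μ
      = ∫⁻ w, ∫⁻ t, S.indicator (fun p => g p.2) (w, t) ∂ν ∂μ := by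
        refine lintegral_congr fun w => ?_
        rw [← lintegral_indicator (hS1 w)]
        rfl
    _ = ∫⁻ t, ∫⁻ w, S.indicator (fun p => g p.2) (w, t) ∂μ ∂ν := lintegral_lintegral_swap hm
    _ = _ := by
        refine lintegral_congr fun t => ?_
        rw [← lintegral_indicator_const (hS2 t)]
        rfl

/-- Substitution `t = r / x` on the half-line. -/
lemma lintegral_Ioi_comp_div {r : ℝ} (hr : 0 < r) (f : ℝ → ℝ≥0∞) :
    ∫⁻ t in Ioi (0 : ℝ), f t = ∫⁻ x in Ioi (0 : ℝ), ENNReal.ofReal (r / x ^ 2) * f (r / x) := by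
  have himg : (fun x => r / x) '' Ioi (0 : ℝ) = Ioi 0 := by
    ext y
    refine ⟨?_, fun hy => ⟨r / y, div_pos hr hy, by
      have : y ≠ 0 := ne_of_gt hy
      field_simp⟩⟩
    rintro ⟨x, hx, rfl⟩
    exact div_pos hr hx
  have hinj : InjOn (fun x => r / x) (Ioi (0 : ℝ)) := fun x _ y _ h => by
    simpa [div_eq_mul_inv, hr.ne'] using h
  have hd : ∀ x ∈ Ioi (0 : ℝ), HasDerivWithinAt (fun x => r / x) (-(r / x ^ 2)) (Ioi 0) x := by
    intro x hx
    have := ((hasDerivAt_inv (ne_of_gt hx)).const_mul r).hasDerivWithinAt (s := Ioi 0)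
    simpa [div_eq_mul_inv] using this
  have := lintegral_image_eq_lintegral_abs_deriv_mul measurableSet_Ioi hd hinj f
  rw [himg] at this
  rw [this]
  refine setLIntegral_congr_fun measurableSet_Ioi fun x _ => ?_
  simp only [abs_neg, abs_of_nonneg (div_nonneg hr.le (sq_nonneg x))]

lemma lintegral_norm_rpow_neg_lt_top {ρ σ ε : ℝ} (hρ : 0 ≤ ρ) (hρσ : ρ < σ) {μ : Measure ℂ}
    (hε : 0 < ε) (h0 : radialCount μ ε = 0) (h : measureType ρ μ < ⊤) :
    ∫⁻ w, ENNReal.ofReal (‖w‖ ^ (-σ)) ∂μ < ⊤ := by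
  obtain ⟨A, hA, hle⟩ := exists_radialCount_le hρ hε h0 h
  have := isLocallyFiniteMeasure_of_radialCount_lt_top fun t => radialCount_lt_top h t
  have hσ : 0 < σ := hρ.trans_lt hρσ
  have hS : MeasurableSet {p : ℂ × ℝ | ‖p.1‖ < p.2} :=
    measurableSet_lt measurable_fst.norm measurable_snd
  have hg : Measurable fun x : ℝ => ENNReal.ofReal (σ * x ^ (-σ - 1)) := by fun_prop
  -- Writing `|w|^(-σ)` as a tail integral lets Tonelli replace the moment by an integral of the
  -- counting function.
  have key : ∀ᵐ w ∂μ, ENNReal.ofReal (‖w‖ ^ (-σ)) =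
      ∫⁻ x in {x | (w, x) ∈ {p : ℂ × ℝ | ‖p.1‖ < p.2}}, ENNReal.ofReal (σ * x ^ (-σ - 1)) := by
    filter_upwards [measure_eq_zero_iff_ae_notMem.1 h0] with w hw
    have hw' : 0 < ‖w‖ := hε.trans (by simpa using hw)
    have hInt : IntegrableOn (fun x : ℝ => σ * x ^ (-σ - 1)) (Ioi ‖w‖) :=
      (integrableOn_Ioi_rpow_of_lt (by linarith) hw').const_mul _
    have e : ∫ x in Ioi ‖w‖, σ * x ^ (-σ - 1) = ‖w‖ ^ (-σ) := by
      rw [integral_const_mul, integral_Ioi_rpow_of_lt (by linarith) hw', sub_add_cancel]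
      field_simp
    rw [← e, ofReal_integral_eq_lintegral_ofReal hInt]
    · rfl
    · filter_upwards [ae_restrict_mem measurableSet_Ioi] with x hx
      have : 0 < x := hw'.trans hx
      simp only [Pi.zero_apply]
      positivity
  rw [lintegral_congr_ae key, lintegral_setLIntegral_swap hS hg.aemeasurable]
  have hInt : IntegrableOn (fun x : ℝ => σ * x ^ (ρ - σ - 1)) (Ioi ε) :=
    (integrableOn_Ioi_rpow_of_lt (by linarith) hε).const_mul _
  calc ∫⁻ x, ENNReal.ofReal (σ * x ^ (-σ - 1)) * μ {w | (w, x) ∈ {p : ℂ × ℝ | ‖p.1‖ < p.2}}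
      ≤ ∫⁻ x, A * (Ioi ε).indicator (fun x => ENNReal.ofReal (σ * x ^ (ρ - σ - 1))) x := by
        refine lintegral_mono fun x => ?_
        have h1 : μ {w | (w, x) ∈ {p : ℂ × ℝ | ‖p.1‖ < p.2}} ≤ radialCount μ x :=
          measure_mono fun w hw => by
            have : ‖w‖ < x := hw
            simpa using this.le
        refine (mul_le_mul_right (h1.trans (hle x)) _).trans (le_of_eq ?_)
        by_cases hx : ε < x
        · have hx0 : 0 < x := hε.trans hx
          rw [indicator_of_mem (mem_Ioi.2 hx), indicator_of_mem (mem_Ioi.2 hx), mul_left_comm,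
            ← ENNReal.ofReal_mul (by positivity), mul_assoc, ← Real.rpow_add hx0]
          ring_nf
        · rw [indicator_of_notMem (by simpa using hx), indicator_of_notMem (by simpa using hx)]
          simp
    _ = A * ∫⁻ x in Ioi ε, ENNReal.ofReal (σ * x ^ (ρ - σ - 1)) := by
        rw [lintegral_const_mul _ (by measurability), lintegral_indicator measurableSet_Ioi]
    _ < ⊤ := ENNReal.mul_lt_top hA hInt.lintegral_lt_top

end Tonelli

/-! ### Identification of the Stieltjes measures. -/

section Stieltjes

/-- Continuity of `ν` from above makes its distribution function right continuous, so the right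
limits in the Stieltjes construction change nothing and half-open intervals decide equality. -/
lemma stieltjesMeasure_toReal_measure_Iic {ν : Measure ℝ} (h0 : ν (Iic 0) = 0)
    (hfin : ∀ t, ν (Iic t) ≠ ⊤) : stieltjesMeasure (fun t => (ν (Iic t)).toReal) = ν := by
  have e : ∀ t, (ν (Iic (max t 0))).toReal = (ν (Iic t)).toReal := by
    intro t
    rcases le_total t 0 with ht | ht
    · rw [max_eq_right ht, h0, measure_mono_null (Iic_subset_Iic.2 ht) h0]
    · rw [max_eq_left ht]
  have hmono : Monotone fun t => (ν (Iic (max t 0))).toReal := fun s t hst =>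
    ENNReal.toReal_mono (hfin _) (measure_mono (Iic_subset_Iic.2 (max_le_max_right 0 hst)))
  have hright : ∀ t, hmono.stieltjesFunction t = (ν (Iic t)).toReal := by
    intro t
    rw [Monotone.stieltjesFunction_eq, ← e t]
    refine rightLim_eq_of_tendsto ?_
    simp_rw [e]
    have h1 := tendsto_measure_biInter_gt (μ := ν) (s := Iic) (a := t)
      (fun _ _ => measurableSet_Iic.nullMeasurableSet) (fun _ _ _ h => Iic_subset_Iic.2 h)
      ⟨t + 1, by simp, hfin _⟩
    have h2 : ⋂ r > t, Iic r = Iic t := by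
      ext x
      simp only [mem_iInter, mem_Iic, gt_iff_lt]
      exact ⟨fun h => le_of_forall_gt_imp_ge_of_dense h, fun h r hr => h.trans hr.le⟩
    rw [h2] at h1
    exact ((ENNReal.tendsto_toReal (hfin t)).comp h1)
  rw [stieltjesMeasure, dif_pos hmono]
  refine (Measure.ext_of_Ioc' ν _ (fun a b _ => ne_top_of_le_ne_top (hfin b)
    (measure_mono Ioc_subset_Iic_self)) fun a b hab => ?_).symm
  rw [Measure.restrict_apply measurableSet_Ioc, Ioc_inter_Ioi, StieltjesFunction.measure_Ioc,
    hright, hright, max_def, ← max_def, e a,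
    ← ENNReal.toReal_sub_of_le (measure_mono (Iic_subset_Iic.2 hab.le)) (hfin b),
    ENNReal.ofReal_toReal (ENNReal.sub_ne_top (hfin b)),
    ← measure_sdiff (Iic_subset_Iic.2 hab.le) measurableSet_Iic.nullMeasurableSet (hfin a),
    Iic_sdiff_Iic]

lemma stieltjesMeasure_radialCount {μ : Measure ℂ} (h0 : radialCount μ 0 = 0)
    (h : ∀ t, radialCount μ t < ⊤) :
    stieltjesMeasure (fun s => (radialCount μ s).toReal) = μ.map norm := by
  have e : ∀ t, radialCount μ t = μ.map norm (Iic t) := fun t => by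
    rw [Measure.map_apply measurable_norm measurableSet_Iic, radialCount]
    congr 1
    ext w
    simp
  simp_rw [e] at h0 h ⊢
  exact stieltjesMeasure_toReal_measure_Iic h0 fun t => (h t).ne

lemma stieltjesMeasure_averagedCount {μ : Measure ℂ} (h : ∀ t, averagedCount μ t < ⊤) :
    stieltjesMeasure (fun s => (averagedCount μ s).toReal) =
      (volume.restrict (Ioi 0)).withDensity fun s => radialCount μ s / ENNReal.ofReal s := by
  have e : ∀ t, averagedCount μ t = (volume.restrict (Ioi 0)).withDensity
      (fun s => radialCount μ s / ENNReal.ofReal s) (Iic t) := fun t => by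
    rw [withDensity_apply _ measurableSet_Iic, Measure.restrict_restrict measurableSet_Iic,
      Iic_inter_Ioi, averagedCount]
  simp_rw [e] at h ⊢
  refine stieltjesMeasure_toReal_measure_Iic ?_ fun t => (h t).ne
  rw [← e 0, averagedCount]
  simp

lemma monotone_max_mul_kernelMaxDeriv (q : ℕ) :
    Monotone fun t : ℝ => max t 0 * kernelMaxDeriv q (max t 0) := by
  intro s t hst
  rcases le_or_gt s 0 with hs | hs
  · simp only [max_eq_right hs, zero_mul]
    rcases le_or_gt t 0 with ht | ht
    · simp [max_eq_right ht]
    · rw [max_eq_left ht.le]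
      exact mul_nonneg ht.le (kernelMaxDeriv_nonneg q ht)
  · simp only [max_eq_left hs.le, max_eq_left (hs.le.trans hst)]
    exact mul_kernelMaxDeriv_mono hs hst

lemma stieltjesMeasure_mul_kernelMaxDeriv_Ioc (q : ℕ) (r : ℝ) :
    stieltjesMeasure (fun s => s * kernelMaxDeriv q s) (Ioc 0 r) =
      ENNReal.ofReal ((monotone_max_mul_kernelMaxDeriv q).stieltjesFunction r) := by
  -- No mass is lost at the origin because `t M_q'(t) → 0` there.
  have h0 : (monotone_max_mul_kernelMaxDeriv q).stieltjesFunction 0 = 0 := by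
    rw [Monotone.stieltjesFunction_eq]
    refine rightLim_eq_of_tendsto ?_
    refine (tendsto_mul_kernelMaxDeriv_zero q).congr' ?_
    filter_upwards [self_mem_nhdsWithin] with t ht
    rw [max_eq_left (le_of_lt ht)]
  rw [stieltjesMeasure, dif_pos (monotone_max_mul_kernelMaxDeriv q),
    Measure.restrict_apply measurableSet_Ioc, inter_eq_left.2 Ioc_subset_Ioi_self,
    StieltjesFunction.measure_Ioc, h0, sub_zero]

instance sigmaFinite_stieltjesMeasure (f : ℝ → ℝ) : SigmaFinite (stieltjesMeasure f) := by
  unfold stieltjesMeasure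
  split_ifs <;> infer_instance

/-- The Stieltjes function is a right limit, so it can differ from `t M_q'(t)` only at the countably
many discontinuities of a monotone function. -/
lemma ae_stieltjesFunction_div_eq (q : ℕ) {r : ℝ} (hr : 0 < r) :
    ∀ᵐ x ∂(volume.restrict (Ioi (0 : ℝ))),
      (monotone_max_mul_kernelMaxDeriv q).stieltjesFunction (r / x) =
        r / x * kernelMaxDeriv q (r / x) := by
  have hc := (monotone_max_mul_kernelMaxDeriv q).countable_not_continuousAt
  have hc' : ((fun x : ℝ => r / x) ⁻¹' {t | ¬ContinuousAt
      (fun t : ℝ => max t 0 * kernelMaxDeriv q (max t 0)) t}).Countable := by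
    refine hc.preimage fun x y h => ?_
    simpa [div_eq_mul_inv, hr.ne'] using h
  filter_upwards [ae_restrict_of_ae (hc'.ae_notMem volume), ae_restrict_mem measurableSet_Ioi] with x hx hx0
  have hx' : ContinuousAt (fun t : ℝ => max t 0 * kernelMaxDeriv q (max t 0)) (r / x) := by
    simpa using hx
  rw [Monotone.stieltjesFunction_eq, hx'.continuousWithinAt.rightLim_eq,
    max_eq_left (div_nonneg hr.le (le_of_lt hx0))]

end Stieltjes

/-! ### Bounds for the canonical integral. -/

section CanonicalBounds

lemma lintegral_kernelMax_div_norm (q : ℕ) {μ : Measure ℂ} [SFinite μ] (h0 : radialCount μ 0 = 0)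
    {r : ℝ} (hr : 0 ≤ r) :
    ∫⁻ w, ENNReal.ofReal (kernelMax q (r / ‖w‖)) ∂μ =
      ∫⁻ t in Ioi (0 : ℝ), radialCount μ (r / t) * ENNReal.ofReal (kernelMaxDeriv q t) := by
  have hS : MeasurableSet {p : ℂ × ℝ | p.2 * ‖p.1‖ ≤ r} :=
    measurableSet_le (measurable_snd.mul measurable_fst.norm) measurable_const
  have key : ∀ᵐ w ∂μ, ENNReal.ofReal (kernelMax q (r / ‖w‖)) =
      ∫⁻ t in {t | (w, t) ∈ {p : ℂ × ℝ | p.2 * ‖p.1‖ ≤ r}}, ENNReal.ofReal (kernelMaxDeriv q t)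
        ∂(volume.restrict (Ioi 0)) := by
    filter_upwards [measure_eq_zero_iff_ae_notMem.1 h0] with w hw
    have hw' : 0 < ‖w‖ := by simpa using hw
    have e : {t : ℝ | t * ‖w‖ ≤ r} = Iic (r / ‖w‖) := by
      ext t
      simp [le_div_iff₀ hw']
    rw [e, Measure.restrict_restrict measurableSet_Iic, Iic_inter_Ioi,
      lintegral_kernelMaxDeriv q (div_nonneg hr hw'.le)]
  rw [lintegral_congr_ae key, lintegral_setLIntegral_swap hS
    (measurable_kernelMaxDeriv_of_pos q).ennreal_ofReal]
  refine setLIntegral_congr_fun measurableSet_Ioi fun t ht => ?_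
  have e : {w | (w, t) ∈ {p : ℂ × ℝ | p.2 * ‖p.1‖ ≤ r}} = closedBall 0 (r / t) := by
    ext w
    simp [le_div_iff₀' (mem_Ioi.1 ht)]
  simp only [e, radialCount, mul_comm]

/-- Integration by parts against `d(t M_q'(t))`, for the primitive of `n(x) / x`. -/
lemma lintegral_primitive_stieltjesMeasure (q : ℕ) {n : ℝ → ℝ≥0∞} (hn : Measurable n) {r : ℝ}
    (hr : 0 < r) :
    ∫⁻ t in Ioi (0 : ℝ), (∫⁻ x in Ioc 0 (r / t), n x / ENNReal.ofReal x)
        ∂(stieltjesMeasure fun s => s * kernelMaxDeriv q s) =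
      ∫⁻ t in Ioi (0 : ℝ), n (r / t) * ENNReal.ofReal (kernelMaxDeriv q t) ∧
    ∫⁻ x in Ioi (0 : ℝ), n x / ENNReal.ofReal x *
        ENNReal.ofReal (r / x * kernelMaxDeriv q (r / x)) =
      ∫⁻ t in Ioi (0 : ℝ), n (r / t) * ENNReal.ofReal (kernelMaxDeriv q t) := by
  set γ := stieltjesMeasure fun s => s * kernelMaxDeriv q s with hγ
  have hS : MeasurableSet {p : ℝ × ℝ | p.2 * p.1 ≤ r} :=
    measurableSet_le (measurable_snd.mul measurable_fst) measurable_const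
  have hg : Measurable fun x : ℝ => n x / ENNReal.ofReal x := by fun_prop
  have h2 : ∫⁻ x in Ioi (0 : ℝ), n x / ENNReal.ofReal x *
        ENNReal.ofReal (r / x * kernelMaxDeriv q (r / x)) =
      ∫⁻ t in Ioi (0 : ℝ), n (r / t) * ENNReal.ofReal (kernelMaxDeriv q t) := by
    rw [lintegral_Ioi_comp_div hr fun t => n (r / t) * ENNReal.ofReal (kernelMaxDeriv q t)]
    refine setLIntegral_congr_fun measurableSet_Ioi fun x hx => ?_
    have hx0 : (0 : ℝ) < x := hx
    have e : r / (r / x) = x := by field_simp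
    simp only [e]
    rw [mul_left_comm, ← ENNReal.ofReal_mul (by positivity), div_eq_mul_inv, mul_assoc,
      ← ENNReal.ofReal_inv_of_pos hx0, ← ENNReal.ofReal_mul (by positivity)]
    congr 2
    field_simp
  refine ⟨?_, h2⟩
  rw [← h2]
  have h3 : ∫⁻ t in Ioi (0 : ℝ), (∫⁻ x in Ioc 0 (r / t), n x / ENNReal.ofReal x) ∂γ =
      ∫⁻ t in Ioi (0 : ℝ), (∫⁻ x in {x | (t, x) ∈ {p : ℝ × ℝ | p.2 * p.1 ≤ r}},
        n x / ENNReal.ofReal x ∂(volume.restrict (Ioi 0))) ∂γ := by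
    refine setLIntegral_congr_fun measurableSet_Ioi fun t ht => ?_
    have e : {x | (t, x) ∈ {p : ℝ × ℝ | p.2 * p.1 ≤ r}} = Iic (r / t) := by
      ext x
      simp [le_div_iff₀ (mem_Ioi.1 ht)]
    simp only [e]
    rw [Measure.restrict_restrict measurableSet_Iic, Iic_inter_Ioi]
  -- After Tonelli on `{t x ≤ r}` the inner integral is the mass of `(0, r/x]`, which is `(r/x)
  -- M_q'(r/x)` for almost every `x`.
  rw [h3, lintegral_setLIntegral_swap hS hg.aemeasurable]
  refine lintegral_congr_ae ?_
  filter_upwards [ae_stieltjesFunction_div_eq q hr, ae_restrict_mem measurableSet_Ioi] with x hx hx0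
  have e : {t : ℝ | x * t ≤ r} = Iic (r / x) := by
    ext t
    simp [le_div_iff₀' (mem_Ioi.1 hx0)]
  rw [e, Measure.restrict_apply measurableSet_Iic, Iic_inter_Ioi,
    stieltjesMeasure_mul_kernelMaxDeriv_Ioc, hx]

lemma toENNReal_primaryKernel_le (q : ℕ) (w : ℂ) :
    (primaryKernel q w).toENNReal ≤ ENNReal.ofReal (kernelMax q ‖w‖) := by
  rw [← EReal.real_coe_toENNReal]
  exact EReal.toENNReal_le_toENNReal (primaryKernel_le_kernelMax q w)

lemma lintegral_kernelMax_div_norm_lt_top {ρ ε r : ℝ} (hρ : 0 ≤ ρ) {μ : Measure ℂ} (hε : 0 < ε)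
    (h0 : radialCount μ ε = 0) (h : measureType ρ μ < ⊤) (hr : 0 ≤ r) :
    ∫⁻ w, ENNReal.ofReal (kernelMax ⌊ρ⌋₊ (r / ‖w‖)) ∂μ < ⊤ := by
  obtain ⟨C, hC, hM⟩ := exists_kernelMax_le_pow ⌊ρ⌋₊
  have hlt := lintegral_norm_rpow_neg_lt_top (σ := ((⌊ρ⌋₊ + 1 : ℕ) : ℝ)) hρ
    (by exact_mod_cast Nat.lt_floor_add_one ρ) hε h0 h
  refine lt_of_le_of_lt ?_ (ENNReal.mul_lt_top
    (ENNReal.ofReal_lt_top (r := C * r ^ (⌊ρ⌋₊ + 1))) hlt)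
  rw [← lintegral_const_mul _ (by fun_prop)]
  refine lintegral_mono fun w => ?_
  rw [← ENNReal.ofReal_mul (by positivity)]
  refine ENNReal.ofReal_le_ofReal ((hM _ (by positivity)).trans (le_of_eq ?_))
  rw [Real.rpow_neg (norm_nonneg w), Real.rpow_natCast, div_pow]
  ring

lemma eintegral_le_lintegral {α : Type*} [MeasurableSpace α] (μ : Measure α) (f : α → EReal) :
    eintegral μ f ≤ ((∫⁻ x, (f x).toENNReal ∂μ : ℝ≥0∞) : EReal) := by
  unfold eintegral
  simpa using EReal.sub_le_sub le_rfl (EReal.coe_ennreal_nonneg _)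

/-- Every integral on the right equals `∫ M_q(|z|/|w|) dμ(w)`, so one domination of the kernel and
one convergence proof settle all the claims. -/
theorem canonicalIntegral_bounds {ρ : ℝ} (hρ : 0 < ρ) {μ : Measure ℂ} (h0 : (0 : ℂ) ∉ μ.support)
    (h : measureType ρ μ < ⊤) (z : ℂ) :
    ∫⁻ w, (primaryKernel ⌊ρ⌋₊ (z / w)).toENNReal ∂μ < ⊤ ∧
      (canonicalIntegral ⌊ρ⌋₊ μ z ≤
          ((∫⁻ t in Ioi (0 : ℝ), ENNReal.ofReal (kernelMax ⌊ρ⌋₊ (‖z‖ / t))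
            ∂(stieltjesMeasure fun s => (radialCount μ s).toReal) : ℝ≥0∞) : EReal) ∧
        ∫⁻ t in Ioi (0 : ℝ), ENNReal.ofReal (kernelMax ⌊ρ⌋₊ (‖z‖ / t))
            ∂(stieltjesMeasure fun s => (radialCount μ s).toReal) =
          ∫⁻ t in Ioi (0 : ℝ),
            radialCount μ (‖z‖ / t) * ENNReal.ofReal (kernelMaxDeriv ⌊ρ⌋₊ t) ∧
        ∫⁻ t in Ioi (0 : ℝ),
            radialCount μ (‖z‖ / t) * ENNReal.ofReal (kernelMaxDeriv ⌊ρ⌋₊ t) < ⊤) ∧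
      (canonicalIntegral ⌊ρ⌋₊ μ z ≤
          ((∫⁻ t in Ioi (0 : ℝ), ENNReal.ofReal (‖z‖ / t * kernelMaxDeriv ⌊ρ⌋₊ (‖z‖ / t))
            ∂(stieltjesMeasure fun s => (averagedCount μ s).toReal) : ℝ≥0∞) : EReal) ∧
        ∫⁻ t in Ioi (0 : ℝ), ENNReal.ofReal (‖z‖ / t * kernelMaxDeriv ⌊ρ⌋₊ (‖z‖ / t))
            ∂(stieltjesMeasure fun s => (averagedCount μ s).toReal) =
          ∫⁻ t in Ioi (0 : ℝ), averagedCount μ (‖z‖ / t)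
            ∂(stieltjesMeasure fun s => s * kernelMaxDeriv ⌊ρ⌋₊ s) ∧
        ∫⁻ t in Ioi (0 : ℝ), averagedCount μ (‖z‖ / t)
            ∂(stieltjesMeasure fun s => s * kernelMaxDeriv ⌊ρ⌋₊ s) < ⊤) := by
  set q := ⌊ρ⌋₊ with hq
  obtain ⟨ε, hε, hμε⟩ : ∃ ε > 0, radialCount μ ε = 0 := by
    obtain ⟨U, hU, hμU⟩ := Measure.notMem_support_iff_exists.1 h0
    obtain ⟨ε, hε, hεU⟩ := nhds_basis_closedBall.mem_iff.1 hU
    exact ⟨ε, hε, measure_mono_null hεU hμU⟩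
  have hfin : ∀ t, radialCount μ t < ⊤ := radialCount_lt_top h
  have hμ0 : radialCount μ 0 = 0 := le_antisymm (hμε ▸ radialCount_mono μ hε.le) bot_le
  have := isLocallyFiniteMeasure_of_radialCount_lt_top hfin
  have hmeas : Measurable (radialCount μ) := (radialCount_mono μ).measurable
  have hzero : ∀ᵐ w ∂μ, 0 < ‖w‖ := by
    filter_upwards [measure_eq_zero_iff_ae_notMem.1 hμ0] with w hw
    simpa using hw
  have hlt : ∫⁻ w, ENNReal.ofReal (kernelMax q (‖z‖ / ‖w‖)) ∂μ < ⊤ :=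
    lintegral_kernelMax_div_norm_lt_top hρ.le hε hμε h (norm_nonneg z)
  have hle : ∫⁻ w, (primaryKernel q (z / w)).toENNReal ∂μ ≤
      ∫⁻ w, ENNReal.ofReal (kernelMax q (‖z‖ / ‖w‖)) ∂μ := by
    refine lintegral_mono fun w => ?_
    rw [← norm_div]
    exact toENNReal_primaryKernel_le q _
  have hU : canonicalIntegral q μ z ≤
      ((∫⁻ w, ENNReal.ofReal (kernelMax q (‖z‖ / ‖w‖)) ∂μ : ℝ≥0∞) : EReal) :=
    (eintegral_le_lintegral μ _).trans (EReal.coe_ennreal_le_coe_ennreal_iff.2 hle)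
  have hswap := lintegral_kernelMax_div_norm q hμ0 (norm_nonneg z)
  have hcount : ∫⁻ t in Ioi (0 : ℝ), ENNReal.ofReal (kernelMax q (‖z‖ / t))
      ∂(stieltjesMeasure fun s => (radialCount μ s).toReal) =
        ∫⁻ w, ENNReal.ofReal (kernelMax q (‖z‖ / ‖w‖)) ∂μ := by
    have hm : AEMeasurable (fun t => ENNReal.ofReal (kernelMax q (‖z‖ / t)))
        ((μ.map norm).restrict (Ioi 0)) := by
      refine aemeasurable_restrict_of_antitoneOn measurableSet_Ioi fun s hs t ht hst => ?_
      refine ENNReal.ofReal_le_ofReal (kernelMax_mono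
        (div_nonneg (norm_nonneg z) (le_of_lt ht)) ?_)
      exact div_le_div_of_nonneg_left (norm_nonneg z) hs hst
    rw [stieltjesMeasure_radialCount hμ0 hfin]
    rw [Measure.restrict_map measurable_norm measurableSet_Ioi] at hm ⊢
    rw [lintegral_map' hm measurable_norm.aemeasurable, Measure.restrict_eq_self_of_ae_mem]
    filter_upwards [hzero] with w hw using hw
  have hNfin : ∀ t, averagedCount μ t < ⊤ := by
    intro t
    have hle : averagedCount μ t ≤ ∫⁻ s in Ioc 0 t, radialCount μ t / ENNReal.ofReal ε := by
      refine setLIntegral_mono' measurableSet_Ioc fun s hs => ?_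
      rcases le_total s ε with hsε | hsε
      · have : radialCount μ s = 0 := le_antisymm (hμε ▸ radialCount_mono μ hsε) bot_le
        simp [this]
      · exact ENNReal.div_le_div (radialCount_mono μ hs.2) (ENNReal.ofReal_le_ofReal hsε)
    refine hle.trans_lt ?_
    rw [setLIntegral_const]
    exact ENNReal.mul_lt_top (ENNReal.div_lt_top (hfin t).ne (by simpa using hε)) (by simp)
  refine ⟨hle.trans_lt hlt, ⟨hcount ▸ hU, hcount.trans hswap, hswap ▸ hlt⟩, ?_⟩
  have hdens : ∫⁻ t in Ioi (0 : ℝ), ENNReal.ofReal (‖z‖ / t * kernelMaxDeriv q (‖z‖ / t))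
      ∂(stieltjesMeasure fun s => (averagedCount μ s).toReal) =
        ∫⁻ t in Ioi (0 : ℝ), radialCount μ t / ENNReal.ofReal t *
          ENNReal.ofReal (‖z‖ / t * kernelMaxDeriv q (‖z‖ / t)) := by
    rw [stieltjesMeasure_averagedCount hNfin, restrict_withDensity measurableSet_Ioi,
      Measure.restrict_restrict measurableSet_Ioi, inter_self,
      lintegral_withDensity_eq_lintegral_mul_non_measurable _ (by fun_prop)]
    · rfl
    · filter_upwards [ae_restrict_mem measurableSet_Ioi] with t ht
      exact ENNReal.div_lt_top (hfin t).ne (by simpa using ht)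
  rw [hdens]
  -- The substitution `t = r/x` needs `r > 0`; at the origin all these integrals vanish.
  rcases (norm_nonneg z).eq_or_lt with hz | hz
  · have e1 : ∫⁻ w, ENNReal.ofReal (kernelMax q (‖z‖ / ‖w‖)) ∂μ = 0 := by
      simp [← hz, kernelMax_zero]
    rw [e1] at hU
    simpa [← hz, averagedCount] using hU
  · obtain ⟨i1, i2⟩ := lintegral_primitive_stieltjesMeasure q hmeas hz
    change ∫⁻ t in Ioi (0 : ℝ), averagedCount μ (‖z‖ / t)
      ∂(stieltjesMeasure fun s => s * kernelMaxDeriv q s) = _ at i1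
    rw [i1, i2, ← hswap]
    exact ⟨hU, rfl, hlt⟩

end CanonicalBounds

/-! ### Polar coordinates through circles about the origin. -/

section Polar

/-- The measure `r dr ⊗ dθ` on `(0, ∞) × (0, 2π]`. -/
def polarMeasure : Measure (ℝ × ℝ) :=
  ((volume.restrict (Ioi (0 : ℝ))).withDensity fun r => ENNReal.ofReal r).prod
    (volume.restrict (Ioc 0 (2 * Real.pi)))

lemma measurePreserving_circleMap :
    MeasurePreserving (fun p : ℝ × ℝ => circleMap 0 p.1 p.2) polarMeasure volume := by
  have hm : Measurable fun p : ℝ × ℝ => circleMap 0 p.1 p.2 := by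
    unfold circleMap; fun_prop
  refine ⟨hm, Measure.ext_of_lintegral _ fun f hf => ?_⟩
  have hfm : Measurable fun p : ℝ × ℝ => f (circleMap 0 p.1 p.2) := hf.comp hm
  -- Angles in `(0, 2π]` become angles in `(-π, π)` by a shift by `π`, which multiplies the point by
  -- `-1`. The invariance of Lebesgue measure under negation is inserted to compensate.
  rw [lintegral_map hf hm, polarMeasure, lintegral_prod _ hfm.aemeasurable,
    lintegral_withDensity_eq_lintegral_mul _ (by fun_prop) hfm.lintegral_prod_right',
    ← (Measure.measurePreserving_neg (volume : Measure ℂ)).lintegral_comp hf,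
    ← Complex.lintegral_comp_polarCoord_symm, polarCoord_target,
    Measure.volume_eq_prod, ← Measure.prod_restrict, lintegral_prod]
  · refine setLIntegral_congr_fun measurableSet_Ioi fun r hr => ?_
    have hshift : ∀ g : ℝ → ℝ≥0∞, ∫⁻ θ in Ioc 0 (2 * Real.pi), g θ =
        ∫⁻ θ in Ioo (-Real.pi) Real.pi, g (θ + Real.pi) := fun g => by
      rw [← (measurePreserving_add_right volume Real.pi).setLIntegral_comp_preimage_emb
        (measurableEmbedding_addRight Real.pi), Measure.restrict_congr_set (Ioo_ae_eq_Ioc (μ := volume))]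
      congr 2
      ext θ
      simp only [mem_preimage, mem_Ioc]
      constructor <;> rintro ⟨h1, h2⟩ <;> constructor <;> linarith
    simp only [Pi.mul_apply]
    rw [hshift, ← lintegral_const_mul _ (by fun_prop)]
    refine lintegral_congr fun θ => ?_
    congr 2
    simp only [Complex.polarCoord_symm_apply, circleMap, zero_add, Complex.ofReal_add, add_mul,
      Complex.exp_add, Complex.exp_pi_mul_I, Complex.ofReal_cos, Complex.ofReal_sin]
    rw [Complex.exp_mul_I]
    ring
  · simp only [Complex.polarCoord_symm_apply, smul_eq_mul]
    fun_prop

lemma integral_eq_integral_circleAverage {F : ℂ → ℝ} (hF : Integrable F) :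
    IntegrableOn (fun r => r * Real.circleAverage F 0 r) (Ioi 0) ∧
    ∫ z, F z = 2 * Real.pi * ∫ r in Ioi (0 : ℝ), r * Real.circleAverage F 0 r := by
  have hp := measurePreserving_circleMap
  have hFp : Integrable (fun p : ℝ × ℝ => F (circleMap 0 p.1 p.2)) polarMeasure :=
    hp.integrable_comp_of_integrable hF
  have e : ∀ r : ℝ, ∫ θ in Ioc 0 (2 * Real.pi), F (circleMap 0 r θ) =
      2 * Real.pi * Real.circleAverage F 0 r := fun r => by
    rw [Real.circleAverage_def, intervalIntegral.integral_of_le Real.two_pi_pos.le, smul_eq_mul,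
      mul_inv_cancel_left₀ Real.two_pi_pos.ne']
  have h1 : ∫ z, F z = ∫ p, F (circleMap 0 p.1 p.2) ∂polarMeasure := by
    have := integral_map (φ := fun p : ℝ × ℝ => circleMap 0 p.1 p.2) (f := F)
      (μ := polarMeasure) hp.measurable.aemeasurable (by rw [hp.map_eq]; exact hF.1)
    rwa [hp.map_eq] at this
  have h2 := hFp.integral_prod_left
  simp only [e] at h2
  rw [integrable_withDensity_iff_integrable_smul₀' (by fun_prop)
    (ae_of_all _ fun _ => ENNReal.ofReal_lt_top)] at h2
  have h3 : IntegrableOn (fun r => r * Real.circleAverage F 0 r) (Ioi 0) := by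
    have := h2.const_mul (2 * Real.pi)⁻¹
    refine this.congr ?_
    filter_upwards [ae_restrict_mem measurableSet_Ioi] with r hr
    rw [ENNReal.toReal_ofReal (le_of_lt hr), smul_eq_mul]
    field_simp
  refine ⟨h3, ?_⟩
  rw [h1, polarMeasure, integral_prod _ hFp, integral_withDensity_eq_integral_toReal_smul
    (by fun_prop) (ae_of_all _ fun _ => ENNReal.ofReal_lt_top), ← integral_const_mul]
  refine setIntegral_congr_fun measurableSet_Ioi fun r hr => ?_
  simp only [e]
  rw [ENNReal.toReal_ofReal (le_of_lt hr), smul_eq_mul]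
  ring

end Polar

/-! ### Radial test functions and their Laplacians. -/

section Mollifier

lemma laplacian_eq_fderiv_fderiv {f : ℂ → ℝ} (hf : ContDiff ℝ 2 f) (z : ℂ) :
    Laplacian.laplacian f z = fderiv ℝ (fun y => fderiv ℝ f y 1) z 1 +
      fderiv ℝ (fun y => fderiv ℝ f y Complex.I) z Complex.I := by
  have hd : DifferentiableAt ℝ (fderiv ℝ f) z :=
    ((hf.fderiv_right (m := 1) le_rfl).differentiable one_ne_zero) z
  rw [InnerProductSpace.laplacian_eq_iteratedFDeriv_complexPlane]
  simp only [iteratedFDeriv_two_apply, Matrix.cons_val_zero, Matrix.cons_val_one]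
  rw [fderiv_clm_apply hd (differentiableAt_const _), fderiv_clm_apply hd (differentiableAt_const _)]
  simp

/-- A radial function with profile `a`. -/
def radialFunction (a : ℝ → ℝ) (z : ℂ) : ℝ := a (‖z‖ ^ 2)

/-- The Laplacian of `radialFunction a` as a function of the radius. -/
def radialLaplacian (a : ℝ → ℝ) (r : ℝ) : ℝ :=
  4 * deriv a (r ^ 2) + 4 * r ^ 2 * deriv (deriv a) (r ^ 2)

variable {a : ℝ → ℝ}

lemma contDiff_radialFunction (ha : ContDiff ℝ ∞ a) : ContDiff ℝ ∞ (radialFunction a) :=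
  ha.comp (contDiff_norm_sq ℝ)

lemma radialFunction_eq_zero (h1 : ∀ x, 1 ≤ x → a x = 0) {z : ℂ} (hz : 1 ≤ ‖z‖) :
    radialFunction a z = 0 := h1 _ (one_le_pow₀ hz)

lemma hasCompactSupport_radialFunction (h1 : ∀ x, 1 ≤ x → a x = 0) :
    HasCompactSupport (radialFunction a) :=
  HasCompactSupport.intro (isCompact_closedBall 0 1) fun z hz =>
    radialFunction_eq_zero h1 (by simpa using (not_le.1 (by simpa using hz) : 1 < ‖z‖).le)

lemma laplacian_radialFunction (ha : ContDiff ℝ ∞ a) (z : ℂ) :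
    Laplacian.laplacian (radialFunction a) z = radialLaplacian a ‖z‖ := by
  have hs : ∀ z : ℂ, HasFDerivAt (fun z : ℂ => ‖z‖ ^ 2) (2 • innerSL ℝ z) z := fun z =>
    (hasStrictFDerivAt_norm_sq z).hasFDerivAt
  have ha1 : ContDiff ℝ ∞ (deriv a) := by
    simpa using (contDiff_infty_iff_deriv.1 ha).2
  have hd : ∀ x, HasDerivAt a (deriv a x) x := fun x =>
    (ha.differentiable (by simp) x).hasDerivAt
  have hd1 : ∀ x, HasDerivAt (deriv a) (deriv (deriv a) x) x := fun x =>
    (ha1.differentiable (by simp) x).hasDerivAt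
  have h1 : ∀ y v : ℂ, fderiv ℝ (radialFunction a) y v =
      2 * deriv a (‖y‖ ^ 2) * inner ℝ y v := fun y v => by
    have := (hd (‖y‖ ^ 2)).comp_hasFDerivAt y (hs y)
    rw [show radialFunction a = a ∘ fun z : ℂ => ‖z‖ ^ 2 from rfl, this.fderiv]
    simp
    ring
  have h2 : ∀ v : ℂ, fderiv ℝ (fun y => fderiv ℝ (radialFunction a) y v) z v =
      2 * deriv a (‖z‖ ^ 2) * inner ℝ v v +
        4 * deriv (deriv a) (‖z‖ ^ 2) * (inner ℝ z v) ^ 2 := fun v => by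
    simp only [h1]
    have e1 := ((hd1 (‖z‖ ^ 2)).comp_hasFDerivAt z (hs z)).const_mul 2
    simp only [Function.comp_def] at e1
    have e2 : HasFDerivAt (fun y : ℂ => inner ℝ y v) (innerSL ℝ v) z := by
      have := (innerSL ℝ v).hasFDerivAt (x := z)
      refine this.congr_of_eventuallyEq (Eventually.of_forall fun y => ?_)
      simp [real_inner_comm]
    rw [show (fun y : ℂ => 2 * deriv a (‖y‖ ^ 2) * inner ℝ y v) =
      (fun y => 2 * deriv a (‖y‖ ^ 2)) * fun y => inner ℝ y v from rfl, (e1.mul e2).fderiv]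
    simp
    ring
  rw [laplacian_eq_fderiv_fderiv ((contDiff_radialFunction ha).of_le (by norm_cast)),
    h2, h2, radialLaplacian, ← Complex.normSq_eq_norm_sq, Complex.normSq_apply]
  simp [Complex.inner]
  ring

lemma deriv_eq_zero_of_one_lt (h1 : ∀ x, 1 ≤ x → a x = 0) {x : ℝ} (hx : 1 < x) :
    deriv a x = 0 := by
  have : a =ᶠ[nhds x] fun _ => 0 := by
    filter_upwards [lt_mem_nhds hx] with y hy using h1 y hy.le
  rw [this.deriv_eq, deriv_const]

lemma deriv_deriv_eq_zero_of_one_lt (h1 : ∀ x, 1 ≤ x → a x = 0) {x : ℝ} (hx : 1 < x) :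
    deriv (deriv a) x = 0 := by
  have : deriv a =ᶠ[nhds x] fun _ => 0 := by
    filter_upwards [lt_mem_nhds hx] with y hy using deriv_eq_zero_of_one_lt h1 hy
  rw [this.deriv_eq, deriv_const]

lemma radialLaplacian_eq_zero (h1 : ∀ x, 1 ≤ x → a x = 0) {r : ℝ} (hr : 1 < r) :
    radialLaplacian a r = 0 := by
  have : 1 < r ^ 2 := one_lt_pow₀ hr two_ne_zero
  simp [radialLaplacian, deriv_eq_zero_of_one_lt h1 this, deriv_deriv_eq_zero_of_one_lt h1 this]

lemma continuous_radialLaplacian (ha : ContDiff ℝ ∞ a) : Continuous (radialLaplacian a) := by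
  have ha1 : ContDiff ℝ ∞ (deriv a) := by simpa using (contDiff_infty_iff_deriv.1 ha).2
  have ha2 : ContDiff ℝ ∞ (deriv (deriv a)) := by simpa using (contDiff_infty_iff_deriv.1 ha1).2
  have := ha1.continuous
  have := ha2.continuous
  unfold radialLaplacian
  fun_prop

/-- The radial form of Green's formula for the logarithmic kernel. -/
lemma integral_radialLaplacian_mul_log (ha : ContDiff ℝ ∞ a) (h1 : ∀ x, 1 ≤ x → a x = 0) {d : ℝ}
    (hd : 0 ≤ d) (c : ℝ) :
    ∫ r in Ioi (0 : ℝ), r * (radialLaplacian a r * (Real.log (max d r) + c)) = a (d ^ 2) := by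
  have ha1 : ContDiff ℝ ∞ (deriv a) := by simpa using (contDiff_infty_iff_deriv.1 ha).2
  have hca := ha1.continuous
  have hL := continuous_radialLaplacian ha
  have hda : ∀ x, HasDerivAt a (deriv a x) x := fun x =>
    (ha.differentiable (by simp) x).hasDerivAt
  have hda1 : ∀ x, HasDerivAt (deriv a) (deriv (deriv a) x) x := fun x =>
    (ha1.differentiable (by simp) x).hasDerivAt
  -- With `φ(r) = a(r²)`, `W` is `r φ'(r)`; the polar form of the Laplacian reads `W' = r Δφ`.
  set W : ℝ → ℝ := fun r => 2 * r ^ 2 * deriv a (r ^ 2) with hW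
  have hsq : ∀ r : ℝ, HasDerivAt (fun r : ℝ => r ^ 2) (2 * r) r := fun r => by
    simpa using hasDerivAt_pow 2 r
  have hWd : ∀ r, HasDerivAt W (r * radialLaplacian a r) r := fun r => by
    have e1 := ((hsq r).const_mul 2).mul ((hda1 (r ^ 2)).comp r (hsq r))
    refine e1.congr_deriv ?_
    simp only [radialLaplacian, Function.comp]
    ring
  -- An antiderivative of the integrand away from `d`: below `d` the last term is constant, and
  -- above `d` its derivative cancels the contribution `W / r` of the logarithm.
  set J : ℝ → ℝ := fun r => W r * (Real.log (max d r) + c) - a (max d r ^ 2) with hJ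
  have hJc : ContinuousOn J (Icc 0 2) := by
    have hca0 := ha.continuous
    have h2 : ContinuousOn (fun r => W r * Real.log (max d r)) (Icc 0 2) := by
      rcases hd.eq_or_lt with rfl | hd
      · have : Continuous fun r : ℝ => 2 * r * deriv a (r ^ 2) * (r * Real.log r) :=
          (by fun_prop : Continuous fun r : ℝ => 2 * r * deriv a (r ^ 2)).mul
            Real.continuous_mul_log
        refine this.continuousOn.congr fun r hr => ?_
        simp only [hW, max_eq_right hr.1]
        ring
      · have : Continuous fun r : ℝ => Real.log (max d r) :=
          (by fun_prop : Continuous fun r : ℝ => max d r).log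
            fun r => (lt_max_of_lt_left hd).ne'
        exact (Continuous.mul (by fun_prop) this).continuousOn
    have h3 : Continuous fun r => W r * c - a (max d r ^ 2) := by fun_prop
    refine (h2.add h3.continuousOn).congr fun r _ => ?_
    simp only [hJ, Pi.add_apply]
    ring
  have hJd : ∀ r ∈ Ioo (0 : ℝ) 2 \ {d}, HasDerivAt J
      (r * (radialLaplacian a r * (Real.log (max d r) + c))) r := by
    rintro r ⟨⟨hr0, -⟩, hrd⟩
    rcases lt_or_gt_of_ne hrd with h | h
    · have e : J =ᶠ[nhds r] fun r => W r * (Real.log d + c) - a (d ^ 2) := by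
        filter_upwards [gt_mem_nhds h] with x hx
        simp [hJ, max_eq_left (le_of_lt hx)]
      refine HasDerivAt.congr_of_eventuallyEq ?_ e
      rw [max_eq_left h.le]
      refine (((hWd r).mul_const _).sub_const _).congr_deriv ?_
      ring
    · have e : J =ᶠ[nhds r] fun r => W r * (Real.log r + c) - a (r ^ 2) := by
        filter_upwards [lt_mem_nhds h] with x hx
        simp [hJ, max_eq_right (le_of_lt hx)]
      refine HasDerivAt.congr_of_eventuallyEq ?_ e
      rw [max_eq_right (le_of_lt h)]
      refine (((hWd r).mul ((Real.hasDerivAt_log hr0.ne').add_const c)).sub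
        ((hda (r ^ 2)).comp r (hsq r))).congr_deriv ?_
      simp only [hW]
      field_simp
      ring
  have hInt : IntervalIntegrable
      (fun r => r * (radialLaplacian a r * (Real.log (max d r) + c))) volume 0 2 := by
    have h3 : Continuous fun r => r * radialLaplacian a r := by fun_prop
    have h2 : IntervalIntegrable (fun r => Real.log (max d r) + c) volume 0 2 := by
      refine IntervalIntegrable.add ?_ intervalIntegrable_const
      rcases hd.eq_or_lt with rfl | hd
      · refine intervalIntegral.intervalIntegrable_log'.congr fun r hr => ?_
        rw [uIoc_of_le zero_le_two] at hr
        simp [max_eq_right hr.1.le]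
      · have : Continuous fun r : ℝ => Real.log (max d r) :=
          (by fun_prop : Continuous fun r : ℝ => max d r).log
            fun r => (lt_max_of_lt_left hd).ne'
        exact this.intervalIntegrable _ _
    refine (h2.continuousOn_mul h3.continuousOn).congr fun r _ => ?_
    ring
  have key := integral_eq_of_hasDerivAt_off_countable_of_le _ _ zero_le_two
    (countable_singleton d) hJc hJd hInt
  -- The endpoint `2` lies strictly beyond `1`, where `a'` vanishes too. Since `W` is zero at both
  -- ends, the constant `c` drops out.
  have hJ2 : J 2 = 0 := by
    have e1 : deriv a ((2 : ℝ) ^ 2) = 0 := deriv_eq_zero_of_one_lt h1 (by norm_num)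
    have e2 : a (max d 2 ^ 2) = 0 := h1 _ (one_le_pow₀ (le_max_of_le_right (by norm_num)))
    simp [hJ, hW, e1, e2]
  have hJ0 : J 0 = -a (d ^ 2) := by simp [hJ, hW, max_eq_left hd]
  rw [hJ2, hJ0, intervalIntegral.integral_of_le zero_le_two, zero_sub, neg_neg] at key
  rw [← key]
  refine setIntegral_eq_of_subset_of_forall_sdiff_eq_zero measurableSet_Ioi Ioc_subset_Ioi_self
    fun r hr => ?_
  have hr2 : 2 < r := by
    by_contra! h
    exact hr.2 ⟨hr.1, h⟩
  rw [radialLaplacian_eq_zero h1 (by linarith)]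
  simp

lemma circleAverage_mul_comp_norm_sub (f : ℂ → ℝ) (Ψ : ℝ → ℝ) (z₀ : ℂ) {r : ℝ} (hr : 0 ≤ r) :
    Real.circleAverage (fun z => f (z₀ + z) * Ψ ‖z‖) 0 r = Ψ r * Real.circleAverage f z₀ r := by
  simp only [Real.circleAverage_def, smul_eq_mul]
  have h : ∀ θ, f (z₀ + circleMap 0 r θ) * Ψ ‖circleMap 0 r θ‖ = Ψ r * f (circleMap z₀ r θ) :=
    fun θ => by simp [circleMap, abs_of_nonneg hr, mul_comm]
  simp only [h, intervalIntegral.integral_const_mul]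
  ring

lemma integral_mul_comp_norm_sub {f : ℂ → ℝ} {Ψ : ℝ → ℝ} {z₀ : ℂ}
    (hInt : Integrable fun z => f z * Ψ ‖z - z₀‖) :
    IntegrableOn (fun r => r * (Ψ r * Real.circleAverage f z₀ r)) (Ioi 0) ∧
    ∫ z, f z * Ψ ‖z - z₀‖ =
      2 * Real.pi * ∫ r in Ioi (0 : ℝ), r * (Ψ r * Real.circleAverage f z₀ r) := by
  have h1 : Integrable fun z => f (z₀ + z) * Ψ ‖z‖ := by
    simpa using hInt.comp_add_left z₀
  obtain ⟨h2, h3⟩ := integral_eq_integral_circleAverage h1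
  have e : ∫ z, f z * Ψ ‖z - z₀‖ = ∫ z, f (z₀ + z) * Ψ ‖z‖ := by
    rw [← integral_add_left_eq_self (μ := volume) _ z₀]
    simp
  rw [e, h3]
  refine ⟨h2.congr_fun (fun r hr => ?_) measurableSet_Ioi, ?_⟩
  · simp only [circleAverage_mul_comp_norm_sub f Ψ z₀ (le_of_lt hr)]
  · congr 1
    refine setIntegral_congr_fun measurableSet_Ioi fun r hr => ?_
    simp only [circleAverage_mul_comp_norm_sub f Ψ z₀ (le_of_lt hr)]

/-- A function whose circle means about `z₀` are those of a logarithmic kernel has, against the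
Laplacian of a radial test function about `z₀`, the integral of that kernel. -/
lemma integral_mul_radialLaplacian (ha : ContDiff ℝ ∞ a) (h1 : ∀ x, 1 ≤ x → a x = 0)
    {f : ℂ → ℝ} {z₀ : ℂ} {d c : ℝ} (hd : 0 ≤ d)
    (hInt : Integrable fun z => f z * radialLaplacian a ‖z - z₀‖)
    (hf : ∀ r, 0 < r → Real.circleAverage f z₀ r = Real.log (max d r) + c) :
    ∫ z, f z * radialLaplacian a ‖z - z₀‖ = 2 * Real.pi * a (d ^ 2) := by
  rw [(integral_mul_comp_norm_sub hInt).2, ← integral_radialLaplacian_mul_log ha h1 hd c]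
  congr 1
  refine setIntegral_congr_fun measurableSet_Ioi fun r hr => ?_
  simp only [hf r hr]

lemma integral_radialFunction (ha : ContDiff ℝ ∞ a) (h1 : ∀ x, 1 ≤ x → a x = 0) :
    ∫ z, radialFunction a z = 2 * Real.pi * ∫ r in Ioi (0 : ℝ), r * a (r ^ 2) := by
  have hInt : Integrable fun z : ℂ => (1 : ℝ) * a (‖z - 0‖ ^ 2) := by
    simp only [sub_zero, one_mul]
    exact (contDiff_radialFunction ha).continuous.integrable_of_hasCompactSupport
      (hasCompactSupport_radialFunction h1)
  have := (integral_mul_comp_norm_sub (f := fun _ => 1) (Ψ := fun r => a (r ^ 2)) hInt).2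
  simpa [radialFunction, Real.circleAverage_const] using this

/-- In polar coordinates the integral is a weighted average of the circle means, with nonnegative
weights of total mass one. -/
lemma le_integral_mul_radialFunction (ha : ContDiff ℝ ∞ a) (h1 : ∀ x, 1 ≤ x → a x = 0)
    (hpos : ∀ x, 0 ≤ a x) (hone : ∫ z, radialFunction a z = 1) {f : ℂ → ℝ} {z₀ : ℂ} {m : ℝ}
    (hInt : Integrable fun z => f z * radialFunction a (z - z₀))
    (hf : ∀ r, 0 < r → m ≤ Real.circleAverage f z₀ r) :
    m ≤ ∫ z, f z * radialFunction a (z - z₀) := by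
  obtain ⟨h2, h3⟩ := integral_mul_comp_norm_sub (f := f) (Ψ := fun r => a (r ^ 2)) hInt
  have h4 : ∫ z, f z * radialFunction a (z - z₀) = _ := h3
  rw [h4]
  have hInt' : Integrable fun z : ℂ => (1 : ℝ) * a (‖z - 0‖ ^ 2) := by
    simp only [sub_zero, one_mul]
    exact (contDiff_radialFunction ha).continuous.integrable_of_hasCompactSupport
      (hasCompactSupport_radialFunction h1)
  have h5 := (integral_mul_comp_norm_sub (f := fun _ => 1) (Ψ := fun r => a (r ^ 2)) hInt').1
  simp only [Real.circleAverage_const, mul_one] at h5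
  rw [integral_radialFunction ha h1] at hone
  calc m = 2 * Real.pi * ∫ r in Ioi (0 : ℝ), r * (a (r ^ 2)) * m := by
        rw [integral_mul_const, ← mul_assoc, hone, one_mul]
    _ ≤ _ := by
        refine mul_le_mul_of_nonneg_left ?_ Real.two_pi_pos.le
        refine setIntegral_mono_on (h5.mul_const m) h2 measurableSet_Ioi fun r hr => ?_
        rw [mul_assoc]
        exact mul_le_mul_of_nonneg_left (mul_le_mul_of_nonneg_left (hf r hr) (hpos _))
          (le_of_lt hr)

end Mollifier

/-! ### Mollification, and a Liouville theorem from `L¹` means. -/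

section Harmonic

open scoped Convolution in
lemma fderiv_convolution_apply {h φ : ℂ → ℝ} (hh : LocallyIntegrable h) (hφ : ContDiff ℝ ∞ φ)
    (hc : HasCompactSupport φ) (z v : ℂ) :
    fderiv ℝ (h ⋆[ContinuousLinearMap.mul ℝ ℝ] φ) z v =
      (h ⋆[ContinuousLinearMap.mul ℝ ℝ] fun y => fderiv ℝ φ y v) z := by
  have h1 : ContDiff ℝ 1 φ := hφ.of_le (by norm_cast)
  rw [(hc.hasFDerivAt_convolution_right (ContinuousLinearMap.mul ℝ ℝ) hh h1 z).fderiv,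
    convolution_precompR_apply _ hh (hc.fderiv ℝ) (h1.continuous_fderiv one_ne_zero)]

/-- The mollification `z ↦ ∫ h(ζ) φ(ζ - z) dA(ζ)` of `h` by a radial function. -/
def mollify (a : ℝ → ℝ) (h : ℂ → ℝ) (z : ℂ) : ℝ := ∫ ζ, h ζ * radialFunction a (ζ - z)

variable {a : ℝ → ℝ}

lemma integrable_mul_radialFunction (ha : ContDiff ℝ ∞ a) (h1 : ∀ x, 1 ≤ x → a x = 0)
    {h : ℂ → ℝ} (hh : LocallyIntegrable h) (z : ℂ) :
    Integrable fun ζ => h ζ * radialFunction a (ζ - z) := by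
  have := hh.integrable_smul_left_of_hasCompactSupport
    (g := fun ζ => radialFunction a (ζ - z))
    ((contDiff_radialFunction ha).continuous.comp (by fun_prop))
    ((hasCompactSupport_radialFunction h1).comp_homeomorph (Homeomorph.subRight z))
  simpa [mul_comm] using this

lemma integrable_mul_radialLaplacian (ha : ContDiff ℝ ∞ a) (h1 : ∀ x, 1 ≤ x → a x = 0)
    {h : ℂ → ℝ} (hh : LocallyIntegrable h) (z : ℂ) :
    Integrable fun ζ => h ζ * radialLaplacian a ‖ζ - z‖ := by
  have hL := continuous_radialLaplacian ha
  have := hh.integrable_smul_left_of_hasCompactSupport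
    (g := fun ζ => radialLaplacian a ‖ζ - z‖) (by fun_prop)
    (HasCompactSupport.intro (isCompact_closedBall z 1) fun ζ hζ =>
      radialLaplacian_eq_zero h1 (by simpa [dist_eq_norm] using hζ))
  simpa [mul_comm] using this

open scoped Convolution in
lemma mollify_eq_convolution (h : ℂ → ℝ) :
    mollify a h = h ⋆[ContinuousLinearMap.mul ℝ ℝ] radialFunction a := by
  ext z
  rw [mollify, convolution_def]
  refine integral_congr_ae (ae_of_all _ fun ζ => ?_)
  simp [radialFunction, norm_sub_rev]

lemma contDiff_mollify (ha : ContDiff ℝ ∞ a) (h1 : ∀ x, 1 ≤ x → a x = 0) {h : ℂ → ℝ}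
    (hh : LocallyIntegrable h) : ContDiff ℝ ∞ (mollify a h) := by
  rw [mollify_eq_convolution]
  exact (hasCompactSupport_radialFunction h1).contDiff_convolution_right _ hh
    (contDiff_radialFunction ha)

-- Both derivatives fall on the smooth factor of the convolution, so local integrability of `h`
-- suffices.
open scoped Convolution in
lemma laplacian_mollify (ha : ContDiff ℝ ∞ a) (h1 : ∀ x, 1 ≤ x → a x = 0) {h : ℂ → ℝ}
    (hh : LocallyIntegrable h) (z : ℂ) :
    Laplacian.laplacian (mollify a h) z = ∫ ζ, h ζ * radialLaplacian a ‖ζ - z‖ := by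
  have hφ := contDiff_radialFunction ha
  have hc := hasCompactSupport_radialFunction h1
  have hφ' : ∀ v : ℂ, ContDiff ℝ ∞ fun y => fderiv ℝ (radialFunction a) y v := fun v =>
    (hφ.fderiv_right (m := ∞) (by norm_cast)).clm_apply contDiff_const
  have hφ'' : ∀ v : ℂ, Continuous
      (fun y => fderiv ℝ (fun y => fderiv ℝ (radialFunction a) y v) y v) := fun v =>
    (((hφ' v).fderiv_right (m := ∞) (by norm_cast)).clm_apply contDiff_const).continuous
  rw [laplacian_eq_fderiv_fderiv ((contDiff_mollify ha h1 hh).of_le (by norm_cast)),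
    mollify_eq_convolution]
  simp only [fderiv_convolution_apply hh hφ hc]
  have e : ∀ v : ℂ, fderiv ℝ (fun y => (h ⋆[ContinuousLinearMap.mul ℝ ℝ]
      fun y => fderiv ℝ (radialFunction a) y v) y) z v =
        ∫ ζ, h ζ * fderiv ℝ (fun y => fderiv ℝ (radialFunction a) y v) (z - ζ) v := fun v => by
    rw [fderiv_convolution_apply hh (hφ' v) (hc.fderiv_apply ℝ v), convolution_def]
    rfl
  have hi : ∀ v : ℂ, Integrable fun ζ =>
      h ζ * fderiv ℝ (fun y => fderiv ℝ (radialFunction a) y v) (z - ζ) v := fun v => by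
    have := ((hc.fderiv_apply ℝ v).fderiv_apply ℝ v).convolutionExists_right
      (ContinuousLinearMap.mul ℝ ℝ) hh (hφ'' v) z
    exact this
  rw [e, e, ← integral_add (hi 1) (hi Complex.I)]
  refine integral_congr_ae (ae_of_all _ fun ζ => ?_)
  simp only
  rw [← mul_add, ← laplacian_eq_fderiv_fderiv (hφ.of_le (by norm_cast)),
    laplacian_radialFunction ha, norm_sub_rev]

lemma harmonicOnNhd_mollify (ha : ContDiff ℝ ∞ a) (h1 : ∀ x, 1 ≤ x → a x = 0) {h : ℂ → ℝ}
    (hh : LocallyIntegrable h) (h0 : ∀ z, ∫ ζ, h ζ * radialLaplacian a ‖ζ - z‖ = 0) :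
    InnerProductSpace.HarmonicOnNhd (mollify a h) univ := fun z _ =>
  ⟨((contDiff_mollify ha h1 hh).of_le (by norm_cast)).contDiffAt,
    Eventually.of_forall fun w => (laplacian_mollify ha h1 hh w).trans (h0 w)⟩

/-- A Liouville theorem: a harmonic function on the plane whose `L¹` means on circles grow at most
like `R ^ ρ`, with `ρ < q + 1`, is a harmonic polynomial of degree at most `q`. -/
lemma exists_abs_le_of_circleAverage_abs_le {g : ℂ → ℝ}
    (hg : InnerProductSpace.HarmonicOnNhd g univ) {q : ℕ} {ρ C : ℝ} (hρ : ρ < q + 1)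
    (h : ∀ R : ℝ, 1 ≤ R → Real.circleAverage |g| 0 R ≤ C * R ^ ρ) :
    ∃ C', ∀ z, |g z| ≤ C' * (1 + ‖z‖) ^ q := by
  obtain ⟨F, hFan, hFre⟩ := hg.exists_analyticOnNhd_univ_re_eq
  have hF : Differentiable ℂ F := fun z => (hFan z (mem_univ z)).differentiableAt
  have hgF : ∀ z, g z = (F z).re := fun z => (congrFun hFre z).symm
  have hgc : Continuous g := by
    rw [← hFre]
    exact Complex.continuous_re.comp hF.continuous
  -- For `|w| ≤ R/2` the Poisson kernel on `|z| = R` is at most `R² / (R/2)² = 4`, so the `L¹` mean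
  -- controls `g` pointwise.
  have hpt : ∀ R : ℝ, 1 ≤ R → ∀ w : ℂ, ‖w‖ ≤ R / 2 → |g w| ≤ 4 * (C * R ^ ρ) := by
    intro R hR w hw
    have hR0 : 0 < R := zero_lt_one.trans_le hR
    have hker : ∀ z ∈ sphere (0 : ℂ) |R|, |(poissonKernel 0 w • g) z| ≤ 4 * |g| z := by
      intro z hz
      rw [abs_of_pos hR0, mem_sphere_zero_iff_norm] at hz
      have hzw : R / 2 ≤ ‖z - w‖ := by
        have := norm_sub_norm_le z w
        linarith
      have hsq : (R / 2) ^ 2 ≤ ‖z - w‖ ^ 2 := pow_le_pow_left₀ (by positivity) hzw 2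
      have hk0 : 0 ≤ poissonKernel 0 w z := by
        rw [poissonKernel_def]
        simp only [sub_zero, hz]
        refine div_nonneg (sub_nonneg.2 (pow_le_pow_left₀ (norm_nonneg w) (by linarith) 2))
          (by positivity)
      have hk : poissonKernel 0 w z ≤ 4 := by
        rw [poissonKernel_def]
        simp only [sub_zero, hz]
        rw [div_le_iff₀ (lt_of_lt_of_le (by positivity) hsq)]
        nlinarith [sq_nonneg ‖w‖]
      simp only [Pi.smul_apply', smul_eq_mul, abs_mul, abs_of_nonneg hk0, Pi.abs_apply]
      gcongr
    have hcont : ContinuousOn (poissonKernel 0 w • g) (sphere 0 |R|) := by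
      refine ContinuousOn.smul ?_ hgc.continuousOn
      unfold poissonKernel
      refine ContinuousOn.div (by fun_prop) (by fun_prop) fun z hz => ?_
      rw [abs_of_pos hR0, mem_sphere_zero_iff_norm] at hz
      have := norm_sub_norm_le z w
      simp only [sub_zero]
      refine pow_ne_zero 2 (ne_of_gt ?_)
      linarith
    have hP := InnerProductSpace.HarmonicOnNhd.circleAverage_poissonKernel_smul
      (hg.mono (subset_univ (closedBall 0 R))) (w := w)
      (by rw [mem_ball_zero_iff]; linarith)
    rw [← hP]
    refine Real.abs_circleAverage_le_circleAverage_abs.trans ?_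
    calc Real.circleAverage |poissonKernel 0 w • g| 0 R
        ≤ Real.circleAverage (fun z => (4 : ℝ) • |g| z) 0 R := by
          refine Real.circleAverage_mono (ContinuousOn.circleIntegrable' hcont.abs)
            (ContinuousOn.circleIntegrable' ?_) hker
          exact (hgc.abs.const_smul (4 : ℝ)).continuousOn
      _ = 4 * Real.circleAverage |g| 0 R := Real.circleAverage_fun_smul
      _ ≤ 4 * (C * R ^ ρ) := by gcongr; exact h R hR
  have hC : 0 ≤ C := by
    have := (abs_nonneg _).trans (hpt 1 le_rfl 0 (by norm_num))
    simpa using this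
  -- Borel–Carathéodory recovers `F` from its real part, and Cauchy's estimates then give
  -- `O(R^(ρ-n))` plus a vanishing term for the derivatives of order `n > ρ`.
  have hcoef : ∀ n : ℕ, q + 1 ≤ n → iteratedDeriv n F 0 = 0 := by
    intro n hn
    have hbound : ∀ R : ℝ, 1 ≤ R → ‖iteratedDeriv n F 0‖ ≤
        n.factorial * 4 ^ n * (8 * (C + 1) * R ^ (ρ - n) + 3 * ‖F 0‖ * R ^ (-(n : ℝ))) := by
      intro R hR
      have hR0 : 0 < R := zero_lt_one.trans_le hR
      -- `C + 1` replaces `C` because a strictly positive bound is required. Passing from radius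
      -- `R/2` to `R/4` costs the factors `2` and `3` below.
      have hM : 0 < 4 * ((C + 1) * R ^ ρ) := by positivity
      have hsph : ∀ z ∈ sphere (0 : ℂ) (R / 4), ‖F z‖ ≤
          8 * (C + 1) * R ^ ρ + 3 * ‖F 0‖ := by
        intro z hz
        rw [mem_sphere_zero_iff_norm] at hz
        have := Complex.borelCaratheodory (R := R / 2) (z := z) hM hF.differentiableOn
          (fun w hw => by
            have hw' : ‖w‖ ≤ R / 2 := (mem_ball_zero_iff.1 hw).le
            have h2 := (le_abs_self _).trans (hpt R hR w hw')
            rw [hgF] at h2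
            refine h2.trans ?_
            gcongr
            linarith) (by positivity) (by rw [mem_ball_zero_iff, hz]; linarith)
        rw [hz] at this
        refine this.trans (le_of_eq ?_)
        field_simp
        ring
      refine (Complex.norm_iteratedDeriv_le_of_forall_mem_sphere_norm_le n (by positivity)
        hF.diffContOnCl hsph).trans (le_of_eq ?_)
      rw [Real.rpow_sub hR0, Real.rpow_neg hR0.le, Real.rpow_natCast, div_pow]
      field_simp
    have hlim : Tendsto (fun R : ℝ => n.factorial * 4 ^ n *
        (8 * (C + 1) * R ^ (ρ - n) + 3 * ‖F 0‖ * R ^ (-(n : ℝ)))) atTop (nhds 0) := by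
      have hn' : (q : ℝ) + 1 ≤ n := by exact_mod_cast hn
      have e1 : Tendsto (fun R : ℝ => R ^ (ρ - n)) atTop (nhds 0) := by
        simpa using tendsto_rpow_neg_atTop (y := n - ρ) (by linarith)
      have e2 : Tendsto (fun R : ℝ => R ^ (-(n : ℝ))) atTop (nhds 0) :=
        tendsto_rpow_neg_atTop (by have : (0 : ℝ) ≤ q := Nat.cast_nonneg q; linarith)
      simpa using ((e1.const_mul (8 * (C + 1))).add (e2.const_mul (3 * ‖F 0‖))).const_mul
        ((n.factorial : ℝ) * 4 ^ n)
    refine norm_le_zero_iff.1 (ge_of_tendsto hlim ?_)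
    filter_upwards [eventually_ge_atTop 1] with R hR using hbound R hR
  refine ⟨∑ n ∈ Finset.range (q + 1), ‖iteratedDeriv n F 0‖, fun z => ?_⟩
  have hsum := (Complex.hasSum_taylorSeries_of_entire hF 0 z).unique
    (hasSum_sum_of_ne_finset_zero (s := Finset.range (q + 1)) fun n hn => by
      rw [hcoef n (by simpa using hn)]; simp)
  rw [hgF, Finset.sum_mul]
  refine (Complex.abs_re_le_norm _).trans ?_
  rw [hsum]
  refine (norm_sum_le _ _).trans (Finset.sum_le_sum fun n hn => ?_)
  rw [norm_smul, norm_smul, sub_zero, norm_inv, norm_pow, Complex.norm_natCast]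
  have h2 : ‖z‖ ^ n ≤ (1 + ‖z‖) ^ q :=
    (pow_le_pow_left₀ (norm_nonneg z) (by linarith) n).trans
      (pow_le_pow_right₀ (by linarith [norm_nonneg z]) (by simpa using Finset.mem_range_succ_iff.1 hn))
  have h3 : ((n.factorial : ℝ))⁻¹ ≤ 1 := inv_le_one_of_one_le₀ (by exact_mod_cast n.factorial_pos)
  calc ((n.factorial : ℝ))⁻¹ * (‖z‖ ^ n * ‖iteratedDeriv n F 0‖)
      ≤ 1 * ((1 + ‖z‖) ^ q * ‖iteratedDeriv n F 0‖) := by gcongr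
    _ = _ := by ring

end Harmonic

/-! ### Local integrability and mollification of subharmonic functions. -/

section Subharmonic

/-- The bridge from extended-real to Bochner integrals: finiteness of both parts makes the values
`±∞` negligible, so `toReal` alters the function only on a null set. -/
lemma integrable_toReal_and_eintegral_eq {α : Type*} [MeasurableSpace α] {ν : Measure α}
    {f : α → EReal} (hf : Measurable f) (hP : ∫⁻ x, (f x).toENNReal ∂ν < ⊤)
    (hN : ∫⁻ x, (-f x).toENNReal ∂ν < ⊤) :
    (∀ᵐ x ∂ν, f x ≠ ⊥) ∧ Integrable (fun x => (f x).toReal) ν ∧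
      eintegral ν f = ((∫ x, (f x).toReal ∂ν : ℝ) : EReal) := by
  have hm1 : Measurable fun x => (f x).toENNReal := measurable_ereal_toENNReal.comp hf
  have hm2 : Measurable fun x => (-f x).toENNReal := measurable_ereal_toENNReal.comp hf.neg
  have h1 : ∀ᵐ x ∂ν, f x ≠ ⊥ ∧ f x ≠ ⊤ := by
    filter_upwards [ae_lt_top hm1 hP.ne, ae_lt_top hm2 hN.ne] with x hx1 hx2
    refine ⟨?_, EReal.toENNReal_ne_top_iff.1 hx1.ne⟩
    have := EReal.toENNReal_ne_top_iff.1 hx2.ne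
    simpa using this
  have e1 : ∀ᵐ x ∂ν, (f x).toENNReal = ENNReal.ofReal (f x).toReal := by
    filter_upwards [h1] with x hx using EReal.toENNReal_of_ne_top hx.2
  have e2 : ∀ᵐ x ∂ν, (-f x).toENNReal = ENNReal.ofReal (-(f x).toReal) := by
    filter_upwards [h1] with x hx
    rw [← EReal.coe_toReal hx.2 hx.1, ← EReal.coe_neg, EReal.real_coe_toENNReal, EReal.toReal_coe]
  have hInt : Integrable (fun x => (f x).toReal) ν := by
    refine ⟨(measurable_ereal_toReal.comp hf).aestronglyMeasurable, ?_⟩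
    refine lt_of_le_of_lt (lintegral_mono_ae ?_)
      ((lintegral_add_left hm1 _).trans_lt (ENNReal.add_lt_top.2 ⟨hP, hN⟩))
    filter_upwards [e1, e2] with x h1 h2
    rw [h1, h2, Real.enorm_eq_ofReal_abs]
    rcases le_total 0 (f x).toReal with h | h
    · rw [abs_of_nonneg h]; exact le_self_add
    · rw [abs_of_nonpos h]; exact le_add_self
  refine ⟨h1.mono fun x hx => hx.1, hInt, ?_⟩
  rw [integral_eq_lintegral_pos_part_sub_lintegral_neg_part hInt, eintegral,
    lintegral_congr_ae e1, lintegral_congr_ae e2, EReal.coe_sub, EReal.coe_ennreal_toReal,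
    EReal.coe_ennreal_toReal]
  · rw [← lintegral_congr_ae e2]; exact hN.ne
  · rw [← lintegral_congr_ae e1]; exact hP.ne

/-- The normalized arc length on `(0, 2π]`. -/
def arcMeasure : Measure ℝ :=
  (ENNReal.ofReal (2 * Real.pi))⁻¹ • volume.restrict (Ioc 0 (2 * Real.pi))

instance isProbabilityMeasure_arcMeasure : IsProbabilityMeasure arcMeasure := ⟨by
  rw [arcMeasure, Measure.smul_apply, Measure.restrict_apply_univ, Real.volume_Ioc, sub_zero,
    smul_eq_mul, ENNReal.inv_mul_cancel (by simp [Real.pi_pos]) ENNReal.ofReal_ne_top]⟩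

lemma lintegral_Ioc_eq_arcMeasure (f : ℝ → ℝ≥0∞) :
    ∫⁻ θ in Ioc 0 (2 * Real.pi), f θ = ENNReal.ofReal (2 * Real.pi) * ∫⁻ θ, f θ ∂arcMeasure := by
  rw [arcMeasure, lintegral_smul_measure, smul_eq_mul, ← mul_assoc,
    ENNReal.mul_inv_cancel (by simp [Real.pi_pos]) ENNReal.ofReal_ne_top, one_mul]

lemma circleAverage_eq_integral_arcMeasure (f : ℂ → ℝ) (z : ℂ) (r : ℝ) :
    Real.circleAverage f z r = ∫ θ, f (circleMap z r θ) ∂arcMeasure := by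
  rw [arcMeasure, integral_smul_measure, Real.circleAverage_def,
    intervalIntegral.integral_of_le Real.two_pi_pos.le, ENNReal.toReal_inv,
    ENNReal.toReal_ofReal Real.two_pi_pos.le]

variable {u : ℂ → EReal}

lemma IsSubharmonic.measurable (hu : IsSubharmonic u) : Measurable u :=
  hu.upperSemicontinuous.measurable

lemma IsSubharmonic.exists_le (hu : IsSubharmonic u) (R : ℝ) :
    ∃ B : ℝ, 0 ≤ B ∧ ∀ z ∈ closedBall (0 : ℂ) R, u z ≤ B := by
  rcases (closedBall (0 : ℂ) R).eq_empty_or_nonempty with he | hne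
  · exact ⟨0, le_rfl, by simp [he]⟩
  obtain ⟨w, -, hw⟩ := UpperSemicontinuousOn.exists_isMaxOn hne (isCompact_closedBall (0 : ℂ) R)
    (hu.upperSemicontinuous.upperSemicontinuousOn _)
  refine ⟨max (u w).toReal 0, le_max_right _ _, fun z hz => (hw hz).trans ?_⟩
  refine (EReal.le_coe_toReal (hu.lt_top w).ne).trans ?_
  exact_mod_cast le_max_left _ _

/-- The sub-mean value inequality reads `u(z) ≤ P - N` with `P ≤ B`; finiteness of `u(z)` therefore
bounds the negative part `N`. -/
lemma IsSubharmonic.lintegral_neg_arc_le (hu : IsSubharmonic u) {z : ℂ} (hz : u z ≠ ⊥) {r B : ℝ}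
    (hr : 0 < r) (hle : ∀ θ, u (circleMap z r θ) ≤ B) (hB : 0 ≤ B) :
    ∫⁻ θ, (u (circleMap z r θ)).toENNReal ∂arcMeasure ≤ ENNReal.ofReal B ∧
    ∫⁻ θ, (-u (circleMap z r θ)).toENNReal ∂arcMeasure ≤ ENNReal.ofReal (B - (u z).toReal) := by
  have hP : ∫⁻ θ, (u (circleMap z r θ)).toENNReal ∂arcMeasure ≤ ENNReal.ofReal B := by
    refine (lintegral_mono fun θ => EReal.toENNReal_le_toENNReal (hle θ)).trans ?_
    simp
  refine ⟨hP, ?_⟩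
  have hm := hu.le_circleMean z r hr
  change u z ≤ ((∫⁻ θ, (u (circleMap z r θ)).toENNReal ∂arcMeasure : ℝ≥0∞) : EReal) -
    ((∫⁻ θ, (-u (circleMap z r θ)).toENNReal ∂arcMeasure : ℝ≥0∞) : EReal) at hm
  set N := ∫⁻ θ, (-u (circleMap z r θ)).toENNReal ∂arcMeasure with hN
  have hP' : ((∫⁻ θ, (u (circleMap z r θ)).toENNReal ∂arcMeasure : ℝ≥0∞) : EReal) ≤ (B : EReal) := by
    refine (EReal.coe_ennreal_le_coe_ennreal_iff.2 hP).trans ?_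
    rw [EReal.coe_ennreal_ofReal, max_eq_left hB]
  have hm' : u z ≤ (B : EReal) - (N : EReal) := hm.trans (EReal.sub_le_sub hP' le_rfl)
  -- With `N = ∞` the difference would be `-∞` and force `u(z) = -∞`.
  have hNtop : N ≠ ⊤ := by
    intro h
    rw [h] at hm'
    simp at hm'
    exact hz hm'
  rw [← EReal.coe_toReal (hu.lt_top z).ne hz, ← EReal.coe_ennreal_toReal hNtop, ← EReal.coe_sub,
    EReal.coe_le_coe_iff] at hm'
  rw [← ENNReal.ofReal_toReal hNtop]
  exact ENNReal.ofReal_le_ofReal (by linarith)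

lemma IsSubharmonic.exists_circle_le (hu : IsSubharmonic u) (z : ℂ) (R : ℝ) :
    ∃ B : ℝ, 0 ≤ B ∧ ∀ r, 0 ≤ r → r ≤ R → ∀ θ, u (circleMap z r θ) ≤ B := by
  obtain ⟨B, hB, h⟩ := hu.exists_le (‖z‖ + R)
  refine ⟨B, hB, fun r hr hrR θ => h _ ?_⟩
  rw [mem_closedBall_zero_iff]
  refine (norm_add_le _ _).trans ?_
  simpa [abs_of_nonneg hr] using hrR

lemma IsSubharmonic.le_circleAverage (hu : IsSubharmonic u) {z : ℂ} (hz : u z ≠ ⊥) {r : ℝ}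
    (hr : 0 < r) : (u z).toReal ≤ Real.circleAverage (fun z => (u z).toReal) z r := by
  obtain ⟨B, hB, hle⟩ := hu.exists_circle_le z r
  obtain ⟨hP, hN⟩ := hu.lintegral_neg_arc_le hz hr (hle r hr.le le_rfl) hB
  obtain ⟨-, -, h⟩ := integrable_toReal_and_eintegral_eq (ν := arcMeasure)
    (f := fun θ => u (circleMap z r θ)) (hu.measurable.comp (measurable_circleMap z r))
    (hP.trans_lt ENNReal.ofReal_lt_top) (hN.trans_lt ENNReal.ofReal_lt_top)
  have hm := hu.le_circleMean z r hr
  change u z ≤ eintegral arcMeasure _ at hm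
  rw [h, ← EReal.coe_toReal (hu.lt_top z).ne hz, EReal.coe_le_coe_iff] at hm
  rwa [circleAverage_eq_integral_arcMeasure]

lemma IsSubharmonic.lintegral_ball_lt_top (hu : IsSubharmonic u) {z₀ : ℂ} (hz : u z₀ ≠ ⊥) (R : ℝ) :
    ∫⁻ z in ball z₀ R, (u z).toENNReal < ⊤ ∧ ∫⁻ z in ball z₀ R, (-u z).toENNReal < ⊤ := by
  obtain ⟨B, hB, hle⟩ := hu.exists_circle_le z₀ R
  -- A uniform bound on the circles about `z₀` integrates in polar coordinates to a bound on the
  -- disc; `F` is either the positive or the negative part.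
  have key : ∀ (F : EReal → ℝ≥0∞) (K : ℝ), Measurable F → (∀ r, 0 < r → r ≤ R →
      ∫⁻ θ, F (u (circleMap z₀ r θ)) ∂arcMeasure ≤ ENNReal.ofReal K) →
      ∫⁻ z in ball z₀ R, F (u z) < ⊤ := by
    intro F K hF hK
    have hFu : Measurable fun z => F (u z) := hF.comp hu.measurable
    have e1 : ∫⁻ z in ball z₀ R, F (u z) =
        ∫⁻ z, (ball (0 : ℂ) R).indicator (fun z => F (u (z₀ + z))) z := by
      rw [← lintegral_indicator measurableSet_ball,
        ← lintegral_add_left_eq_self (μ := volume) _ z₀]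
      refine lintegral_congr fun z => ?_
      by_cases h : z ∈ ball (0 : ℂ) R
      · rw [indicator_of_mem h, indicator_of_mem (by simpa using h)]
      · rw [indicator_of_notMem h, indicator_of_notMem (by simpa using h)]
    have hm : Measurable fun z => (ball (0 : ℂ) R).indicator (fun z => F (u (z₀ + z))) z :=
      (hFu.comp (measurable_const_add z₀)).indicator measurableSet_ball
    have hmc : Measurable fun p : ℝ × ℝ => (ball (0 : ℂ) R).indicator (fun z => F (u (z₀ + z)))
        (circleMap 0 p.1 p.2) := hm.comp measurePreserving_circleMap.measurable
    rw [e1, ← measurePreserving_circleMap.lintegral_comp hm, polarMeasure,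
      lintegral_prod _ hmc.aemeasurable,
      lintegral_withDensity_eq_lintegral_mul _ (by fun_prop) hmc.lintegral_prod_right']
    calc ∫⁻ r in Ioi (0 : ℝ), ((fun r => ENNReal.ofReal r) * fun r =>
          ∫⁻ θ in Ioc 0 (2 * Real.pi), (ball (0 : ℂ) R).indicator (fun z => F (u (z₀ + z)))
            (circleMap 0 r θ)) r
        ≤ ∫⁻ r in Ioi (0 : ℝ), (Ioc 0 R).indicator (fun _ => ENNReal.ofReal R *
            (ENNReal.ofReal (2 * Real.pi) * ENNReal.ofReal K)) r := by
          refine setLIntegral_mono' measurableSet_Ioi fun r hr => ?_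
          have hr0 : (0 : ℝ) < r := hr
          by_cases hrR : r ≤ R
          · rw [indicator_of_mem (show r ∈ Ioc 0 R from ⟨hr0, hrR⟩)]
            simp only [Pi.mul_apply]
            gcongr
            rw [lintegral_Ioc_eq_arcMeasure]
            gcongr
            refine le_trans (lintegral_mono fun θ => ?_) (hK r hr0 hrR)
            refine (indicator_le_self _ _ _).trans (le_of_eq ?_)
            simp [circleMap]
          · have : ∀ θ, circleMap 0 r θ ∉ ball (0 : ℂ) R := fun θ => by
              simp [abs_of_pos hr0, not_le.1 hrR |>.le]
            simp [indicator_of_notMem (this _)]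
      _ ≤ ∫⁻ r, (Ioc 0 R).indicator (fun _ => ENNReal.ofReal R *
            (ENNReal.ofReal (2 * Real.pi) * ENNReal.ofReal K)) r := setLIntegral_le_lintegral _ _
      _ < ⊤ := by
          rw [lintegral_indicator measurableSet_Ioc, setLIntegral_const]
          exact ENNReal.mul_lt_top (ENNReal.mul_lt_top ENNReal.ofReal_lt_top
            (ENNReal.mul_lt_top ENNReal.ofReal_lt_top ENNReal.ofReal_lt_top)) (by simp)
  exact ⟨key _ B measurable_ereal_toENNReal fun r hr hrR =>
      (hu.lintegral_neg_arc_le hz hr (hle r hr.le hrR) hB).1,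
    key (fun x => (-x).toENNReal) _ (measurable_ereal_toENNReal.comp measurable_neg)
      fun r hr hrR => (hu.lintegral_neg_arc_le hz hr (hle r hr.le hrR) hB).2⟩

lemma IsSubharmonic.locallyIntegrable (hu : IsSubharmonic u) (hne : ∃ z, u z ≠ ⊥) :
    (∀ᵐ z, u z ≠ ⊥) ∧ LocallyIntegrable fun z => (u z).toReal := by
  obtain ⟨z₀, hz₀⟩ := hne
  have h := fun R : ℝ => integrable_toReal_and_eintegral_eq (ν := volume.restrict (ball z₀ R))
    hu.measurable (hu.lintegral_ball_lt_top hz₀ R).1 (hu.lintegral_ball_lt_top hz₀ R).2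
  constructor
  · rw [← Measure.restrict_univ (μ := volume), ← iUnion_ball_nat z₀, ae_restrict_iUnion_iff]
    exact fun n => (h n).1
  · intro z
    refine ⟨ball z₀ (dist z z₀ + 1), isOpen_ball.mem_nhds (by simp), (h _).2.1⟩

variable {a : ℝ → ℝ}

lemma IsSubharmonic.le_mollify (hu : IsSubharmonic u) (ha : ContDiff ℝ ∞ a)
    (h1 : ∀ x, 1 ≤ x → a x = 0) (hpos : ∀ x, 0 ≤ a x) (hone : ∫ z, radialFunction a z = 1)
    {z : ℂ} (hz : u z ≠ ⊥) : (u z).toReal ≤ mollify a (fun z => (u z).toReal) z :=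
  le_integral_mul_radialFunction ha h1 hpos hone
    (integrable_mul_radialFunction ha h1 (hu.locallyIntegrable ⟨z, hz⟩).2 z)
    fun _ hr => hu.le_circleAverage hz hr

lemma mollify_eq_integral_add (h : ℂ → ℝ) (z : ℂ) :
    mollify a h z = ∫ ζ, h (z + ζ) * radialFunction a ζ := by
  rw [mollify, ← integral_add_left_eq_self (μ := volume) _ z]
  simp

/-- Mollification averages translates of `u`, each of which satisfies the sub-mean value inequality
wherever it is finite at the centre, hence almost everywhere. Fubini exchanges the two averages. -/
lemma IsSubharmonic.mollify_zero_le_circleAverage (hu : IsSubharmonic u) (hne : ∃ z, u z ≠ ⊥)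
    (ha : ContDiff ℝ ∞ a) (h1 : ∀ x, 1 ≤ x → a x = 0) (hpos : ∀ x, 0 ≤ a x) {R : ℝ} (hR : 0 < R) :
    mollify a (fun z => (u z).toReal) 0 ≤
      Real.circleAverage (mollify a fun z => (u z).toReal) 0 R := by
  obtain ⟨hae, hloc⟩ := hu.locallyIntegrable hne
  set v : ℂ → ℝ := fun z => (u z).toReal with hv
  have hvm : Measurable v := measurable_ereal_toReal.comp hu.measurable
  have hφm : Measurable (radialFunction a) := (contDiff_radialFunction ha).continuous.measurable
  have hi : ∀ {h : ℂ → ℝ}, LocallyIntegrable h → ∀ z, Integrable fun ζ =>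
      h (z + ζ) * radialFunction a ζ := fun hh z => by
    simpa using (integrable_mul_radialFunction ha h1 hh z).comp_add_left z
  have hprod : Integrable (Function.uncurry fun (θ : ℝ) (ζ : ℂ) =>
      v (circleMap 0 R θ + ζ) * radialFunction a ζ) (arcMeasure.prod volume) := by
    have hmeas : Measurable (Function.uncurry fun (θ : ℝ) (ζ : ℂ) =>
        v (circleMap 0 R θ + ζ) * radialFunction a ζ) := by
      have hc := measurable_circleMap 0 R
      unfold Function.uncurry
      fun_prop
    rw [integrable_prod_iff hmeas.aestronglyMeasurable]
    refine ⟨ae_of_all _ fun θ => hi hloc (circleMap 0 R θ), ?_⟩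
    have e : ∀ θ, ∫ ζ, ‖v (circleMap 0 R θ + ζ) * radialFunction a ζ‖ =
        mollify a (fun z => |v z|) (circleMap 0 R θ) := fun θ => by
      rw [mollify_eq_integral_add]
      refine integral_congr_ae (ae_of_all _ fun ζ => ?_)
      simp only [norm_mul, Real.norm_eq_abs, abs_of_nonneg (show 0 ≤ radialFunction a ζ from hpos _)]
    simp only [Function.uncurry_apply_pair, e]
    -- The Fubini hypothesis holds because the mollification of `|v|` is continuous, hence
    -- integrable along the circle.
    have hcont : Continuous fun θ => mollify a (fun z => |v z|) (circleMap 0 R θ) :=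
      (contDiff_mollify ha h1 fun z => (hloc z).norm).continuous.comp (continuous_circleMap 0 R)
    refine Integrable.smul_measure ?_ (by simp [Real.pi_pos])
    exact (hcont.integrableOn_Icc (a := 0) (b := 2 * Real.pi)).mono_set Ioc_subset_Icc_self
  calc mollify a v 0 = ∫ ζ, v ζ * radialFunction a ζ := by simp [mollify]
    _ ≤ ∫ ζ, ∫ θ, v (circleMap 0 R θ + ζ) * radialFunction a ζ ∂arcMeasure := by
        refine integral_mono_ae (by simpa using hi hloc 0) hprod.swap.integral_prod_left ?_
        filter_upwards [hae] with ζ hζ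
        rw [integral_mul_const]
        refine mul_le_mul_of_nonneg_right ?_ (hpos _)
        refine (hu.le_circleAverage hζ hR).trans (le_of_eq ?_)
        rw [circleAverage_eq_integral_arcMeasure]
        simp [circleMap, hv, add_comm]
    _ = ∫ θ, (∫ ζ, v (circleMap 0 R θ + ζ) * radialFunction a ζ) ∂arcMeasure :=
        (integral_integral_swap hprod).symm
    _ = Real.circleAverage (mollify a v) 0 R := by
        rw [circleAverage_eq_integral_arcMeasure]
        simp only [mollify_eq_integral_add]

end Subharmonic

/-! ### The potential of the Riesz measure. -/

section Potential

/-- The harmonic correction of the logarithmic kernel: `0` for `|w| ≤ 1`, and otherwise the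
difference of `K_q(z / w)` and `ln|z - w|`. -/
def kernelCorrection (q : ℕ) (z w : ℂ) : ℝ :=
  if ‖w‖ ≤ 1 then 0
  else -Real.log ‖w‖ + ∑ k ∈ Finset.Icc 1 q, ((z / w) ^ k / (k : ℂ)).re

/-- The kernel `ln|z - w|` for `|w| ≤ 1` and `K_q(z / w)` for `|w| > 1`. -/
def splitKernel (q : ℕ) (z w : ℂ) : ℝ := Real.log ‖z - w‖ + kernelCorrection q z w

/-- The potential of `μ` with respect to `splitKernel`. -/
def potential (q : ℕ) (μ : Measure ℂ) (z : ℂ) : ℝ := ∫ w, splitKernel q z w ∂μ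

lemma measurable_splitKernel (q : ℕ) : Measurable fun p : ℂ × ℂ => splitKernel q p.1 p.2 := by
  unfold splitKernel kernelCorrection
  refine Measurable.add (by fun_prop) (Measurable.ite ?_ measurable_const ?_)
  · exact measurableSet_le measurable_snd.norm measurable_const
  · refine Measurable.add (by fun_prop) (Finset.measurable_sum _ fun k _ => ?_)
    exact Complex.measurable_re.comp (by fun_prop)

lemma splitKernel_of_norm_le {q : ℕ} {z w : ℂ} (hw : ‖w‖ ≤ 1) :
    splitKernel q z w = Real.log ‖z - w‖ := by
  rw [splitKernel, kernelCorrection, if_pos hw, add_zero]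

lemma splitKernel_of_one_lt {q : ℕ} {z w : ℂ} (hw : 1 < ‖w‖) (hzw : z ≠ w) :
    splitKernel q z w = realKernel q (z / w) := by
  have hw0 : w ≠ 0 := norm_pos_iff.1 (zero_lt_one.trans hw)
  have e : ‖1 - z / w‖ = ‖z - w‖ / ‖w‖ := by
    rw [← norm_div, ← norm_neg, sub_div, div_self hw0, neg_sub]
  rw [splitKernel, kernelCorrection, if_neg hw.not_ge, realKernel, e, Real.log_div]
  · ring
  · exact norm_ne_zero_iff.2 (sub_ne_zero.2 hzw)
  · exact norm_ne_zero_iff.2 hw0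

lemma harmonicOnNhd_kernelCorrection (q : ℕ) (w : ℂ) :
    InnerProductSpace.HarmonicOnNhd (fun z => kernelCorrection q z w) univ := by
  intro z _
  unfold kernelCorrection
  split_ifs with h
  · exact InnerProductSpace.harmonicAt_const 0
  · have hF : AnalyticAt ℂ (fun z : ℂ => ((-Real.log ‖w‖ : ℝ) : ℂ) +
        ∑ k ∈ Finset.Icc 1 q, (z / w) ^ k / (k : ℂ)) z := by
      have hd : Differentiable ℂ (fun z : ℂ => ((-Real.log ‖w‖ : ℝ) : ℂ) +
        ∑ k ∈ Finset.Icc 1 q, (z / w) ^ k / (k : ℂ)) := by fun_prop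
      exact hd.analyticAt z
    have := hF.harmonicAt_re
    simpa only [Complex.add_re, Complex.ofReal_re, Complex.re_sum] using this

/-- Jensen's formula gives the mean of `ln|z - w|`; the correction is harmonic and keeps its value
at the centre. -/
lemma circleAverage_splitKernel (q : ℕ) (z₀ w : ℂ) {r : ℝ} (hr : 0 < r) :
    Real.circleAverage (fun z => splitKernel q z w) z₀ r =
      Real.log (max ‖w - z₀‖ r) + kernelCorrection q z₀ w := by
  have hh := harmonicOnNhd_kernelCorrection q w
  have hc : Continuous fun z => kernelCorrection q z w :=
    continuousOn_univ.1 hh.continuousOn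
  have hl : CircleIntegrable (fun z => Real.log ‖z - w‖) z₀ r :=
    MeromorphicOn.circleIntegrable_log_norm (f := fun z => z - w) fun z _ =>
      (analyticAt_id.sub analyticAt_const).meromorphicAt
  unfold splitKernel
  rw [Real.circleAverage_fun_add hl hc.continuousOn.circleIntegrable',
    (hh.mono (subset_univ _)).circleAverage_eq,
    circleAverage_log_norm_sub_const_eq_log_radius_add_posLog hr.ne']
  congr 1
  rw [norm_sub_rev]
  rcases le_total ‖w - z₀‖ r with h | h
  · rw [max_eq_right h, Real.posLog_eq_zero_iff _ |>.2, add_zero]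
    rw [abs_of_nonneg (by positivity), inv_mul_le_iff₀ hr]
    simpa using h
  · rw [max_eq_left h, Real.posLog_eq_log, Real.log_mul (by positivity), Real.log_inv]
    · ring
    · exact (hr.trans_le h).ne'
    · rw [abs_of_nonneg (by positivity), le_inv_mul_iff₀ hr]
      simpa using h

lemma lintegral_enorm_log_norm_ball_lt_top (R : ℝ) :
    ∫⁻ z in ball (0 : ℂ) R, ‖Real.log ‖z‖‖ₑ < ⊤ := by
  have hm : Measurable fun z => (ball (0 : ℂ) R).indicator (fun z => ‖Real.log ‖z‖‖ₑ) z :=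
    Measurable.indicator (by fun_prop) measurableSet_ball
  have hmc : Measurable fun p : ℝ × ℝ => (ball (0 : ℂ) R).indicator (fun z => ‖Real.log ‖z‖‖ₑ)
      (circleMap 0 p.1 p.2) := hm.comp measurePreserving_circleMap.measurable
  rw [← lintegral_indicator measurableSet_ball, ← measurePreserving_circleMap.lintegral_comp hm,
    polarMeasure, lintegral_prod _ hmc.aemeasurable,
    lintegral_withDensity_eq_lintegral_mul _ (by fun_prop) hmc.lintegral_prod_right']
  have hInt : IntegrableOn (fun r => r * Real.log r) (Ioc 0 R) :=
    (Real.continuous_mul_log.integrableOn_Icc (a := 0) (b := R)).mono_set Ioc_subset_Icc_self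
  calc _ ≤ ∫⁻ r in Ioi (0 : ℝ), (Ioc 0 R).indicator (fun r => ENNReal.ofReal (2 * Real.pi) *
        ‖r * Real.log r‖ₑ) r := by
        refine setLIntegral_mono' measurableSet_Ioi fun r hr => ?_
        have hr0 : (0 : ℝ) < r := hr
        by_cases hrR : r ≤ R
        · rw [indicator_of_mem (show r ∈ Ioc 0 R from ⟨hr0, hrR⟩)]
          simp only [Pi.mul_apply]
          rw [lintegral_Ioc_eq_arcMeasure, mul_left_comm, enorm_mul,
            Real.enorm_of_nonneg hr0.le]
          gcongr
          refine (lintegral_mono fun θ => indicator_le_self _ _ _).trans (le_of_eq ?_)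
          simp [circleMap, abs_of_pos hr0]
        · have : ∀ θ, circleMap 0 r θ ∉ ball (0 : ℂ) R := fun θ => by
            simp [abs_of_pos hr0, not_le.1 hrR |>.le]
          simp [indicator_of_notMem (this _)]
    _ ≤ ∫⁻ r, (Ioc 0 R).indicator (fun r => ENNReal.ofReal (2 * Real.pi) *
        ‖r * Real.log r‖ₑ) r := setLIntegral_le_lintegral _ _
    _ = ENNReal.ofReal (2 * Real.pi) * ∫⁻ r in Ioc 0 R, ‖r * Real.log r‖ₑ := by
        rw [lintegral_indicator measurableSet_Ioc, lintegral_const_mul _ (by fun_prop)]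
    _ < ⊤ := ENNReal.mul_lt_top ENNReal.ofReal_lt_top hInt.2

lemma abs_kernelCorrection_le (q : ℕ) {z w : ℂ} {R : ℝ} (hR : 1 ≤ R) (hz : ‖z‖ ≤ R)
    (hw : ‖w‖ ≤ 2 * R) :
    |kernelCorrection q z w| ≤ Real.log (2 * R) + ∑ k ∈ Finset.Icc 1 q, R ^ k := by
  have h0 : 0 ≤ Real.log (2 * R) := Real.log_nonneg (by linarith)
  unfold kernelCorrection
  split_ifs with h
  · rw [abs_zero]
    positivity
  · rw [not_le] at h
    refine (abs_add_le _ _).trans (add_le_add ?_ ((Finset.abs_sum_le_sum_abs _ _).trans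
      (Finset.sum_le_sum fun k hk => (Complex.abs_re_le_norm _).trans ?_)))
    · rw [abs_neg, abs_of_nonneg (Real.log_nonneg h.le)]
      exact Real.log_le_log (by linarith) hw
    · have hk1 : (1 : ℝ) ≤ k := by exact_mod_cast (Finset.mem_Icc.1 hk).1
      rw [norm_div, norm_pow, norm_div, Complex.norm_natCast]
      refine (div_le_self (by positivity) hk1).trans (pow_le_pow_left₀ (by positivity) ?_ k)
      exact (div_le_self (norm_nonneg z) h.le).trans hz

/-- For `|w| ≤ 2R` the logarithm is locally integrable and the correction bounded. For `|w| > 2R`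
one has `|z/w| ≤ 1/2`, and the kernel decays like `|w|^(-q-1)`, which `μ` integrates. -/
lemma exists_lintegral_enorm_splitKernel_le (q : ℕ) {R : ℝ} (hR : 1 ≤ R) :
    ∃ C₁ C₂ : ℝ≥0∞, C₁ < ⊤ ∧ C₂ < ⊤ ∧ ∀ w : ℂ,
      ∫⁻ z in ball (0 : ℂ) R, ‖splitKernel q z w‖ₑ ≤
        (closedBall (0 : ℂ) (2 * R)).indicator (fun _ => C₁) w +
        (closedBall (0 : ℂ) 1)ᶜ.indicator
          (fun w => C₂ * ENNReal.ofReal (‖w‖ ^ (-((q + 1 : ℕ) : ℝ)))) w := by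
  set V : ℝ≥0∞ := volume (ball (0 : ℂ) R) with hV
  have hVt : V < ⊤ := measure_ball_lt_top
  set c : ℝ := Real.log (2 * R) + ∑ k ∈ Finset.Icc 1 q, R ^ k with hc
  refine ⟨(∫⁻ z in ball (0 : ℂ) (3 * R), ‖Real.log ‖z‖‖ₑ) + ENNReal.ofReal c * V,
    ENNReal.ofReal (2 * R ^ (q + 1)) * V,
    ENNReal.add_lt_top.2 ⟨lintegral_enorm_log_norm_ball_lt_top _,
      ENNReal.mul_lt_top ENNReal.ofReal_lt_top hVt⟩,
    ENNReal.mul_lt_top ENNReal.ofReal_lt_top hVt, fun w => ?_⟩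
  rcases le_or_gt ‖w‖ (2 * R) with hw | hw
  · refine le_trans ?_ le_self_add
    rw [indicator_of_mem (by simpa using hw)]
    calc ∫⁻ z in ball (0 : ℂ) R, ‖splitKernel q z w‖ₑ
        ≤ ∫⁻ z in ball (0 : ℂ) R, (‖Real.log ‖z - w‖‖ₑ + ENNReal.ofReal c) := by
          refine setLIntegral_mono' measurableSet_ball fun z hz => ?_
          refine (enorm_add_le _ _).trans ?_
          gcongr
          rw [Real.enorm_eq_ofReal_abs]
          exact ENNReal.ofReal_le_ofReal
            (abs_kernelCorrection_le q hR (mem_ball_zero_iff.1 hz).le hw)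
      _ = (∫⁻ z in ball (0 : ℂ) R, ‖Real.log ‖z - w‖‖ₑ) + ENNReal.ofReal c * V := by
          rw [lintegral_add_right _ measurable_const, setLIntegral_const]
      _ ≤ _ := by
          refine add_le_add ?_ le_rfl
          rw [← lintegral_indicator measurableSet_ball, ← lintegral_indicator measurableSet_ball,
            ← lintegral_add_right_eq_self (μ := volume) _ w]
          refine lintegral_mono fun z => ?_
          by_cases h : z + w ∈ ball (0 : ℂ) R
          · have : z ∈ ball (0 : ℂ) (3 * R) := by
              rw [mem_ball_zero_iff] at h ⊢
              have := norm_sub_le (z + w) w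
              rw [add_sub_cancel_right] at this
              linarith
            rw [indicator_of_mem h, indicator_of_mem this, add_sub_cancel_right]
          · rw [indicator_of_notMem h]
            exact bot_le
  · refine le_trans ?_ le_add_self
    have hw1 : 1 < ‖w‖ := by linarith
    have hw0 : 0 < ‖w‖ := by linarith
    rw [indicator_of_mem (by simpa using hw1)]
    calc ∫⁻ z in ball (0 : ℂ) R, ‖splitKernel q z w‖ₑ
        ≤ ∫⁻ z in ball (0 : ℂ) R,
            ENNReal.ofReal (2 * R ^ (q + 1) * ‖w‖ ^ (-((q + 1 : ℕ) : ℝ))) := by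
          refine setLIntegral_mono' measurableSet_ball fun z hz => ?_
          have hz' : ‖z‖ < R := mem_ball_zero_iff.1 hz
          have hne : z ≠ w := by
            rintro rfl
            linarith
          have hzw : ‖z / w‖ ≤ R / ‖w‖ := by rw [norm_div]; gcongr
          rw [splitKernel_of_one_lt hw1 hne, Real.enorm_eq_ofReal_abs]
          refine ENNReal.ofReal_le_ofReal ((abs_realKernel_le (hzw.trans ?_)).trans ?_)
          · rw [div_le_iff₀ hw0]; linarith
          · rw [Real.rpow_neg hw0.le, Real.rpow_natCast]
            calc 2 * ‖z / w‖ ^ (q + 1) ≤ 2 * (R / ‖w‖) ^ (q + 1) := by gcongr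
              _ = _ := by rw [div_pow]; ring
      _ = _ := by
          rw [setLIntegral_const, ENNReal.ofReal_mul (by positivity)]
          ring

/-- The part of `μ` outside the closed unit disc. -/
def exteriorPart (μ : Measure ℂ) : Measure ℂ := μ.restrict (closedBall 0 1)ᶜ

lemma radialCount_exteriorPart_le (μ : Measure ℂ) (t : ℝ) :
    radialCount (exteriorPart μ) t ≤ radialCount μ t :=
  Measure.restrict_apply_le _ _

/-- This supplies the hypothesis `ε = 1` of the moment bounds, although `0` may lie in the support
of `μ` itself. -/
lemma radialCount_exteriorPart_one (μ : Measure ℂ) : radialCount (exteriorPart μ) 1 = 0 := by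
  rw [radialCount, exteriorPart, Measure.restrict_apply measurableSet_closedBall]
  simp

lemma measureType_exteriorPart_le (ρ : ℝ) (μ : Measure ℂ) :
    measureType ρ (exteriorPart μ) ≤ measureType ρ μ := by
  refine limsup_le_limsup (Eventually.of_forall fun r => ?_)
  simp only [EReal.toENNReal_coe]
  exact ENNReal.div_le_div_right (radialCount_exteriorPart_le μ r) _

variable {ρ : ℝ} {μ : Measure ℂ}

lemma integrable_splitKernel_prod [IsLocallyFiniteMeasure μ] (hρ : 0 ≤ ρ)
    (h : measureType ρ μ < ⊤) {R : ℝ} (hR : 1 ≤ R) :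
    Integrable (fun p : ℂ × ℂ => splitKernel ⌊ρ⌋₊ p.1 p.2)
      ((volume.restrict (ball 0 R)).prod μ) := by
  set q := ⌊ρ⌋₊
  obtain ⟨C₁, C₂, hC₁, hC₂, hle⟩ := exists_lintegral_enorm_splitKernel_le q hR
  refine ⟨(measurable_splitKernel q).aestronglyMeasurable, ?_⟩
  rw [HasFiniteIntegral, lintegral_prod_symm _ (measurable_splitKernel q).enorm.aemeasurable]
  refine (lintegral_mono fun w => hle w).trans_lt ?_
  rw [lintegral_add_left (measurable_const.indicator measurableSet_closedBall),
    lintegral_indicator_const measurableSet_closedBall,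
    lintegral_indicator measurableSet_closedBall.compl, lintegral_const_mul _ (by fun_prop)]
  refine ENNReal.add_lt_top.2 ⟨ENNReal.mul_lt_top hC₁ (radialCount_lt_top h _),
    ENNReal.mul_lt_top hC₂ ?_⟩
  exact lintegral_norm_rpow_neg_lt_top hρ (by exact_mod_cast Nat.lt_floor_add_one ρ) zero_lt_one
    (radialCount_exteriorPart_one μ) ((measureType_exteriorPart_le ρ μ).trans_lt h)

lemma locallyIntegrable_potential [IsLocallyFiniteMeasure μ] (hρ : 0 ≤ ρ)
    (h : measureType ρ μ < ⊤) : LocallyIntegrable (potential ⌊ρ⌋₊ μ) := fun z =>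
  ⟨ball 0 (‖z‖ + 1), isOpen_ball.mem_nhds (by simp),
    (integrable_splitKernel_prod hρ h (by linarith [norm_nonneg z])).integral_prod_left⟩

lemma integrable_splitKernel_mul [IsLocallyFiniteMeasure μ] (hρ : 0 ≤ ρ)
    (h : measureType ρ μ < ⊤) {ψ : ℂ → ℝ} (hψ : Continuous ψ) (hc : HasCompactSupport ψ) :
    Integrable (fun p : ℂ × ℂ => splitKernel ⌊ρ⌋₊ p.1 p.2 * ψ p.1) (volume.prod μ) := by
  obtain ⟨R, hR⟩ := hc.isCompact.isBounded.subset_ball (0 : ℂ)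
  obtain ⟨C, hC⟩ := hψ.bounded_above_of_compact_support hc
  have h1 := integrable_splitKernel_prod hρ h (le_max_right R 1)
  have h2 : Integrable (fun p : ℂ × ℂ => splitKernel ⌊ρ⌋₊ p.1 p.2 * ψ p.1)
      ((volume.restrict (ball 0 (max R 1))).prod μ) :=
    h1.mul_bdd (c := C) (by fun_prop) (ae_of_all _ fun p => hC p.1)
  have e : (volume.restrict (ball (0 : ℂ) (max R 1))).prod μ =
      (volume.prod μ).restrict (ball 0 (max R 1) ×ˢ univ) := by
    rw [← Measure.prod_restrict, Measure.restrict_univ]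
  rw [e] at h2
  refine IntegrableOn.integrable_of_forall_notMem_eq_zero h2 fun p hp => ?_
  have : p.1 ∉ tsupport ψ := fun hp' => hp ⟨ball_subset_ball (le_max_left R 1) (hR hp'), mem_univ _⟩
  rw [image_eq_zero_of_notMem_tsupport this, mul_zero]

lemma integral_potential_mul [IsLocallyFiniteMeasure μ] (hρ : 0 ≤ ρ)
    (h : measureType ρ μ < ⊤) {ψ : ℂ → ℝ} (hψ : Continuous ψ) (hc : HasCompactSupport ψ) :
    ∫ z, potential ⌊ρ⌋₊ μ z * ψ z = ∫ w, (∫ z, splitKernel ⌊ρ⌋₊ z w * ψ z) ∂μ := by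
  simp only [potential, ← integral_mul_const]
  exact integral_integral_swap (f := fun z w => splitKernel ⌊ρ⌋₊ z w * ψ z)
    (integrable_splitKernel_mul hρ h hψ hc)

variable {a : ℝ → ℝ}

/-- The potential has distributional Laplacian `2πμ`, tested on translated radial bumps. After
Fubini each kernel has logarithmic circle means, and the radial Green formula evaluates the inner
integral. -/
lemma integral_potential_mul_radialLaplacian [IsLocallyFiniteMeasure μ] (hρ : 0 ≤ ρ)
    (h : measureType ρ μ < ⊤) (ha : ContDiff ℝ ∞ a) (h1 : ∀ x, 1 ≤ x → a x = 0) (z : ℂ) :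
    ∫ ζ, potential ⌊ρ⌋₊ μ ζ * radialLaplacian a ‖ζ - z‖ =
      2 * Real.pi * ∫ w, radialFunction a (w - z) ∂μ := by
  have hL := continuous_radialLaplacian ha
  have hψ : Continuous fun ζ : ℂ => radialLaplacian a ‖ζ - z‖ := by fun_prop
  have hc : HasCompactSupport fun ζ : ℂ => radialLaplacian a ‖ζ - z‖ :=
    HasCompactSupport.intro (isCompact_closedBall z 1) fun ζ hζ =>
      radialLaplacian_eq_zero h1 (by simpa [dist_eq_norm] using hζ)
  rw [integral_potential_mul hρ h hψ hc, ← integral_const_mul]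
  refine integral_congr_ae ?_
  filter_upwards [(integrable_splitKernel_mul hρ h hψ hc).prod_left_ae] with w hw
  exact integral_mul_radialLaplacian ha h1 (norm_nonneg (w - z)) hw
    fun r hr => circleAverage_splitKernel _ z w hr

lemma continuous_mollifier_sub (ha : ContDiff ℝ ∞ a) (z : ℂ) :
    Continuous fun ζ => radialFunction a (ζ - z) :=
  (contDiff_radialFunction ha).continuous.comp (by fun_prop)

lemma hasCompactSupport_mollifier_sub (h1 : ∀ x, 1 ≤ x → a x = 0) (z : ℂ) :
    HasCompactSupport fun ζ => radialFunction a (ζ - z) :=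
  (hasCompactSupport_radialFunction h1).comp_homeomorph (Homeomorph.subRight z)

lemma splitKernel_le {q : ℕ} {z w : ℂ} {r : ℝ} (hz : ‖z‖ ≤ r) (hzw : z ≠ w) :
    splitKernel q z w ≤ (closedBall (0 : ℂ) 1).indicator (fun _ => Real.log (r + 1)) w +
      (closedBall (0 : ℂ) 1)ᶜ.indicator (fun w => kernelMax q (r / ‖w‖)) w := by
  rcases le_or_gt ‖w‖ 1 with hw | hw
  · rw [indicator_of_mem (by simpa using hw), indicator_of_notMem (by simpa using hw), add_zero,
      splitKernel_of_norm_le hw]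
    refine Real.log_le_log (norm_pos_iff.2 (sub_ne_zero.2 hzw)) ?_
    exact (norm_sub_le z w).trans (add_le_add hz hw)
  · have hw0 : w ≠ 0 := norm_pos_iff.1 (zero_lt_one.trans hw)
    rw [indicator_of_notMem (by simpa using hw), indicator_of_mem (by simpa using hw), zero_add,
      splitKernel_of_one_lt hw hzw]
    refine (realKernel_le_kernelMax fun hone => hzw ?_).trans ?_
    · rwa [div_eq_one_iff_eq hw0] at hone
    · rw [norm_div]
      exact kernelMax_mono (by positivity) (by gcongr)

/-- Fubini puts the mollifier on the kernel. The kernel bound at radius `|z| + 1` holds throughout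
the support of the bump, whose mass is one. -/
lemma mollify_potential_le [IsLocallyFiniteMeasure μ] (hρ : 0 ≤ ρ)
    (h : measureType ρ μ < ⊤) (ha : ContDiff ℝ ∞ a) (h1 : ∀ x, 1 ≤ x → a x = 0)
    (hpos : ∀ x, 0 ≤ a x) (hone : ∫ z, radialFunction a z = 1) (z : ℂ) :
    mollify a (potential ⌊ρ⌋₊ μ) z ≤
      (radialCount μ 1).toReal * Real.log (‖z‖ + 1 + 1) +
        (∫⁻ t in Ioi (0 : ℝ), radialCount (exteriorPart μ) ((‖z‖ + 1) / t) *
          ENNReal.ofReal (kernelMaxDeriv ⌊ρ⌋₊ t)).toReal := by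
  set q := ⌊ρ⌋₊
  set r := ‖z‖ + 1 with hr
  have hr0 : 0 ≤ r := by positivity
  set ν := exteriorPart μ with hν
  have hν1 := radialCount_exteriorPart_one μ
  have hνt : measureType ρ ν < ⊤ := (measureType_exteriorPart_le ρ μ).trans_lt h
  have hlt := lintegral_kernelMax_div_norm_lt_top hρ zero_lt_one hν1 hνt hr0
  have hν0 : radialCount ν 0 = 0 :=
    le_antisymm (hν1 ▸ radialCount_mono ν zero_le_one) bot_le
  have : IsLocallyFiniteMeasure ν := by unfold ν exteriorPart; infer_instance
  have hMnn : ∀ w : ℂ, 0 ≤ kernelMax q (r / ‖w‖) := fun w => kernelMax_nonneg q (by positivity)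
  have hMm : AEStronglyMeasurable (fun w : ℂ => kernelMax q (r / ‖w‖)) ν := by
    have h3 : Measurable fun x : ℝ => kernelMax q (max x 0) :=
      Monotone.measurable fun x y hxy =>
        kernelMax_mono (le_max_right _ _) (max_le_max_right 0 hxy)
    have h4 : Measurable fun w : ℂ => kernelMax q (max (r / ‖w‖) 0) :=
      h3.comp (by fun_prop : Measurable fun w : ℂ => r / ‖w‖)
    refine h4.aestronglyMeasurable.congr (ae_of_all _ fun w => ?_)
    simp only [max_eq_left (show 0 ≤ r / ‖w‖ by positivity)]
  have hMint : Integrable (fun w : ℂ => kernelMax q (r / ‖w‖)) ν := by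
    refine ⟨hMm, ?_⟩
    rw [hasFiniteIntegral_iff_ofReal (ae_of_all _ hMnn)]
    exact hlt
  have hMint' : Integrable ((closedBall (0 : ℂ) 1)ᶜ.indicator
      fun w => kernelMax q (r / ‖w‖)) μ :=
    (integrable_indicator_iff measurableSet_closedBall.compl).2 hMint
  have hLint : Integrable ((closedBall (0 : ℂ) 1).indicator
      fun _ => Real.log (r + 1)) μ :=
    (integrable_indicator_iff measurableSet_closedBall).2
      (integrableOn_const (radialCount_lt_top h 1).ne)
  have hψ := continuous_mollifier_sub ha z
  have hc := hasCompactSupport_mollifier_sub h1 z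
  have hK := integrable_splitKernel_mul hρ h hψ hc
  have hone' : ∫ ζ, radialFunction a (ζ - z) = 1 := by
    rw [integral_sub_right_eq_self (fun ζ => radialFunction a ζ) z, hone]
  have hE : (∫⁻ t in Ioi (0 : ℝ), radialCount ν (r / t) *
      ENNReal.ofReal (kernelMaxDeriv q t)).toReal = ∫ w, kernelMax q (r / ‖w‖) ∂ν := by
    rw [integral_eq_lintegral_of_nonneg_ae (ae_of_all _ hMnn) hMm,
      lintegral_kernelMax_div_norm q hν0 hr0]
  calc mollify a (potential q μ) z
      = ∫ w, (∫ ζ, splitKernel q ζ w * radialFunction a (ζ - z)) ∂μ :=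
        integral_potential_mul hρ h hψ hc
    _ ≤ ∫ w, ((closedBall (0 : ℂ) 1).indicator (fun _ => Real.log (r + 1)) w +
          (closedBall (0 : ℂ) 1)ᶜ.indicator (fun w => kernelMax q (r / ‖w‖)) w) ∂μ := by
        refine integral_mono_ae hK.integral_prod_right (hLint.add hMint') ?_
        filter_upwards [hK.prod_left_ae] with w hw
        set b := (closedBall (0 : ℂ) 1).indicator (fun _ => Real.log (r + 1)) w +
          (closedBall (0 : ℂ) 1)ᶜ.indicator (fun w => kernelMax q (r / ‖w‖)) w with hb
        calc ∫ ζ, splitKernel q ζ w * radialFunction a (ζ - z)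
            ≤ ∫ ζ, b * radialFunction a (ζ - z) := by
              refine integral_mono_ae hw
                ((hψ.integrable_of_hasCompactSupport hc).const_mul b) ?_
              -- The point `ζ = w` is discarded because there `Real.log 0 = 0` stands in for `-∞`.
              filter_upwards [measure_eq_zero_iff_ae_notMem.1 (measure_singleton (μ := volume) w)]
                with ζ hζ
              rcases le_or_gt ‖ζ‖ r with hζr | hζr
              · exact mul_le_mul_of_nonneg_right (splitKernel_le hζr hζ) (hpos _)
              · have : radialFunction a (ζ - z) = 0 := by
                  refine radialFunction_eq_zero h1 ?_
                  have := norm_sub_norm_le ζ z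
                  linarith
                simp [this]
          _ = b := by rw [integral_const_mul, hone', mul_one]
    _ = _ := by
        rw [integral_add hLint hMint', integral_indicator measurableSet_closedBall,
          integral_indicator measurableSet_closedBall.compl, setIntegral_const, hE]
        rfl

end Potential

/-! ### Growth of the majorant in terms of the two types. -/

/-- The integral `∫ μ^rad(r/t) dM_q(t)` for the part of `μ` outside the unit disc. -/
def majorant (q : ℕ) (μ : Measure ℂ) (r : ℝ) : ℝ≥0∞ :=
  ∫⁻ t in Ioi (0 : ℝ), radialCount (exteriorPart μ) (r / t) *
    ENNReal.ofReal (kernelMaxDeriv q t)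

lemma lintegral_ofReal_div_rpow_mul_kernelMaxDeriv (ρ : ℝ) {r : ℝ} (hr : 0 < r) :
    ∫⁻ t in Ioi (0 : ℝ), ENNReal.ofReal ((r / t) ^ ρ) *
      ENNReal.ofReal (kernelMaxDeriv ⌊ρ⌋₊ t) = ENNReal.ofReal (r ^ ρ) * valironConstant ρ := by
  rw [valironConstant, ← lintegral_const_mul' _ _ ENNReal.ofReal_ne_top]
  refine setLIntegral_congr_fun measurableSet_Ioi fun t ht => ?_
  have ht : 0 < t := ht
  rw [← ENNReal.ofReal_mul (by positivity), ← ENNReal.ofReal_mul (by positivity),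
    Real.div_rpow hr.le ht.le, Real.rpow_neg ht.le]
  congr 1
  ring

/-- A function bounded by `c s^ρ` near infinity and vanishing on `(0, 1]`. -/
lemma le_rpow_add_indicator {f : ℝ → ℝ≥0∞} (hf : Monotone f) {c : ℝ≥0∞} {ρ R : ℝ} (h1 : f 1 = 0)
    (hR : ∀ s, R ≤ s → f s ≤ c * ENNReal.ofReal (s ^ ρ)) {r t : ℝ} (ht : 0 < t) :
    f (r / t) ≤ c * ENNReal.ofReal ((r / t) ^ ρ) + (Ioc 0 r).indicator (fun _ => f R) t := by
  by_cases htr : t ≤ r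
  · rw [indicator_of_mem (show t ∈ Ioc 0 r from ⟨ht, htr⟩)]
    rcases le_total R (r / t) with h | h
    · exact (hR _ h).trans le_self_add
    · exact (hf h).trans le_add_self
  · have : f (r / t) ≤ f 1 := hf ((div_le_one ht).2 (le_of_not_ge htr))
    rw [h1] at this
    exact this.trans zero_le

/-- Replacing the counting function by `c s^ρ` beyond `R` yields `c S(ρ) r^ρ`. The rest costs at
most its value at `R` times `M_q(r)`, enlarged here to the argument also needed for the averaged
bound. -/
lemma exists_majorant_le_of_measureType_lt {ρ : ℝ} {μ : Measure ℂ}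
    {c : ℝ≥0∞} (h : measureType ρ μ < c) (hc : c < ⊤) :
    ∃ A : ℝ≥0∞, A < ⊤ ∧ ∀ r, 0 < r → majorant ⌊ρ⌋₊ μ r ≤
      c * valironConstant ρ * ENNReal.ofReal (r ^ ρ) +
        A * ENNReal.ofReal (kernelMax ⌊ρ⌋₊ (2 * Real.exp 1 * r)) := by
  obtain ⟨R, hR⟩ := eventually_atTop.1 (eventually_le_of_growthType_lt h)
  set ν := exteriorPart μ
  refine ⟨radialCount ν R, (radialCount_exteriorPart_le μ R).trans_lt
    (radialCount_lt_top (h.trans hc) R), fun r hr => ?_⟩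
  set q := ⌊ρ⌋₊ with hq
  have hM : kernelMax q r ≤ kernelMax q (2 * Real.exp 1 * r) := by
    refine kernelMax_mono hr.le ?_
    have := Real.one_le_exp (zero_le_one' ℝ)
    nlinarith
  calc majorant q μ r
      ≤ ∫⁻ t in Ioi (0 : ℝ), (c * (ENNReal.ofReal ((r / t) ^ ρ) *
          ENNReal.ofReal (kernelMaxDeriv q t)) + radialCount ν R * (Ioc 0 r).indicator
            (fun t => ENNReal.ofReal (kernelMaxDeriv q t)) t) := by
        refine setLIntegral_mono' measurableSet_Ioi fun t ht => ?_
        have hle := le_rpow_add_indicator (radialCount_mono ν) (r := r)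
          (radialCount_exteriorPart_one μ) (fun s hs => (radialCount_exteriorPart_le μ s).trans
            ((EReal.toENNReal_coe (x := radialCount μ s)).symm.trans_le (hR s hs))) ht
        refine (mul_le_mul_left hle _).trans_eq ?_
        rw [add_mul, mul_assoc]
        congr 1
        by_cases h : t ∈ Ioc 0 r <;> simp [h]
    _ = c * (ENNReal.ofReal (r ^ ρ) * valironConstant ρ) +
          radialCount ν R * ENNReal.ofReal (kernelMax q r) := by
        rw [lintegral_add_left', lintegral_const_mul' _ _ hc.ne,
          lintegral_ofReal_div_rpow_mul_kernelMaxDeriv ρ hr, lintegral_const_mul',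
          setLIntegral_indicator measurableSet_Ioc, inter_eq_left.2 Ioc_subset_Ioi_self,
          lintegral_kernelMaxDeriv q hr.le]
        · exact ((radialCount_exteriorPart_le μ R).trans_lt
            (radialCount_lt_top (h.trans hc) R)).ne
        · exact ((by fun_prop : Measurable fun t : ℝ => ENNReal.ofReal ((r / t) ^ ρ)).aemeasurable.mul
            (measurable_kernelMaxDeriv_of_pos q).ennreal_ofReal).const_mul c
    _ ≤ _ := by
        rw [mul_assoc c, mul_comm (valironConstant ρ)]
        gcongr

lemma averagedCount_exteriorPart_le (μ : Measure ℂ) (t : ℝ) :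
    averagedCount (exteriorPart μ) t ≤ averagedCount μ t :=
  lintegral_mono fun _ => ENNReal.div_le_div_right (radialCount_exteriorPart_le μ _) _

lemma averagedCount_exteriorPart_one (μ : Measure ℂ) : averagedCount (exteriorPart μ) 1 = 0 := by
  rw [averagedCount, setLIntegral_congr_fun (g := fun _ => 0) measurableSet_Ioc, lintegral_zero]
  intro s hs
  have : radialCount (exteriorPart μ) s = 0 :=
    le_antisymm ((radialCount_mono _ hs.2).trans_eq (radialCount_exteriorPart_one μ)) zero_le
  simp [this]

lemma lintegral_Ioc_rpow_div {ρ : ℝ} (hρ : 0 < ρ) {s : ℝ} (hs : 0 < s) :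
    ∫⁻ x in Ioc 0 s, ENNReal.ofReal (ρ * x ^ ρ) / ENNReal.ofReal x = ENNReal.ofReal (s ^ ρ) := by
  have hi : IntervalIntegrable (fun x : ℝ => ρ * x ^ (ρ - 1)) volume 0 s :=
    (intervalIntegral.intervalIntegrable_rpow' (by linarith)).const_mul ρ
  have e : ∀ x ∈ Ioc 0 s, ENNReal.ofReal (ρ * x ^ ρ) / ENNReal.ofReal x =
      ENNReal.ofReal (ρ * x ^ (ρ - 1)) := fun x hx => by
    rw [← ENNReal.ofReal_div_of_pos hx.1, Real.rpow_sub_one hx.1.ne', mul_div_assoc]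
  rw [setLIntegral_congr_fun measurableSet_Ioc e, ← ofReal_integral_eq_lintegral_ofReal hi.1,
    ← intervalIntegral.integral_of_le hs.le, intervalIntegral.integral_const_mul,
    integral_rpow (Or.inl (by linarith))]
  · congr 1
    simp only [sub_add_cancel]
    rw [Real.zero_rpow hρ.ne', sub_zero]
    field_simp
  · filter_upwards [ae_restrict_mem measurableSet_Ioc] with x hx
    have := hx.1
    positivity

lemma stieltjesMeasure_mul_kernelMaxDeriv_Ioc_le (q : ℕ) {r : ℝ} (hr : 0 < r) :
    stieltjesMeasure (fun s => s * kernelMaxDeriv q s) (Ioc 0 r) ≤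
      ENNReal.ofReal (kernelMax q (2 * Real.exp 1 * r)) := by
  rw [stieltjesMeasure_mul_kernelMaxDeriv_Ioc, Monotone.stieltjesFunction_eq]
  -- The mass is a right limit at `r`, bounded by the value at `2r`; convexity adds the factor `e`.
  refine ENNReal.ofReal_le_ofReal (((monotone_max_mul_kernelMaxDeriv q).rightLim_le
    (show r < 2 * r by linarith)).trans ?_)
  rw [max_eq_left (by positivity)]
  refine (mul_kernelMaxDeriv_le q (by positivity)).trans_eq ?_
  congr 1
  ring

lemma exists_majorant_le_of_averagedType_lt {ρ : ℝ} (hρ : 0 < ρ) {μ : Measure ℂ}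
    {c : ℝ≥0∞} (h : averagedType ρ μ < c) (hc : c < ⊤) :
    ∃ A : ℝ≥0∞, A < ⊤ ∧ ∀ r, 0 < r → majorant ⌊ρ⌋₊ μ r ≤
      c * (ENNReal.ofReal ρ * valironConstant ρ) * ENNReal.ofReal (r ^ ρ) +
        A * ENNReal.ofReal (kernelMax ⌊ρ⌋₊ (2 * Real.exp 1 * r)) := by
  obtain ⟨R, hR⟩ := eventually_atTop.1 (eventually_le_of_growthType_lt h)
  set ν := exteriorPart μ
  have hA : averagedCount ν R < ⊤ := by
    refine (averagedCount_exteriorPart_le μ R).trans_lt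
      (((EReal.toENNReal_coe (x := averagedCount μ R)).symm.trans_le (hR R le_rfl)).trans_lt ?_)
    exact ENNReal.mul_lt_top hc ENNReal.ofReal_lt_top
  refine ⟨averagedCount ν R, hA, fun r hr => ?_⟩
  set q := ⌊ρ⌋₊ with hq
  set γ := stieltjesMeasure fun s => s * kernelMaxDeriv q s with hγ
  -- Integration by parts for the density `ρ x^ρ / x`, whose primitive is `s^ρ`; the factor `ρ` of
  -- the second bound arises here.
  have hpow : ∫⁻ t in Ioi (0 : ℝ), ENNReal.ofReal ((r / t) ^ ρ) ∂γ =
      ENNReal.ofReal ρ * (ENNReal.ofReal (r ^ ρ) * valironConstant ρ) := by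
    have h1 := (lintegral_primitive_stieltjesMeasure q
      (n := fun x => ENNReal.ofReal (ρ * x ^ ρ)) (by fun_prop) hr).1
    rw [setLIntegral_congr_fun measurableSet_Ioi fun t ht =>
      lintegral_Ioc_rpow_div hρ (div_pos hr ht)] at h1
    rw [h1, ← lintegral_ofReal_div_rpow_mul_kernelMaxDeriv ρ hr,
      ← lintegral_const_mul' _ _ ENNReal.ofReal_ne_top]
    refine lintegral_congr fun t => ?_
    rw [ENNReal.ofReal_mul hρ.le, mul_assoc]
  calc majorant q μ r = ∫⁻ t in Ioi (0 : ℝ), averagedCount ν (r / t) ∂γ :=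
        ((lintegral_primitive_stieltjesMeasure q (radialCount_mono ν).measurable hr).1).symm
    _ ≤ ∫⁻ t in Ioi (0 : ℝ), (c * ENNReal.ofReal ((r / t) ^ ρ) +
          (Ioc 0 r).indicator (fun _ => averagedCount ν R) t) ∂γ := by
        refine setLIntegral_mono' measurableSet_Ioi fun t ht => ?_
        refine le_rpow_add_indicator (averagedCount_mono ν)
          (averagedCount_exteriorPart_one μ) (fun s hs => ?_) ht
        refine (averagedCount_exteriorPart_le μ s).trans ?_
        simpa using hR s hs
    _ = c * (ENNReal.ofReal ρ * (ENNReal.ofReal (r ^ ρ) * valironConstant ρ)) +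
          averagedCount ν R * γ (Ioc 0 r) := by
        rw [lintegral_add_left (by fun_prop), lintegral_const_mul' _ _ hc.ne, hpow,
          setLIntegral_indicator measurableSet_Ioc, inter_eq_left.2 Ioc_subset_Ioi_self,
          setLIntegral_const]
    _ ≤ _ := by
        rw [mul_assoc c, mul_assoc (ENNReal.ofReal ρ), mul_comm (valironConstant ρ)]
        gcongr
        exact stieltjesMeasure_mul_kernelMaxDeriv_Ioc_le q hr

/-- The integral of `ds/s` over `[t, e t]` is one and the counting function is increasing. -/
lemma radialCount_le_averagedCount (μ : Measure ℂ) {t : ℝ} (ht : 0 < t) :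
    radialCount μ t ≤ averagedCount μ (Real.exp 1 * t) := by
  have hte : t ≤ Real.exp 1 * t := by
    have := Real.one_le_exp (zero_le_one' ℝ)
    nlinarith
  have hpos : ∀ x ∈ Ioc t (Real.exp 1 * t), 0 < x := fun x hx => ht.trans hx.1
  have hi : IntervalIntegrable (fun x : ℝ => x⁻¹) volume t (Real.exp 1 * t) := by
    refine intervalIntegral.intervalIntegrable_inv (fun x hx => ?_) continuousOn_id
    rw [uIcc_of_le hte] at hx
    exact (ht.trans_le hx.1).ne'
  have h1 : ∫⁻ s in Ioc t (Real.exp 1 * t), (ENNReal.ofReal s)⁻¹ = 1 := by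
    rw [setLIntegral_congr_fun measurableSet_Ioc fun s hs =>
        (ENNReal.ofReal_inv_of_pos (hpos s hs)).symm,
      ← ofReal_integral_eq_lintegral_ofReal hi.1, ← intervalIntegral.integral_of_le hte,
      integral_inv_of_pos ht (by positivity), mul_div_cancel_right₀ _ ht.ne', Real.log_exp,
      ENNReal.ofReal_one]
    filter_upwards [ae_restrict_mem measurableSet_Ioc] with x hx
    exact (inv_pos.2 (hpos x hx)).le
  calc radialCount μ t = ∫⁻ s in Ioc t (Real.exp 1 * t), radialCount μ t * (ENNReal.ofReal s)⁻¹ := by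
        rw [lintegral_const_mul _ (by fun_prop), h1, mul_one]
    _ ≤ ∫⁻ s in Ioc t (Real.exp 1 * t), radialCount μ s / ENNReal.ofReal s :=
        setLIntegral_mono' measurableSet_Ioc fun s hs =>
          mul_le_mul_left (radialCount_mono μ hs.1.le) _
    _ ≤ _ := lintegral_mono_set (Ioc_subset_Ioc_left ht.le)

lemma measureType_lt_top_of_averagedType_lt_top {ρ : ℝ} {μ : Measure ℂ}
    (h : averagedType ρ μ < ⊤) : measureType ρ μ < ⊤ := by
  obtain ⟨c, hc, hc'⟩ := exists_between h
  have hev := (tendsto_id.const_mul_atTop (Real.exp_pos 1)).eventually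
    (eventually_le_of_growthType_lt hc)
  refine lt_of_le_of_lt (growthType_le_of_eventually_le
    (c := c * ENNReal.ofReal (Real.exp 1 ^ ρ)) ?_)
    (ENNReal.mul_lt_top hc' ENNReal.ofReal_lt_top)
  filter_upwards [hev, eventually_gt_atTop 0] with t ht ht0
  simp only [EReal.toENNReal_coe, id] at ht ⊢
  refine (radialCount_le_averagedCount μ ht0).trans (ht.trans_eq ?_)
  rw [Real.mul_rpow (Real.exp_pos 1).le ht0.le, ENNReal.ofReal_mul (by positivity), mul_assoc]

/-! ### Comparison of a subharmonic function with its potential. -/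

section Growth

open InnerProductSpace Real

lemma exists_mollifier : ∃ a : ℝ → ℝ, ContDiff ℝ ∞ a ∧ (∀ x, 1 ≤ x → a x = 0) ∧
    (∀ x, 0 ≤ a x) ∧ ∫ z, radialFunction a z = 1 := by
  set b : ℝ → ℝ := fun x => expNegInvGlue (1 - x)
  have hb : ContDiff ℝ ∞ b := expNegInvGlue.contDiff.comp (contDiff_const.sub contDiff_id)
  have hb1 : ∀ x, 1 ≤ x → b x = 0 := fun x hx => expNegInvGlue.zero_of_nonpos (by linarith)
  have hb0 : ∀ x, 0 ≤ b x := fun x => expNegInvGlue.nonneg _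
  have hpos : 0 < ∫ z, radialFunction b z := by
    refine (contDiff_radialFunction hb).continuous.integral_pos_of_hasCompactSupport_nonneg_nonzero
      (hasCompactSupport_radialFunction hb1) (fun z => hb0 _) (x := 0) ?_
    have : 0 < b 0 := expNegInvGlue.pos_of_pos (by norm_num)
    simpa [radialFunction] using this.ne'
  refine ⟨fun x => (∫ z, radialFunction b z)⁻¹ * b x, contDiff_const.mul hb,
    fun x hx => by simp [hb1 x hx], fun x => mul_nonneg (inv_pos.2 hpos).le (hb0 x), ?_⟩
  have : ∀ z, radialFunction (fun x => (∫ z, radialFunction b z)⁻¹ * b x) z =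
      (∫ z, radialFunction b z)⁻¹ * radialFunction b z := fun z => rfl
  simp_rw [this]
  rw [integral_const_mul, inv_mul_cancel₀ hpos.ne']

variable {u : ℂ → EReal} {μ : Measure ℂ} {ρ : ℝ} {a : ℝ → ℝ}

lemma IsSubharmonic.exists_le_rpow (hu : IsSubharmonic u) (hρ : 0 ≤ ρ)
    (h : functionType ρ u < ⊤) :
    ∃ C : ℝ, 0 ≤ C ∧ ∀ z, u z ≤ ((C * (1 + ‖z‖) ^ ρ : ℝ) : EReal) := by
  obtain ⟨c, hc, hc'⟩ := exists_between h
  obtain ⟨R, hR⟩ := eventually_atTop.1 (eventually_le_of_growthType_lt hc)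
  obtain ⟨B, hB0, hB⟩ := hu.exists_le R
  refine ⟨B + c.toReal, by positivity, fun z => ?_⟩
  have h1 : 1 ≤ (1 + ‖z‖) ^ ρ := Real.one_le_rpow (by simp) hρ
  have hc0 : 0 ≤ c.toReal := ENNReal.toReal_nonneg
  rcases le_total ‖z‖ R with hz | hz
  · refine (hB z (by simpa using hz)).trans (EReal.coe_le_coe_iff.2 ?_)
    nlinarith
  · have hz1 : u z ≤ circleMax u ‖z‖ := le_iSup₂_of_le z (by simp) le_rfl
    have hz2 : (circleMax u ‖z‖).toENNReal ≤ ENNReal.ofReal ((B + c.toReal) * (1 + ‖z‖) ^ ρ) := by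
      refine (hR _ hz).trans ?_
      rw [← ENNReal.ofReal_toReal hc'.ne, ← ENNReal.ofReal_mul hc0, ENNReal.toReal_ofReal hc0]
      refine ENNReal.ofReal_le_ofReal (mul_le_mul (by linarith) ?_ (by positivity) (by positivity))
      exact Real.rpow_le_rpow (by positivity) (by linarith) hρ
    calc u z ≤ ((circleMax u ‖z‖).toENNReal : EReal) := hz1.trans
          ((le_max_right _ _).trans_eq EReal.coe_toENNReal_eq_max.symm)
      _ ≤ ((ENNReal.ofReal ((B + c.toReal) * (1 + ‖z‖) ^ ρ) : ℝ≥0∞) : EReal) :=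
        EReal.coe_ennreal_le_coe_ennreal_iff.2 hz2
      _ = _ := by rw [EReal.coe_ennreal_ofReal, max_eq_left (by positivity)]

lemma mollify_le_of_le_rpow (ha : ContDiff ℝ ∞ a) (h1 : ∀ x, 1 ≤ x → a x = 0)
    (hpos : ∀ x, 0 ≤ a x) (hone : ∫ z, radialFunction a z = 1) {v : ℂ → ℝ}
    (hv : LocallyIntegrable v) {C : ℝ} (hC : 0 ≤ C) (hρ : 0 ≤ ρ)
    (hle : ∀ z, v z ≤ C * (1 + ‖z‖) ^ ρ) (z : ℂ) :
    mollify a v z ≤ C * (2 + ‖z‖) ^ ρ := by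
  have hψ := continuous_mollifier_sub ha z
  have hc := hasCompactSupport_mollifier_sub h1 z
  calc mollify a v z ≤ ∫ ζ, (C * (2 + ‖z‖) ^ ρ) * radialFunction a (ζ - z) := by
        refine integral_mono (integrable_mul_radialFunction ha h1 hv z)
          ((hψ.integrable_of_hasCompactSupport hc).const_mul _) fun ζ => ?_
        by_cases hζ : 1 ≤ ‖ζ - z‖
        · simp [radialFunction_eq_zero h1 hζ]
        · refine mul_le_mul_of_nonneg_right ((hle ζ).trans ?_) (hpos _)
          have := norm_sub_norm_le ζ z
          exact mul_le_mul_of_nonneg_left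
            (Real.rpow_le_rpow (by positivity) (by linarith) hρ) hC
    _ = _ := by
        rw [integral_const_mul, integral_sub_right_eq_self (fun ζ => radialFunction a ζ) z, hone,
          mul_one]

lemma exists_majorant_le_rpow (hρ : 0 < ρ) (hn : ∀ n : ℕ, ρ ≠ n) (h : measureType ρ μ < ⊤) :
    ∃ C : ℝ, 0 ≤ C ∧ ∀ r, 1 ≤ r → (majorant ⌊ρ⌋₊ μ r).toReal ≤ C * r ^ ρ := by
  obtain ⟨c, hc, hc'⟩ := exists_between h
  obtain ⟨A, hA, hle⟩ := exists_majorant_le_of_measureType_lt hc hc'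
  obtain ⟨K, hK, hKle⟩ := exists_kernelMax_le_rpow hρ (Nat.floor_le hρ.le)
  set x := (c * valironConstant ρ).toReal with hx
  have hx' : c * valironConstant ρ = ENNReal.ofReal x :=
    (ENNReal.ofReal_toReal (ENNReal.mul_lt_top hc' (valironConstant_lt_top hρ hn)).ne).symm
  have hx0 : 0 ≤ x := ENNReal.toReal_nonneg
  have hA0 : 0 ≤ A.toReal := ENNReal.toReal_nonneg
  refine ⟨x + A.toReal * (K * (2 * Real.exp 1) ^ ρ), by positivity, fun r hr => ?_⟩
  have hr0 : 0 < r := zero_lt_one.trans_le hr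
  have he := Real.one_le_exp (zero_le_one' ℝ)
  refine ENNReal.toReal_le_of_le_ofReal (by positivity) ((hle r hr0).trans ?_)
  rw [hx', ← ENNReal.ofReal_toReal hA.ne, ← ENNReal.ofReal_mul hx0, ← ENNReal.ofReal_mul hA0,
    ENNReal.toReal_ofReal hA0, ← ENNReal.ofReal_add (by positivity)
      (mul_nonneg hA0 (kernelMax_nonneg _ (by positivity)))]
  refine ENNReal.ofReal_le_ofReal ?_
  rw [add_mul, mul_assoc A.toReal, mul_assoc K, ← Real.mul_rpow (by positivity) hr0.le]
  gcongr
  exact hKle _ (by nlinarith)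

lemma exists_mollify_potential_le_rpow [IsLocallyFiniteMeasure μ] (hρ : 0 < ρ)
    (hn : ∀ n : ℕ, ρ ≠ n) (h : measureType ρ μ < ⊤) (ha : ContDiff ℝ ∞ a)
    (h1 : ∀ x, 1 ≤ x → a x = 0) (hpos : ∀ x, 0 ≤ a x) (hone : ∫ z, radialFunction a z = 1) :
    ∃ C : ℝ, 0 ≤ C ∧ ∀ z, mollify a (potential ⌊ρ⌋₊ μ) z ≤ C * (2 + ‖z‖) ^ ρ := by
  obtain ⟨C, hC, hle⟩ := exists_majorant_le_rpow hρ hn h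
  refine ⟨(radialCount μ 1).toReal * (1 / ρ) + C, by positivity, fun z => ?_⟩
  refine (mollify_potential_le hρ.le h ha h1 hpos hone z).trans ?_
  rw [add_mul, mul_assoc]
  refine add_le_add (mul_le_mul_of_nonneg_left ?_ ENNReal.toReal_nonneg) ?_
  · refine (Real.log_le_rpow_div (by positivity) hρ).trans_eq ?_
    rw [show ‖z‖ + 1 + 1 = 2 + ‖z‖ by ring]
    ring
  · exact (hle (‖z‖ + 1) (by simp)).trans (mul_le_mul_of_nonneg_left
      (Real.rpow_le_rpow (by positivity) (by linarith) hρ.le) hC)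

/-- The difference of two functions of order at most `ρ < q + 1` grows at most like `|z| ^ q` if
it is harmonic. -/
lemma exists_abs_sub_le_of_harmonic {g₁ g₂ : ℂ → ℝ} {q : ℕ} {C : ℝ} (hρ : 0 ≤ ρ)
    (hρq : ρ < q + 1) (hc₁ : Continuous g₁) (hc₂ : Continuous g₂)
    (hg : HarmonicOnNhd (fun z => g₁ z - g₂ z) univ)
    (hmean : ∀ R, 0 < R → g₁ 0 ≤ circleAverage g₁ 0 R) (hC : 0 ≤ C)
    (h₁ : ∀ z, g₁ z ≤ C * (2 + ‖z‖) ^ ρ) (h₂ : ∀ z, g₂ z ≤ C * (2 + ‖z‖) ^ ρ) :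
    ∃ C', ∀ z, |g₁ z - g₂ z| ≤ C' * (1 + ‖z‖) ^ q := by
  refine exists_abs_le_of_circleAverage_abs_le
    (C := 4 * (C * 3 ^ ρ) + (|g₁ 0| + |g₂ 0|)) hg hρq fun R hR => ?_
  have hR0 : 0 < R := zero_lt_one.trans_le hR
  set B := C * (2 + R) ^ ρ
  have hB : B ≤ C * 3 ^ ρ * R ^ ρ := by
    rw [mul_assoc, ← Real.mul_rpow (by norm_num) hR0.le]
    simp only [B]
    gcongr
    linarith
  have hB0 : 0 ≤ B := by positivity
  have hRρ : 1 ≤ R ^ ρ := Real.one_le_rpow hR hρ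
  have hi : ∀ {f : ℂ → ℝ}, Continuous f → CircleIntegrable f 0 R := fun hf =>
    hf.continuousOn.circleIntegrable hR0.le
  have hgm : circleAverage (fun z => g₁ z - g₂ z) 0 R = g₁ 0 - g₂ 0 :=
    InnerProductSpace.HarmonicOnNhd.circleAverage_eq (hg.mono (subset_univ _))
  have hsub : circleAverage (fun z => g₁ z - g₂ z) 0 R =
      circleAverage g₁ 0 R - circleAverage g₂ 0 R := circleAverage_fun_sub (hi hc₁) (hi hc₂)
  -- Since `|g₁ - g₂| = 2 max(g₁, g₂) - (g₁ + g₂)`, upper bounds for both functions and lower bounds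
  -- for their means suffice. The mean of `g₁` is at least `g₁(0)`, and harmonicity of the
  -- difference gives the same for `g₂`.
  have hle : circleAverage (fun z => |g₁ z - g₂ z|) 0 R ≤
      circleAverage (fun z => 4 * B - (g₁ z + g₂ z)) 0 R := by
    refine circleAverage_mono (hi (by fun_prop)) (hi (by fun_prop)) fun z hz => ?_
    have hzR : ‖z‖ = R := by simpa [abs_of_pos hR0] using hz
    have k₁ := h₁ z
    have k₂ := h₂ z
    rw [hzR] at k₁ k₂
    rw [abs_le]
    constructor <;> linarith
  have heq : circleAverage (fun z => 4 * B - (g₁ z + g₂ z)) 0 R =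
      4 * B - (circleAverage g₁ 0 R + circleAverage g₂ 0 R) := by
    rw [circleAverage_fun_sub (hi continuous_const) (hi (by fun_prop)), circleAverage_const,
      circleAverage_fun_add (hi hc₁) (hi hc₂)]
  have hm := hmean R hR0
  have e₁ := neg_abs_le (g₁ 0)
  have e₂ := neg_abs_le (g₂ 0)
  have h0 : 0 ≤ |g₁ 0| + |g₂ 0| := by positivity
  calc circleAverage (fun z => |g₁ z - g₂ z|) 0 R
      ≤ 4 * B + (|g₁ 0| + |g₂ 0|) := by linarith
    _ ≤ _ := by nlinarith

lemma laplacian_radialFunction_sub (ha : ContDiff ℝ ∞ a) (z ζ : ℂ) :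
    Laplacian.laplacian (fun ζ => radialFunction a (ζ - z)) ζ = radialLaplacian a ‖ζ - z‖ := by
  rw [← laplacian_radialFunction ha, laplacian_eq_fderiv_fderiv, laplacian_eq_fderiv_fderiv]
  · simp only [fderiv_comp_sub]
    rw [fderiv_comp_sub (f := fun y => fderiv ℝ (radialFunction a) y 1),
      fderiv_comp_sub (f := fun y => fderiv ℝ (radialFunction a) y Complex.I)]
  · exact (contDiff_radialFunction ha).of_le (by norm_cast)
  · exact ((contDiff_radialFunction ha).comp (contDiff_id.sub contDiff_const)).of_le
      (by norm_cast)

lemma mollify_sub (ha : ContDiff ℝ ∞ a) (h1 : ∀ x, 1 ≤ x → a x = 0) {v w : ℂ → ℝ}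
    (hv : LocallyIntegrable v) (hw : LocallyIntegrable w) (z : ℂ) :
    mollify a (fun ζ => v ζ - w ζ) z = mollify a v z - mollify a w z := by
  simp only [mollify, sub_mul]
  exact integral_sub (integrable_mul_radialFunction ha h1 hv z)
    (integrable_mul_radialFunction ha h1 hw z)

/-- The defining property of the Riesz measure and the Green formula for the potential give the two
mollifications the same Laplacian. -/
lemma harmonicOnNhd_mollify_sub_potential (hu : IsSubharmonic u) (hne : ∃ z, u z ≠ ⊥)
    (hμ : IsRieszMeasure u μ) (hρ : 0 ≤ ρ) (h : measureType ρ μ < ⊤) (ha : ContDiff ℝ ∞ a)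
    (h1 : ∀ x, 1 ≤ x → a x = 0) :
    HarmonicOnNhd (fun z => mollify a (fun z => (u z).toReal) z -
      mollify a (potential ⌊ρ⌋₊ μ) z) univ := by
  have := hμ.locallyFinite
  have hv := (hu.locallyIntegrable hne).2
  have hU := locallyIntegrable_potential hρ h
  have key := harmonicOnNhd_mollify ha h1 (hv.sub hU) fun z => ?_
  · refine (funext fun z => mollify_sub ha h1 hv hU z) ▸ key
  · simp only [Pi.sub_apply, sub_mul]
    rw [integral_sub (integrable_mul_radialLaplacian ha h1 hv z)
      (integrable_mul_radialLaplacian ha h1 hU z), integral_potential_mul_radialLaplacian hρ h ha h1,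
      ← hμ.integral_laplacian (fun ζ => radialFunction a (ζ - z))
        ((contDiff_radialFunction ha).comp (contDiff_id.sub contDiff_const))
        (hasCompactSupport_mollifier_sub h1 z)]
    simp_rw [laplacian_radialFunction_sub ha z]
    exact sub_self _

/-- Here `u` is at most its mollification, which is the mollified potential plus a harmonic function
of growth at most `|z|^q`. -/
lemma IsSubharmonic.exists_le_majorant (hu : IsSubharmonic u) (hne : ∃ z, u z ≠ ⊥)
    (hμ : IsRieszMeasure u μ) (hρ : 0 < ρ) (hn : ∀ n : ℕ, ρ ≠ n) (hT : functionType ρ u < ⊤)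
    (h : measureType ρ μ < ⊤) :
    ∃ C : ℝ, 0 ≤ C ∧ ∀ z, u z ≤ ((C * (1 + ‖z‖) ^ ⌊ρ⌋₊ +
      ((radialCount μ 1).toReal * Real.log (‖z‖ + 1 + 1) +
        (majorant ⌊ρ⌋₊ μ (‖z‖ + 1)).toReal) : ℝ) : EReal) := by
  have := hμ.locallyFinite
  obtain ⟨a, ha, h1, hpos, hone⟩ := exists_mollifier
  have hv := (hu.locallyIntegrable hne).2
  have hU := locallyIntegrable_potential hρ.le h
  obtain ⟨C₁, hC₁, hle₁⟩ := hu.exists_le_rpow hρ.le hT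
  obtain ⟨C₂, hC₂, hle₂⟩ := exists_mollify_potential_le_rpow hρ hn h ha h1 hpos hone
  have hle₁' : ∀ z, (u z).toReal ≤ C₁ * (1 + ‖z‖) ^ ρ := fun z => by
    by_cases hz : u z = ⊥
    · rw [hz, EReal.toReal_bot]
      positivity
    · exact EReal.toReal_le_toReal (hle₁ z) hz (EReal.coe_ne_top _)
  obtain ⟨C', hC'⟩ := exists_abs_sub_le_of_harmonic (q := ⌊ρ⌋₊) (C := C₁ + C₂) hρ.le
    (Nat.lt_floor_add_one ρ) (contDiff_mollify ha h1 hv).continuous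
    (contDiff_mollify ha h1 hU).continuous
    (harmonicOnNhd_mollify_sub_potential hu hne hμ hρ.le h ha h1)
    (fun R hR => hu.mollify_zero_le_circleAverage hne ha h1 hpos hR) (by positivity)
    (fun z => (mollify_le_of_le_rpow ha h1 hpos hone hv hC₁ hρ.le hle₁' z).trans
      (mul_le_mul_of_nonneg_right (by linarith) (by positivity)))
    (fun z => (hle₂ z).trans (mul_le_mul_of_nonneg_right (by linarith) (by positivity)))
  refine ⟨|C'|, abs_nonneg _, fun z => ?_⟩
  by_cases hz : u z = ⊥
  · simp [hz]
  rw [← EReal.coe_toReal (hu.lt_top z).ne hz]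
  refine EReal.coe_le_coe_iff.2 ((hu.le_mollify ha h1 hpos hone hz).trans ?_)
  have k₁ := (le_abs_self _).trans (hC' z)
  have k₂ := mollify_potential_le hρ.le h ha h1 hpos hone z
  have k₃ : C' * (1 + ‖z‖) ^ ⌊ρ⌋₊ ≤ |C'| * (1 + ‖z‖) ^ ⌊ρ⌋₊ :=
    mul_le_mul_of_nonneg_right (le_abs_self _) (by positivity)
  rw [majorant]
  linarith

end Growth

/-! ### Passage to the type. -/

lemma tendsto_rpow_add_rpow_div {ρ p : ℝ} (hp : p < ρ) (K x : ℝ) :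
    Tendsto (fun r : ℝ => (K * r ^ p + x * (r + 1) ^ ρ) / r ^ ρ) atTop (nhds x) := by
  have h1 : Tendsto (fun r : ℝ => K * r ^ (-(ρ - p))) atTop (nhds (K * 0)) :=
    (tendsto_rpow_neg_atTop (by linarith)).const_mul K
  have h2 : Tendsto (fun r : ℝ => x * (1 + r⁻¹) ^ ρ) atTop (nhds (x * (1 + 0) ^ ρ)) :=
    (((tendsto_inv_atTop_zero).const_add 1).rpow_const (Or.inl (by norm_num))).const_mul x
  have h3 := h1.add h2
  simp only [mul_zero, add_zero, Real.one_rpow, mul_one, zero_add] at h3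
  refine h3.congr' ?_
  filter_upwards [eventually_gt_atTop 0] with r hr
  rw [add_div, mul_div_assoc, mul_div_assoc, ← Real.rpow_sub hr, ← Real.div_rpow (by positivity) hr.le,
    neg_sub, add_div, div_self hr.ne', one_div]

lemma one_add_pow_le_rpow {q : ℕ} {p r : ℝ} (hqp : (q : ℝ) ≤ p) (hr : 1 ≤ r) :
    (1 + r) ^ q ≤ 2 ^ p * r ^ p := by
  rw [← Real.mul_rpow (by norm_num) (by linarith), ← Real.rpow_natCast]
  exact (Real.rpow_le_rpow_of_exponent_le (by linarith) hqp).trans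
    (Real.rpow_le_rpow (by positivity) (by linarith) ((Nat.cast_nonneg q).trans hqp))

/-- A bound for the integral of the counting function gives a bound for the type. -/
lemma IsSubharmonic.functionType_le {u : ℂ → EReal} {μ : Measure ℂ} {ρ : ℝ}
    (hu : IsSubharmonic u) (hne : ∃ z, u z ≠ ⊥) (hμ : IsRieszMeasure u μ) (hρ : 0 < ρ)
    (hn : ∀ n : ℕ, ρ ≠ n) (hT : functionType ρ u < ⊤) (h : measureType ρ μ < ⊤)
    {s A : ℝ≥0∞} (hs : s < ⊤) (hA : A < ⊤)
    (hle : ∀ r, 0 < r → majorant ⌊ρ⌋₊ μ r ≤ s * ENNReal.ofReal (r ^ ρ) +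
        A * ENNReal.ofReal (kernelMax ⌊ρ⌋₊ (2 * Real.exp 1 * r))) :
    functionType ρ u ≤ s := by
  obtain ⟨C, hC, hCle⟩ := hu.exists_le_majorant hne hμ hρ hn hT h
  set q := ⌊ρ⌋₊ with hq
  have hqρ : (q : ℝ) < ρ := lt_of_le_of_ne (Nat.floor_le hρ.le) (hn q).symm
  obtain ⟨p, hqp, hpρ⟩ := exists_between hqρ
  have hp : 0 < p := (Nat.cast_nonneg q).trans_lt hqp
  obtain ⟨L, hL, hLle⟩ := exists_kernelMax_le_rpow hp hqp.le
  have hs0 : 0 ≤ s.toReal := ENNReal.toReal_nonneg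
  have hA0 : 0 ≤ A.toReal := ENNReal.toReal_nonneg
  set m := (radialCount μ 1).toReal with hm
  have hm0 : 0 ≤ m := ENNReal.toReal_nonneg
  -- The summands collect the harmonic part, the logarithm (`r + 2 ≤ 3r`) and the kernel remainder
  -- (`r + 1 ≤ 2r`), all `O(r^p)` with `p < ρ`.
  set K := C * 2 ^ p + (m * (3 ^ p / p) + A.toReal * (L * (4 * Real.exp 1) ^ p)) with hK
  have he := Real.one_le_exp (zero_le_one' ℝ)
  have hmaj : ∀ r, 1 ≤ r → (majorant q μ (r + 1)).toReal ≤
      s.toReal * (r + 1) ^ ρ + A.toReal * (L * (4 * Real.exp 1) ^ p * r ^ p) := by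
    intro r hr
    have hr0 : 0 < r := zero_lt_one.trans_le hr
    refine ENNReal.toReal_le_of_le_ofReal (by positivity) ((hle (r + 1) (by linarith)).trans ?_)
    rw [ENNReal.ofReal_add (by positivity) (by positivity), ENNReal.ofReal_mul hs0,
      ENNReal.ofReal_mul hA0, ENNReal.ofReal_toReal hs.ne, ENNReal.ofReal_toReal hA.ne]
    gcongr
    calc kernelMax q (2 * Real.exp 1 * (r + 1)) ≤ kernelMax q (4 * Real.exp 1 * r) :=
          kernelMax_mono (by positivity) (by nlinarith)
      _ ≤ L * (4 * Real.exp 1 * r) ^ p := hLle _ (by nlinarith)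
      _ = _ := by rw [Real.mul_rpow (by positivity) hr0.le, mul_assoc]
  have hbound : ∀ r, 1 ≤ r → (circleMax u r).toENNReal ≤
      ENNReal.ofReal (K * r ^ p + s.toReal * (r + 1) ^ ρ) := by
    intro r hr
    have hr0 : 0 < r := zero_lt_one.trans_le hr
    rw [← EReal.real_coe_toENNReal]
    refine EReal.toENNReal_le_toENNReal (iSup₂_le fun z hz => (hCle z).trans
      (EReal.coe_le_coe_iff.2 ?_))
    rw [mem_sphere_zero_iff_norm.1 hz]
    have k₁ := mul_le_mul_of_nonneg_left (one_add_pow_le_rpow hqp.le hr) hC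
    have k₂ : m * Real.log (r + 1 + 1) ≤ m * (3 ^ p / p * r ^ p) := by
      refine mul_le_mul_of_nonneg_left ((Real.log_le_rpow_div (by positivity) hp).trans ?_) hm0
      rw [div_mul_eq_mul_div, ← Real.mul_rpow (by norm_num) hr0.le]
      gcongr
      linarith
    have k₃ := hmaj r hr
    rw [hK]
    linarith
  have hlim := ENNReal.tendsto_ofReal (tendsto_rpow_add_rpow_div hpρ K s.toReal)
  rw [ENNReal.ofReal_toReal hs.ne] at hlim
  rw [← hlim.limsup_eq]
  refine limsup_le_limsup ?_
  filter_upwards [eventually_ge_atTop 1] with r hr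
  rw [ENNReal.ofReal_div_of_pos (Real.rpow_pos_of_pos (by linarith) ρ)]
  exact ENNReal.div_le_div_right (hbound r hr) _

/-- Let `c` decrease to `T`. For `T = ∞` the hypothesis is empty, and the conclusion holds because
`S ≠ 0`. -/
lemma le_mul_of_forall_lt_mul {F S T : ℝ≥0∞} (hS0 : S ≠ 0) (hS : S ≠ ⊤)
    (h : ∀ c, T < c → c < ⊤ → F ≤ c * S) : F ≤ S * T := by
  by_contra! hlt
  rw [mul_comm, ← ENNReal.lt_div_iff_mul_lt (Or.inl hS0) (Or.inl hS)] at hlt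
  obtain ⟨c, hc, hc'⟩ := exists_between hlt
  refine absurd (h c hc (hc'.trans_le le_top)) (not_le.2 ?_)
  rwa [← ENNReal.lt_div_iff_mul_lt (Or.inl hS0) (Or.inl hS)]

theorem IsSubharmonic.functionType_bounds {u : ℂ → EReal} {μ : Measure ℂ} {ρ : ℝ}
    (hu : IsSubharmonic u) (hne : ∃ z, u z ≠ ⊥) (hμ : IsRieszMeasure u μ) (hρ : 0 < ρ)
    (hn : ∀ n : ℕ, ρ ≠ n) (hT : functionType ρ u < ⊤) :
    functionType ρ u ≤ valironConstant ρ * measureType ρ μ ∧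
      functionType ρ u ≤ ENNReal.ofReal ρ * valironConstant ρ * averagedType ρ μ := by
  have hS := valironConstant_lt_top hρ hn
  have hS' : ENNReal.ofReal ρ * valironConstant ρ < ⊤ :=
    ENNReal.mul_lt_top ENNReal.ofReal_lt_top hS
  constructor
  · refine le_mul_of_forall_lt_mul (valironConstant_ne_zero ρ) hS.ne fun c hc hc' => ?_
    obtain ⟨A, hA, hle⟩ := exists_majorant_le_of_measureType_lt hc hc'
    exact hu.functionType_le hne hμ hρ hn hT (hc.trans hc') (ENNReal.mul_lt_top hc' hS) hA hle
  · refine le_mul_of_forall_lt_mul (mul_ne_zero (ENNReal.ofReal_pos.2 hρ).ne'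
      (valironConstant_ne_zero ρ)) hS'.ne fun c hc hc' => ?_
    obtain ⟨A, hA, hle⟩ := exists_majorant_le_of_averagedType_lt hρ hc hc'
    -- The potential requires a finite type of `μ` itself, which finiteness of the averaged type
    -- provides.
    exact hu.functionType_le hne hμ hρ hn hT
      (measureType_lt_top_of_averagedType_lt_top (hc.trans hc')) (ENNReal.mul_lt_top hc' hS') hA hle

end Valiron

end

theorem mainTheorem1 (ρ : ℝ) (hρ : 0 < ρ) :
    -- bounds for the canonical integral of a measure whose support does not contain `0`
    (∀ μ : Measure ℂ, (0 : ℂ) ∉ μ.support → measureType ρ μ < ⊤ → ∀ z : ℂ,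
      -- the canonical integral is well defined, with a value in `[-∞, +∞)`
      ∫⁻ w, (primaryKernel ⌊ρ⌋₊ (z / w)).toENNReal ∂μ < ⊤ ∧
      -- in terms of the counting function
      (canonicalIntegral ⌊ρ⌋₊ μ z ≤
          ((∫⁻ t in Ioi (0 : ℝ), ENNReal.ofReal (kernelMax ⌊ρ⌋₊ (‖z‖ / t))
            ∂(stieltjesMeasure fun s => (radialCount μ s).toReal) : ℝ≥0∞) : EReal) ∧
        ∫⁻ t in Ioi (0 : ℝ), ENNReal.ofReal (kernelMax ⌊ρ⌋₊ (‖z‖ / t))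
            ∂(stieltjesMeasure fun s => (radialCount μ s).toReal) =
          ∫⁻ t in Ioi (0 : ℝ),
            radialCount μ (‖z‖ / t) * ENNReal.ofReal (kernelMaxDeriv ⌊ρ⌋₊ t) ∧
        ∫⁻ t in Ioi (0 : ℝ),
            radialCount μ (‖z‖ / t) * ENNReal.ofReal (kernelMaxDeriv ⌊ρ⌋₊ t) < ⊤) ∧
      -- in terms of the averaged counting function
      (canonicalIntegral ⌊ρ⌋₊ μ z ≤
          ((∫⁻ t in Ioi (0 : ℝ), ENNReal.ofReal (‖z‖ / t * kernelMaxDeriv ⌊ρ⌋₊ (‖z‖ / t))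
            ∂(stieltjesMeasure fun s => (averagedCount μ s).toReal) : ℝ≥0∞) : EReal) ∧
        ∫⁻ t in Ioi (0 : ℝ), ENNReal.ofReal (‖z‖ / t * kernelMaxDeriv ⌊ρ⌋₊ (‖z‖ / t))
            ∂(stieltjesMeasure fun s => (averagedCount μ s).toReal) =
          ∫⁻ t in Ioi (0 : ℝ), averagedCount μ (‖z‖ / t)
            ∂(stieltjesMeasure fun s => s * kernelMaxDeriv ⌊ρ⌋₊ s) ∧
        ∫⁻ t in Ioi (0 : ℝ), averagedCount μ (‖z‖ / t)
            ∂(stieltjesMeasure fun s => s * kernelMaxDeriv ⌊ρ⌋₊ s) < ⊤)) ∧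
    -- bounds for the type of a subharmonic function, at a non-integer order
    ((∀ n : ℕ, ρ ≠ n) →
      valironConstant ρ < ⊤ ∧
      ∀ u : ℂ → EReal, IsSubharmonic u → (∃ z, u z ≠ ⊥) → functionType ρ u < ⊤ →
        ∀ μ : Measure ℂ, IsRieszMeasure u μ →
          functionType ρ u ≤ valironConstant ρ * measureType ρ μ ∧
          functionType ρ u ≤ ENNReal.ofReal ρ * valironConstant ρ * averagedType ρ μ) := by
  exact ⟨fun μ h0 h z => canonicalIntegral_bounds hρ h0 h z, fun hn =>
    ⟨valironConstant_lt_top hρ hn, fun u hu hne hT μ hμ =>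
      hu.functionType_bounds hne hμ hρ hn hT⟩⟩
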